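/- **Setting.** Let $T=(T^{st})_{s,t}$ be an injective tensor of $\chi\times\chi$ matrices generating, at every length $N\ge 1$, a matrix product unitary $U=\sum \mathrm{Tr}[T^{s_1t_1}\cdots T^{s_Nt_N}]\,|s_1\dots s_N\rangle\langle t_1\dots t_N|$ with $U^2=\mathbb 1$. Let $A,B$ be injective MPS tensors with left inverses $\hat A,\hat B$ (contracting the physical legs of $\hat A$ and $A$, resp. $\hat B$ and $B$, gives the identity on the virtual legs) such that the contractions of $\hat A$ with $B$ and of $\hat B$ with $A$ vanish, and let $U\psi_A=\psi_B$, $U\psi_B=\psi_A$ for the periodic states $\psi_A,\psi_B$ at every length. Write $TA$ for $T$ stacked on $A$, i.e. $(TA)^s=\sum_t T^{st}\otimes A^t$, and similarly for other stacks. * $(V,\hat V)$ are fusion tensors: $\hat V\,(TT)^{m}\,V=\mathrm{id}^{\otimes m}$ on $m$ sites and $(TT)^{m+3}=(TT)\,V\,\mathrm{id}^{\otimes (m+1)}\,\hat V\,(TT)$ on $m+3$ sites, for all $m\ge0$. The anomaly index $\omega$ is the number with $\hat V_{\rm upper}\,(TTT)^{3}\,V_{\rm lower}=\omega\,T^{3}$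 on three sites ($\hat V$ closes the upper two of the three layers on the left, $V$ the lower two on the right). * $(W_B,\hat W_B)$ are action tensors from $A$ to $B$: $\hat W_B\,(TA)^mW_B=B^m$ and $(TA)^{m+3}=(TA)W_BB^{m+1}\hat W_B(TA)$ for all $m\ge0$; $(W_A,\hat W_A)$ are action tensors from $B$ to $A$ in the same sense. * $e_{AB},e_{BA}\neq0$ are domain wall tensors such that, for some $R$, on every periodic chain and for all sites $k<\ell$ at cyclic distance at least $R$ in both directions, $U$ maps the state with domain $A$ outside and $B$ between $k$ and $\ell$, with $e_{AB}$ at $k$ and $e_{BA}$ at $\ell$, to a multiple of the same state with the roles of $A$ and $B$ interchanged. The numbers $c_{AB},c_{BA}$ are defined by the three-site equations $$\hat W_B\,(TA)(Te_{AB})(TB)\,W_A=c_{AB}\;B\,e_{BA}\,A,\qquad \hat W_A\,(TB)(Te_{BA})(TA)\,W_B=c_{BA}\;A\,e_{AB}\,B .$$ * The left endpoint tensor is the sum of $e_{AB}\hat W_B$ and $e_{BA}\hat W_A$ with the lower MPS legs contracted with $\hat A$ and $\hat B$, respectively (applied to $A$ it gives $e_{AB}\hat W_B$, applied to $B$ it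 gives $e_{BA}\hat W_A$); the right endpoint tensor is built in the same way from $W_Be_{BA}$ and $W_Ae_{AB}$. $O^{[i,j]}$, $i<j$, is the MPU string with the left endpoint tensor at $i$, the right endpoint tensor at $j$ and $T$ on the sites in between. $O^{[i]}_x$ acts on a half chain of sites $0,\dots,L-1$: left endpoint tensor at $i$, $T$ on all sites to the right of $i$, and the open MPU leg at the right cut fixed to $x$. On the half chain, $\psi_A$ and $\psi_B$ denote the open MPS with arbitrary fixed values of the two outer virtual legs. **Theorem.** The numbers $\omega$, $c_{AB}$ and $c_{BA}$ exist and are unique, $\omega\in\{1,-1\}$ and $c_{AB}c_{BA}=\omega$. Moreover: 1. For $j+2\le i\le L-5$ and all $x,y$: $\;O^{[j]}_xO^{[i]}_y\psi_A=c_{AB}\,O^{[i]}_xO^{[j]}_y\psi_A\;$ and $\;O^{[j]}_xO^{[i]}_y\psi_B=c_{BA}\,O^{[i]}_xO^{[j]}_y\psi_B$. 2. For $k+2\le j$, $j+4\le i\le L-6$ and all $x,y,z$: $$O^{[k]}_zO^{[j]}_yO^{[i]}_x\psi_A=c_{AB}\,O^{[k]}_zO^{[i]}_yO^{[j]}_x\psi_A=\omega\,O^{[i]}_zO^{[k]}_yO^{[j]}_x\psi_A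 .$$ 3. On a periodic chain, for $i_2+2\le i_1$, $i_1+4\le j_1$, $j_1+2\le j_2$: $\;O^{[i_1,j_1]}O^{[i_2,j_2]}\psi_A=\omega\,O^{[i_2,j_2]}O^{[i_1,j_1]}\psi_A$. 4. If $\omega=-1$, there is $r\ne0$ with $|r|=|c_{AB}|$ such that after replacing $e_{BA}$ by $r\,e_{BA}$ all assumptions still hold and $c_{AB}=c_{BA}=\mathrm i$, so that both exchanges in (1) give the phase $\mathrm i$ (semionic statistics). 5. This happens for the CZX symmetry: let $T_0$ be the bond dimension $2$ tensor $T_0^{st}=\delta_{s,1-t}\sum_{l}(-1)^{s}(-1)^{ls}\,|l)(s|$ (with $s,t,l\in\{0,1\}$), which generates $\prod_i Z_i\,CZ_{i,i+1}\prod_iX_i$ on every periodic chain of qubits. Blocking two sites of $T_0$ gives a tensor for which a system as above with $\psi_A=|0\dots0\rangle$ and $\psi_B=|1\dots1\rangle$ exists, and every system as above with this tensor has $\omega=-1$. -/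

import Mathlib

open scoped Kronecker

noncomputable section

namespace MPUDomainWall

open Matrix

universe u v w z

/-! ### Tensors, matrix product states, matrix product operators -/

section Tensors

/-- The ordered matrix product `M k₁ * M k₂ * ⋯` over the sites `k₁ < k₂ < ⋯` of a chain of `N`
sites that satisfy `p`. -/
def siteProd {N : ℕ} {m : Type*} [Fintype m] [DecidableEq m]
    (p : Fin N → Prop) [DecidablePred p] (M : Fin N → Matrix m m ℂ) : Matrix m m ℂ :=
  (((List.finRange N).filter (fun k => decide (p k))).map M).prod

/-- The ordered matrix product `M 0 * M 1 * ⋯ * M (N - 1)`. -/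
def wordProd {N : ℕ} {m : Type*} [Fintype m] [DecidableEq m]
    (M : Fin N → Matrix m m ℂ) : Matrix m m ℂ :=
  (List.ofFn M).prod

/-- `Ahat` is a left inverse of the tensor `A`, seen as a map from the virtual to the physical
space: contracting the physical legs gives the identity on the virtual legs. -/
def IsLeftInverse {P m n : Type*} [Fintype P] [DecidableEq m] [DecidableEq n]
    (Ahat A : P → Matrix m n ℂ) : Prop :=
  ∀ a b c d, ∑ p, Ahat p a b * A p c d = if a = c ∧ b = d then 1 else 0

/-- The contraction of the physical legs of `Ahat` and `B` vanishes. -/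
def Annihilates {P m n m' n' : Type*} [Fintype P]
    (Ahat : P → Matrix m n ℂ) (B : P → Matrix m' n' ℂ) : Prop :=
  ∀ a b c d, ∑ p, Ahat p a b * B p c d = 0

/-- A tensor is injective if it has a left inverse. -/
def IsInjectiveTensor {P m n : Type*} [Fintype P] [DecidableEq m] [DecidableEq n]
    (A : P → Matrix m n ℂ) : Prop :=
  ∃ Ahat : P → Matrix m n ℂ, IsLeftInverse Ahat A

/-- The periodic matrix product state `∑ Tr[A^{s₁} ⋯ A^{s_N}] |s₁ … s_N⟩`. -/
def mps {P m : Type*} [Fintype m] [DecidableEq m] (A : P → Matrix m m ℂ) (N : ℕ) :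
    (Fin N → P) → ℂ :=
  fun s => (wordProd fun k => A (s k)).trace

/-- The matrix product state on `L` sites whose two outer virtual legs are cut open and fixed
to the values `a` and `b`. -/
def openMPS {P m : Type*} [Fintype m] [DecidableEq m] (A : P → Matrix m m ℂ) (L : ℕ) (a b : m) :
    (Fin L → P) → ℂ :=
  fun s => (wordProd fun k => A (s k)) a b

/-- The periodic matrix product operator
`∑ Tr[T^{s₁ t₁} ⋯ T^{s_N t_N}] |s₁ … s_N⟩⟨t₁ … t_N|`. -/
def mpo {P χ : Type*} [Fintype χ] [DecidableEq χ] (T : P → P → Matrix χ χ ℂ) (N : ℕ) :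
    Matrix (Fin N → P) (Fin N → P) ℂ :=
  Matrix.of fun s t => (wordProd fun k => T (s k) (t k)).trace

/-- `T` generates a matrix product unitary: the periodic operator is unitary at every length. -/
def IsMPU {P χ : Type*} [Fintype P] [DecidableEq P] [Fintype χ] [DecidableEq χ]
    (T : P → P → Matrix χ χ ℂ) : Prop :=
  ∀ N : ℕ, 0 < N → mpo T N ∈ Matrix.unitaryGroup (Fin N → P) ℂ

/-- One operator tensor `T` placed on top of a tensor `M` (physical output of `M` contracted
with physical input of `T`). The virtual legs are pairs (leg of `T`, leg of `M`). -/
def act {P χ m n : Type*} [Fintype P] (T : P → P → Matrix χ χ ℂ) (M : P → Matrix m n ℂ) (s : P) :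
    Matrix (χ × m) (χ × n) ℂ :=
  ∑ t, T s t ⊗ₖ M t

/-- Two operator tensors on top of each other; the first virtual component is the upper layer. -/
def stack₂ {P χ : Type*} [Fintype P] (T : P → P → Matrix χ χ ℂ) (s t : P) :
    Matrix (χ × χ) (χ × χ) ℂ :=
  act T (fun r => T r t) s

/-- Three operator tensors on top of each other, virtual legs (upper, (middle, lower)). -/
def stack₃ {P χ : Type*} [Fintype P] (T : P → P → Matrix χ χ ℂ) (s t : P) :
    Matrix (χ × (χ × χ)) (χ × (χ × χ)) ℂ :=
  act T (fun r => stack₂ T r t) s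

/-- `(V, Vhat)` is a pair of fusion tensors reducing the product of two tensors `T` to the
identity operator. -/
structure IsFusionPair {P χ : Type*} [Fintype P] [DecidableEq P] [Fintype χ] [DecidableEq χ]
    (T : P → P → Matrix χ χ ℂ) (V Vhat : χ × χ → ℂ) : Prop where
  reduce : ∀ (l : ℕ) (s t : Fin l → P),
    Vhat ⬝ᵥ ((wordProd fun k => stack₂ T (s k) (t k)) *ᵥ V) = if s = t then 1 else 0
  insert : ∀ (l : ℕ) (s t : Fin (l + 1) → P) (i j i' j' : P),
    stack₂ T i j * (wordProd fun k => stack₂ T (s k) (t k)) * stack₂ T i' j' =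
      (if s = t then (1 : ℂ) else 0) • (stack₂ T i j * vecMulVec V Vhat * stack₂ T i' j')

/-- `V` closing the lower two of three layers on the right. -/
def closeLower {χ : Type*} [DecidableEq χ] (V : χ × χ → ℂ) : Matrix (χ × (χ × χ)) χ ℂ :=
  Matrix.of fun q d => if q.1 = d then V q.2 else 0

/-- `Vhat` closing the upper two of three layers on the left. -/
def closeUpper {χ : Type*} [DecidableEq χ] (Vhat : χ × χ → ℂ) : Matrix χ (χ × (χ × χ)) ℂ :=
  Matrix.of fun d q => if q.2.2 = d then Vhat (q.1, q.2.1) else 0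

/-- `ω` is the anomaly index: it compares the two local decompositions of `(TT)T = T(TT)`. -/
def IsAnomalyIndex {P χ : Type*} [Fintype P] [Fintype χ] [DecidableEq χ]
    (T : P → P → Matrix χ χ ℂ) (V Vhat : χ × χ → ℂ) (ω : ℂ) : Prop :=
  ∀ i j i' j' i'' j'' : P,
    closeUpper Vhat * (stack₃ T i j * stack₃ T i' j' * stack₃ T i'' j'') * closeLower V =
      ω • (T i j * T i' j' * T i'' j'')

/-- `(W, What)` is a pair of action tensors reducing `T` acting on `A` to `B`. -/
structure IsActionPair {P χ α β : Type*} [Fintype P] [Fintype χ] [DecidableEq χ]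
    [Fintype α] [DecidableEq α] [Fintype β] [DecidableEq β]
    (T : P → P → Matrix χ χ ℂ) (A : P → Matrix α α ℂ) (B : P → Matrix β β ℂ)
    (W : Matrix (χ × α) β ℂ) (What : Matrix β (χ × α) ℂ) : Prop where
  reduce : ∀ (l : ℕ) (s : Fin l → P),
    What * (wordProd fun k => act T A (s k)) * W = wordProd fun k => B (s k)
  insert : ∀ (l : ℕ) (s : Fin (l + 1) → P) (i j : P),
    act T A i * (wordProd fun k => act T A (s k)) * act T A j =
      act T A i * W * (wordProd fun k => B (s k)) * What * act T A j

/-- The periodic state with domain `A` outside and domain `B` strictly between the sites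
`k < l`, with domain wall tensor `e` at `k` and `f` at `l`. -/
def pairState {P α β : Type*} [Fintype α] [DecidableEq α] [Fintype β] [DecidableEq β]
    (A : P → Matrix α α ℂ) (B : P → Matrix β β ℂ) (e : P → Matrix α β ℂ) (f : P → Matrix β α ℂ)
    {N : ℕ} (k l : Fin N) : (Fin N → P) → ℂ :=
  fun s => (siteProd (fun x => x < k) (fun x => A (s x)) * e (s k) *
    siteProd (fun x => k < x ∧ x < l) (fun x => B (s x)) * f (s l) *
    siteProd (fun x => l < x) (fun x => A (s x))).trace

end Tensors

/-! ### A `ℤ₂` symmetry exchanging two ground states, with domain walls -/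

/-- The tensors involved: the MPU tensor `T` with fusion tensors `V`, `Vhat`; the MPS tensors
`A`, `B` with left inverses `Ahat`, `Bhat`; the action tensors `(WB, WhatB)` (from `A` to `B`)
and `(WA, WhatA)` (from `B` to `A`); the domain wall tensors `eAB`, `eBA`. -/
structure DWData (P : Type u) (χ : Type v) (α : Type w) (β : Type z) where
  T : P → P → Matrix χ χ ℂ
  V : χ × χ → ℂ
  Vhat : χ × χ → ℂ
  A : P → Matrix α α ℂ
  B : P → Matrix β β ℂ
  Ahat : P → Matrix α α ℂ
  Bhat : P → Matrix β β ℂ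
  WB : Matrix (χ × α) β ℂ
  WhatB : Matrix β (χ × α) ℂ
  WA : Matrix (χ × β) α ℂ
  WhatA : Matrix α (χ × β) ℂ
  eAB : P → Matrix α β ℂ
  eBA : P → Matrix β α ℂ

namespace DWData

variable {P : Type u} {χ : Type v} {α : Type w} {β : Type z}
  [Fintype P] [DecidableEq P] [Fintype χ] [DecidableEq χ]
  [Fintype α] [DecidableEq α] [Fintype β] [DecidableEq β]

/-- The standing assumptions on the tensors. -/
structure IsDomainWallSystem (S : DWData P χ α β) : Prop where
  /-- `T` is injective and generates a unitary of order two at every length -/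
  injective_T : IsInjectiveTensor (fun p : P × P => S.T p.1 p.2)
  unitary : IsMPU S.T
  order_two : ∀ N : ℕ, 0 < N → mpo S.T N * mpo S.T N = 1
  fusion : IsFusionPair S.T S.V S.Vhat
  /-- the MPS tensors are injective with separately acting left inverses -/
  left_inverse_A : IsLeftInverse S.Ahat S.A
  left_inverse_B : IsLeftInverse S.Bhat S.B
  separate_AB : Annihilates S.Ahat S.B
  separate_BA : Annihilates S.Bhat S.A
  /-- the symmetry interchanges the two ground states -/
  map_A : ∀ N : ℕ, 0 < N → mpo S.T N *ᵥ mps S.A N = mps S.B N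
  map_B : ∀ N : ℕ, 0 < N → mpo S.T N *ᵥ mps S.B N = mps S.A N
  action_B : IsActionPair S.T S.A S.B S.WB S.WhatB
  action_A : IsActionPair S.T S.B S.A S.WA S.WhatA
  /-- the domain wall tensors do not vanish, and the symmetry maps a well separated pair of
  domain walls `A-B-A` to the pair `B-A-B` at the same sites, up to a factor -/
  eAB_ne_zero : S.eAB ≠ 0
  eBA_ne_zero : S.eBA ≠ 0
  map_pair : ∃ R : ℕ, ∀ (N : ℕ) (k l : Fin N), k < l → (k : ℕ) + R ≤ l → (l : ℕ) + R ≤ N + k →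
    ∃ c : ℂ, mpo S.T N *ᵥ pairState S.A S.B S.eAB S.eBA k l =
      c • pairState S.B S.A S.eBA S.eAB k l

/-- `ω` is the anomaly index of the symmetry. -/
def IsAnomaly (S : DWData P χ α β) (ω : ℂ) : Prop :=
  IsAnomalyIndex S.T S.V S.Vhat ω

/-- `c` is the factor `c_AB` of the local transformation of `e_AB` into `e_BA`. -/
def IsCAB (S : DWData P χ α β) (c : ℂ) : Prop :=
  ∀ i j k : P, S.WhatB * act S.T S.A i * act S.T S.eAB j * act S.T S.B k * S.WA =
    c • (S.B i * S.eBA j * S.A k)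

/-- `c` is the factor `c_BA` of the local transformation of `e_BA` into `e_AB`. -/
def IsCBA (S : DWData P χ α β) (c : ℂ) : Prop :=
  ∀ i j k : P, S.WhatA * act S.T S.B i * act S.T S.eBA j * act S.T S.A k * S.WB =
    c • (S.A i * S.eAB j * S.B k)

/-- Left endpoint tensor: physical output `s`, physical input `t`, MPU virtual leg `q` to its
right. On `A` it gives `e_AB` followed by `WhatB`, on `B` it gives `e_BA` followed by `WhatA`. -/
def leftEnd (S : DWData P χ α β) (s t : P) (q : χ) : ℂ :=
  (∑ a, ∑ a', (S.eAB s * S.WhatB) a (q, a') * S.Ahat t a a') +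
    ∑ b, ∑ b', (S.eBA s * S.WhatA) b (q, b') * S.Bhat t b b'

/-- Right endpoint tensor: MPU virtual leg `q` to its left. On `A` it gives `WB` followed by
`e_BA`, on `B` it gives `WA` followed by `e_AB`. -/
def rightEnd (S : DWData P χ α β) (s t : P) (q : χ) : ℂ :=
  (∑ a, ∑ a', (S.WB * S.eBA s) (q, a) a' * S.Ahat t a a') +
    ∑ b, ∑ b', (S.WA * S.eAB s) (q, b) b' * S.Bhat t b b'

/-- The truncated domain wall creation operator `O^[i]_x` on the left half chain of `L` sites:
endpoint tensor at `i`, MPU tensors on all sites to the right of `i`, and the MPU leg at the cut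
fixed to `x`. -/
def halfOp (S : DWData P χ α β) {L : ℕ} (i : Fin L) (x : χ) :
    Matrix (Fin L → P) (Fin L → P) ℂ :=
  Matrix.of fun s t =>
    if ∀ k, k < i → s k = t k then
      (S.leftEnd (s i) (t i) ᵥ* siteProd (fun k => i < k) (fun k => S.T (s k) (t k))) x
    else 0

/-- The operator `O^[i,j]` creating a pair of domain walls at the sites `i < j`. -/
def pairOp (S : DWData P χ α β) {N : ℕ} (i j : Fin N) :
    Matrix (Fin N → P) (Fin N → P) ℂ :=
  Matrix.of fun s t =>
    if ∀ k, k < i ∨ j < k → s k = t k then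
      (S.leftEnd (s i) (t i) ᵥ* siteProd (fun k => i < k ∧ k < j) (fun k => S.T (s k) (t k))) ⬝ᵥ
        S.rightEnd (s j) (t j)
    else 0

/-- The same data with the domain wall tensor `e_BA` rescaled by `r`. -/
def rescale (S : DWData P χ α β) (r : ℂ) : DWData P χ α β :=
  { S with eBA := fun p => r • S.eBA p }

end DWData

/-! ### The CZX symmetry -/

/-- The tensor of the CZX matrix product unitary: `X` first, then the two legs of the controlled
phases (the left one through the matrix `(-1)^(l s)`), then `Z`. -/
def czxTensor (s t : Fin 2) : Matrix (Fin 2) (Fin 2) ℂ :=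
  Matrix.of fun l r =>
    if s = 1 - t ∧ r = s then (-1 : ℂ) ^ (s : ℕ) * (-1) ^ ((l : ℕ) * (s : ℕ)) else 0

/-- The operator `∏ᵢ Zᵢ CZ_{i,i+1} ∏ᵢ Xᵢ` on a periodic chain of `N` qubits. -/
def czxOperator (N : ℕ) [NeZero N] : Matrix (Fin N → Fin 2) (Fin N → Fin 2) ℂ :=
  Matrix.diagonal (fun s => ∏ i, (-1 : ℂ) ^ (s i : ℕ) * (-1) ^ ((s i : ℕ) * (s (i + 1) : ℕ))) *
    Matrix.of (fun s t => if s = fun i => 1 - t i then 1 else 0)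

/-- Blocking two sites of a matrix product operator. -/
def blockTwo {P χ : Type*} [Fintype χ] (T : P → P → Matrix χ χ ℂ) (s t : P × P) :
    Matrix χ χ ℂ :=
  T s.1 t.1 * T s.2 t.2

/-- The bond dimension one tensor of the product state `|p⟩ ⊗ |p⟩ ⊗ ⋯`. -/
def productTensor {P : Type*} [DecidableEq P] (p : P) (s : P) : Matrix Unit Unit ℂ :=
  if s = p then 1 else 0

end MPUDomainWall

end

set_option linter.unusedSectionVars false

noncomputable section

namespace MPUDomainWall

open Matrix

/-! ### Tensors spanning the full matrix space -/

section Spanning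

variable {Q Q' m n : Type*} [Fintype Q] [Fintype Q']

/-! All tensor identities have one shape: a tensor `M` reduces to `N` by closing tensors `W`, `What`
(`Reduces`). Fusion of two operator layers and the action of one layer on `A` or `B` are of this
kind, a reduction survives under a further layer (`Reduces.lift`), and a closing tensor can be moved
along the chain site by site. Scalars arise because the centre of a matrix algebra is trivial: if
the `K q` span all matrices and `F q * K r = K q * F r`, then `F` is a multiple of `K`. This yields
`ω`, and also constants that compare, over `A` and over `B`, fusing two layers with letting them act
one after the other (`Reduces.compare`).

Sign of `ω`. Evaluating three layers over `A` in two ways shows that the comparison constants at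
right ends over `A` and over `B` differ by the factor `ω` (`associator_eq_anomaly_mul`).
Interchanging `A` and `B` gives the same relation backwards, so `ω * ω = 1`.

Product of the wall factors. Two layers over a wall `A…A e B…B`, closed by two successive actions at
each end, produce `c_AB c_BA`. Trading the actions for fusion tensors costs the left constant over
`A` and the right constant over `B`; fusion tensors do not see the bottom row and cross the wall
freely. Left and right constants over `A` are inverse to each other, so the total cost is `ω`
(`mul_eq_anomaly`).

Existence of the wall factors. The global transformation of a pair of walls is localized by
inserting reductions in every domain and then replacing the blocks of spanning tensors by arbitrary
matrices (`pair_local`). What is left is a product of two local tensors, one for each wall, equal to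
a nonzero multiple of the expected product; hence each factor is proportional to its own target.

Exchange. An endpoint on `A` leaves a closing tensor `WhatB` in front of the layered chain. If a
wall already stands to the right, `WhatB` has to cross it and picks up `c_AB` (`mulNet_wall_open`);
if the right operator acts second, nothing is crossed. The multiple exchanges count crossings in the
same way. Rescaling `e_BA` only redistributes the product `c_AB c_BA` between its two factors.

CZX. The blocked tensor flips spins and has virtual matrices of rank one (`IsFlip`), so all
conditions become identities between finitely many signs. -/

/-- Every matrix is a linear combination of the matrices `K q`. -/
def Spanning (K : Q → Matrix m n ℂ) : Prop :=
  ∀ X : Matrix m n ℂ, ∃ c : Q → ℂ, ∑ q, c q • K q = X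

theorem IsLeftInverse.spanning [Fintype m] [Fintype n] [DecidableEq m] [DecidableEq n]
    {Khat K : Q → Matrix m n ℂ} (h : IsLeftInverse Khat K) : Spanning K := by
  intro X
  refine ⟨fun q => ∑ a, ∑ b, X a b * Khat q a b, ?_⟩
  ext c d
  simp only [Matrix.sum_apply, Matrix.smul_apply, smul_eq_mul, Finset.sum_mul]
  rw [Finset.sum_comm]
  have : ∀ a b, ∑ q, X a b * Khat q a b * K q c d =
      X a b * if a = c ∧ b = d then 1 else 0 := by
    intro a b
    rw [← h a b c d, Finset.mul_sum]
    simp only [mul_assoc]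
  rw [Finset.sum_congr rfl fun a _ => Finset.sum_comm]
  simp only [this]
  rw [Finset.sum_eq_single c, Finset.sum_eq_single d] <;> simp +contextual

theorem Spanning.mul_right_cancel [Fintype n] [DecidableEq n] {l : Type*}
    {K : Q → Matrix n n ℂ} (hK : Spanning K) {Y Z : Matrix l n ℂ}
    (h : ∀ q, Y * K q = Z * K q) : Y = Z := by
  obtain ⟨c, hc⟩ := hK 1
  rw [← Matrix.mul_one Y, ← Matrix.mul_one Z, ← hc, Matrix.mul_sum, Matrix.mul_sum]
  simp [h]

theorem Spanning.mul_left_cancel [Fintype n] [DecidableEq n] {l : Type*}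
    {K : Q → Matrix n n ℂ} (hK : Spanning K) {Y Z : Matrix n l ℂ}
    (h : ∀ q, K q * Y = K q * Z) : Y = Z := by
  obtain ⟨c, hc⟩ := hK 1
  rw [← Matrix.one_mul Y, ← Matrix.one_mul Z, ← hc, Matrix.sum_mul, Matrix.sum_mul]
  simp [h]

theorem Spanning.trace_ext [Fintype n] [DecidableEq n]
    {K : Q → Matrix n n ℂ} (hK : Spanning K) {Y Z : Matrix n n ℂ}
    (h : ∀ q, (K q * Y).trace = (K q * Z).trace) : Y = Z := by
  refine Matrix.ext_iff_trace_mul_left.2 fun X => ?_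
  obtain ⟨c, rfl⟩ := hK X
  simp [Matrix.sum_mul, Matrix.trace_sum, h]

/-- One family expands the given matrix, the other is only needed to expand the identity. -/
theorem Spanning.mul [Fintype n] [DecidableEq n] {K : Q → Matrix n n ℂ} {K' : Q' → Matrix n n ℂ}
    (hK : Spanning K) (hK' : Spanning K') : Spanning fun q : Q × Q' => K q.1 * K' q.2 := by
  intro X
  obtain ⟨c, rfl⟩ := hK X
  obtain ⟨c', hc'⟩ := hK' 1
  refine ⟨fun q => c q.1 * c' q.2, ?_⟩
  rw [Fintype.sum_prod_type]
  refine Finset.sum_congr rfl fun q _ => ?_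
  conv_rhs => rw [← Matrix.mul_one (K q), ← hc', Matrix.mul_sum, Finset.smul_sum]
  simp [mul_smul]

/-- A family with `F q * K r = K q * F r` is a multiple of `K`. -/
theorem Spanning.exists_smul_of_intertwine [Fintype n] [DecidableEq n] {K F : Q → Matrix n n ℂ}
    (hK : Spanning K) (h : ∀ q r, F q * K r = K q * F r) : ∃ c : ℂ, ∀ q, F q = c • K q := by
  obtain ⟨c, hc⟩ := hK 1
  -- `Y` is the value of `F` extrapolated to the identity matrix. Then `F q = K q * Y = Y * K q`, so
  -- `Y` commutes with every matrix and is scalar.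
  set Y := ∑ q, c q • F q with hY
  have h1 : ∀ q, F q = K q * Y := by
    intro q
    rw [← Matrix.mul_one (F q), ← hc, hY, Matrix.mul_sum, Matrix.mul_sum]
    simp [h]
  have h2 : ∀ q, F q = Y * K q := by
    intro q
    rw [← Matrix.one_mul (F q), ← hc, hY, Matrix.sum_mul, Matrix.sum_mul]
    simp [h]
  have h3 : ∀ X : Matrix n n ℂ, X * Y = Y * X := by
    intro X
    obtain ⟨d, rfl⟩ := hK X
    simp [Matrix.sum_mul, Matrix.mul_sum, ← h1, ← h2]
  obtain ⟨z, hz⟩ := Matrix.mem_range_scalar_of_commute_single (M := Y) fun i j _ => h3 _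
  refine ⟨z, fun q => ?_⟩
  rw [h1 q, ← hz]
  ext i j
  simp [mul_comm]

theorem Spanning.exists_ne_zero [Nonempty m] [Nonempty n] {K : Q → Matrix m n ℂ}
    (hK : Spanning K) : ∃ q, K q ≠ 0 := by
  by_contra! h
  obtain ⟨c, hc⟩ := hK (Matrix.of fun _ _ => 1)
  have := congrFun (congrFun hc (Classical.arbitrary m)) (Classical.arbitrary n)
  simp [h] at this

end Spanning

/-! ### Words and stacked tensors -/

section Words

variable {P χ m n l k : Type*} [Fintype m] [DecidableEq m]

/-- The matrix product of one tensor over the sites of a chain. -/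
def word (M : P → Matrix m m ℂ) (L : ℕ) (s : Fin L → P) : Matrix m m ℂ :=
  wordProd fun k => M (s k)

theorem wordProd_zero (M : Fin 0 → Matrix m m ℂ) : wordProd M = 1 := rfl

theorem wordProd_succ {L : ℕ} (M : Fin (L + 1) → Matrix m m ℂ) :
    wordProd M = M 0 * wordProd fun k => M k.succ := by
  simp [wordProd, List.ofFn_succ]

theorem Spanning.word [Fintype P] {M : P → Matrix m m ℂ} (hM : Spanning M) (L : ℕ) :
    Spanning (word M (L + 1)) := by
  induction L with
  | zero =>
    intro X
    obtain ⟨c, rfl⟩ := hM X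
    refine ⟨fun s => c (s 0), ?_⟩
    rw [← (Equiv.funUnique (Fin 1) P).symm.sum_comp]
    simp [MPUDomainWall.word, wordProd_succ, wordProd_zero]
  | succ L ih =>
    intro X
    obtain ⟨c, hc⟩ := hM.mul ih X
    refine ⟨fun s => c (s 0, Fin.tail s), ?_⟩
    rw [← hc, ← (Fin.consEquiv fun _ : Fin (L + 2) => P).sum_comp]
    refine Finset.sum_congr rfl fun q _ => ?_
    simp [MPUDomainWall.word, wordProd_succ, Fin.consEquiv]

end Words

section Act

variable {P χ m n l k : Type*} [Fintype P] [Fintype χ] [DecidableEq χ]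

/-- A matrix on the lower virtual leg never meets the operator layer and can be absorbed into the
lower tensor; this is why reductions lift. -/
theorem act_mul_one_kronecker [Fintype n] (T : P → P → Matrix χ χ ℂ) (M : P → Matrix m n ℂ)
    (X : Matrix n l ℂ) (i : P) :
    act T M i * ((1 : Matrix χ χ ℂ) ⊗ₖ X) = act T (fun t => M t * X) i := by
  simp [act, Matrix.sum_mul, ← Matrix.mul_kronecker_mul]

theorem one_kronecker_mul_act [Fintype m] (T : P → P → Matrix χ χ ℂ) (M : P → Matrix m n ℂ)
    (X : Matrix l m ℂ) (i : P) :
    ((1 : Matrix χ χ ℂ) ⊗ₖ X) * act T M i = act T (fun t => X * M t) i := by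
  simp [act, Matrix.mul_sum, ← Matrix.mul_kronecker_mul]

theorem act_smul (T : P → P → Matrix χ χ ℂ) (M : P → Matrix m n ℂ) (c : ℂ) (i : P) :
    act T (fun t => c • M t) i = c • act T M i := by
  simp [act, Finset.smul_sum, Matrix.kronecker_smul]

theorem act_mul_act [Fintype n] (T : P → P → Matrix χ χ ℂ) (M : P → Matrix m n ℂ)
    (M' : P → Matrix n l ℂ) (i j : P) :
    act T M i * act T M' j = ∑ t, ∑ t', (T i t * T j t') ⊗ₖ (M t * M' t') := by
  rw [act, Matrix.sum_mul]
  simp only [act, Matrix.mul_sum, ← Matrix.mul_kronecker_mul]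

theorem act_mul_act_mul_act [Fintype n] [Fintype l] (T : P → P → Matrix χ χ ℂ)
    (M : P → Matrix m n ℂ) (M' : P → Matrix n l ℂ) (M'' : P → Matrix l k ℂ) (i j h : P) :
    act T M i * act T M' j * act T M'' h =
      ∑ t, ∑ t', ∑ t'', (T i t * T j t' * T h t'') ⊗ₖ (M t * M' t' * M'' t'') := by
  rw [act_mul_act]
  simp only [Matrix.sum_mul]
  simp only [act, Matrix.mul_sum, ← Matrix.mul_kronecker_mul]

end Act

/-! ### Reductions of tensors -/

section Reduction

variable {P χ m n k : Type*} [Fintype m] [DecidableEq m] [Fintype n] [DecidableEq n]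
  [Fintype k] [DecidableEq k]

/-- The tensor `M` reduces to the tensor `N` by means of `W` and `What`. -/
structure Reduces (M : P → Matrix m m ℂ) (N : P → Matrix n n ℂ) (W : Matrix m n ℂ)
    (What : Matrix n m ℂ) : Prop where
  unit : What * W = 1
  mid : ∀ i, What * M i * W = N i
  right : ∀ i j, M i * M j * W = M i * W * N j
  left : ∀ i j, What * M i * M j = N i * What * M j
  insert : ∀ i j h, M i * M j * M h = M i * W * N j * What * M h

/-- The one-sided relations follow by padding with two sites: `N p * N q` is rewritten through `M`,
the insertion relation shifts the cut by one site, and the padding is cancelled because the products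
`N p * N q` span. Hence words of length at most two suffice. -/
theorem Reduces.of_words [Fintype P] {M : P → Matrix m m ℂ} {N : P → Matrix n n ℂ}
    {W : Matrix m n ℂ} {What : Matrix n m ℂ} (hN : Spanning N) (unit : What * W = 1)
    (mid : ∀ i, What * M i * W = N i) (mid2 : ∀ i j, What * (M i * M j) * W = N i * N j)
    (ins : ∀ i j h, M i * M j * M h = M i * W * N j * What * M h) : Reduces M N W What := by
  have hNN := hN.mul hN
  refine ⟨unit, mid, fun i j => hNN.mul_right_cancel ?_, fun i j => hNN.mul_left_cancel ?_, ins⟩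
  · rintro ⟨p, q⟩
    calc M i * M j * W * (N p * N q)
        = M i * (M j * W * N p * What * M q) * W := by
          rw [← mid q]; simp only [Matrix.mul_assoc]
      _ = (M i * M j * M p) * (M q * W) := by
          rw [← ins]; simp only [Matrix.mul_assoc]
      _ = M i * W * N j * (What * (M p * M q) * W) := by
          rw [ins]; simp only [Matrix.mul_assoc]
      _ = _ := by rw [mid2]
  · rintro ⟨p, q⟩
    calc N p * N q * (What * M i * M j)
        = What * (M p * W * N q * What * M i) * M j := by
          rw [← mid p]; simp only [Matrix.mul_assoc]
      _ = What * M p * (M q * M i * M j) := by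
          rw [← ins]; simp only [Matrix.mul_assoc]
      _ = What * (M p * M q) * W * N i * What * M j := by
          rw [ins]; simp only [Matrix.mul_assoc]
      _ = N p * N q * (N i * What * M j) := by rw [mid2]; simp only [Matrix.mul_assoc]

theorem IsActionPair.reduces [Fintype P] [Fintype χ] [DecidableEq χ] {T : P → P → Matrix χ χ ℂ}
    {A : P → Matrix m m ℂ} {B : P → Matrix n n ℂ} {W : Matrix (χ × m) n ℂ}
    {What : Matrix n (χ × m) ℂ} (h : IsActionPair T A B W What) (hB : Spanning B) :
    Reduces (act T A) B W What :=
  .of_words hB (by simpa [wordProd_zero] using h.reduce 0 Fin.elim0)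
    (fun i => by simpa [wordProd_zero, wordProd_succ] using h.reduce 1 fun _ => i)
    (fun i j => by simpa [wordProd_zero, wordProd_succ] using h.reduce 2 ![i, j])
    (fun i j k => by simpa [wordProd_zero, wordProd_succ] using h.insert 0 (fun _ => j) i k)

/-- Putting a layer on top of a reduction. -/
theorem Reduces.lift [Fintype P] [Fintype χ] [DecidableEq χ] {M : P → Matrix m m ℂ}
    {N : P → Matrix n n ℂ} {W : Matrix m n ℂ} {What : Matrix n m ℂ} (h : Reduces M N W What)
    (T : P → P → Matrix χ χ ℂ) :
    Reduces (act T M) (act T N) ((1 : Matrix χ χ ℂ) ⊗ₖ W) ((1 : Matrix χ χ ℂ) ⊗ₖ What) where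
  unit := by rw [← Matrix.mul_kronecker_mul, h.unit]; simp
  mid i := by simp only [one_kronecker_mul_act, act_mul_one_kronecker, h.mid]
  right i j := by
    rw [Matrix.mul_assoc, act_mul_one_kronecker, act_mul_one_kronecker, act_mul_act, act_mul_act]
    simp only [← Matrix.mul_assoc, h.right]
  left i j := by
    rw [one_kronecker_mul_act, act_mul_act, Matrix.mul_assoc, one_kronecker_mul_act, act_mul_act]
    simp only [← Matrix.mul_assoc, h.left]
  insert i j g := by
    rw [act_mul_one_kronecker, Matrix.mul_assoc _ _ (1 ⊗ₖ What), act_mul_one_kronecker,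
      act_mul_act_mul_act, act_mul_act_mul_act]
    simp only [← Matrix.mul_assoc, h.insert]

/-- A closing tensor passes a site only while another site follows, so the last of the four stays
unreduced. Four sites is the block length on which `Reduces.compare` works. -/
theorem Reduces.mul_word_four {M : P → Matrix m m ℂ} {N : P → Matrix n n ℂ} {W : Matrix m n ℂ}
    {What : Matrix n m ℂ} (h : Reduces M N W What) (i j g l : P) :
    What * (M i * M j * M g * M l) = N i * N j * N g * (What * M l) :=
  calc What * (M i * M j * M g * M l) = (What * M i * M j) * M g * M l := by
        simp only [Matrix.mul_assoc]
    _ = N i * (What * M j * M g) * M l := by rw [h.left]; simp only [Matrix.mul_assoc]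
    _ = N i * N j * (What * M g * M l) := by rw [h.left]; simp only [Matrix.mul_assoc]
    _ = _ := by rw [h.left]; simp only [Matrix.mul_assoc]

theorem Reduces.word_four_mul {M : P → Matrix m m ℂ} {N : P → Matrix n n ℂ} {W : Matrix m n ℂ}
    {What : Matrix n m ℂ} (h : Reduces M N W What) (i j g l : P) :
    M i * M j * M g * M l * W = M i * W * (N j * N g * N l) :=
  calc M i * M j * M g * M l * W = M i * M j * (M g * M l * W) := by
        simp only [Matrix.mul_assoc]
    _ = M i * (M j * M g * W) * N l := by rw [h.right]; simp only [Matrix.mul_assoc]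
    _ = (M i * M j * W) * N g * N l := by rw [h.right]; simp only [Matrix.mul_assoc]
    _ = _ := by rw [h.right]; simp only [Matrix.mul_assoc]

section Composition

variable {M : P → Matrix m m ℂ} {N : P → Matrix n n ℂ} {K : P → Matrix k k ℂ}
  {W : Matrix m n ℂ} {What : Matrix n m ℂ} {W' : Matrix n k ℂ} {What' : Matrix k n ℂ}
  {Wf : Matrix m k ℂ} {Whatf : Matrix k m ℂ}

/-- `What'` needs two sites with `N` before it can move, and `What` needs one more site with `M` to
produce the second of them; hence three sites. -/
theorem Reduces.left_comp (h : Reduces M N W What) (h' : Reduces N K W' What') (i j g : P) :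
    What' * What * M i * M j * M g = K i * (What' * What) * M j * M g :=
  calc What' * What * M i * M j * M g
      = What' * (What * M i * M j) * M g := by simp only [Matrix.mul_assoc]
    _ = What' * N i * (What * M j * M g) := by rw [h.left]; simp only [Matrix.mul_assoc]
    _ = (What' * N i * N j) * What * M g := by rw [h.left]; simp only [Matrix.mul_assoc]
    _ = K i * What' * (N j * What * M g) := by rw [h'.left]; simp only [Matrix.mul_assoc]
    _ = _ := by rw [← h.left]; simp only [Matrix.mul_assoc]

theorem Reduces.right_comp (h : Reduces M N W What) (h' : Reduces N K W' What') (i j g : P) :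
    M i * M j * M g * (W * W') = M i * M j * (W * W') * K g :=
  calc M i * M j * M g * (W * W')
      = M i * (M j * M g * W) * W' := by simp only [Matrix.mul_assoc]
    _ = (M i * M j * W) * N g * W' := by rw [h.right]; simp only [Matrix.mul_assoc]
    _ = M i * W * (N j * N g * W') := by rw [h.right]; simp only [Matrix.mul_assoc]
    _ = (M i * W * N j) * W' * K g := by rw [h'.right]; simp only [Matrix.mul_assoc]
    _ = _ := by rw [← h.right]; simp only [Matrix.mul_assoc]

/-- Iterating the defining equation of a composite reduction over a block of five sites. -/
theorem Reduces.mid_comp (h : Reduces M N W What) (h' : Reduces N K W' What') (a b c d e : P) :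
    What' * What * (M a * M b * M c * M d * M e) * (W * W') = K a * K b * K c * K d * K e := by
  have h2 : What' * What * M d * M e * (W * W') = K d * K e :=
    calc What' * What * M d * M e * (W * W')
        = What' * (What * M d * M e) * W * W' := by simp only [Matrix.mul_assoc]
      _ = What' * N d * (What * M e * W) * W' := by rw [h.left]; simp only [Matrix.mul_assoc]
      _ = What' * N d * N e * W' := by rw [h.mid]
      _ = K d * (What' * N e * W') := by rw [h'.left]; simp only [Matrix.mul_assoc]
      _ = _ := by rw [h'.mid]
  calc What' * What * (M a * M b * M c * M d * M e) * (W * W')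
      = (What' * What * M a * M b * M c) * M d * M e * (W * W') := by simp only [Matrix.mul_assoc]
    _ = K a * (What' * What * M b * M c * M d) * M e * (W * W') := by
        rw [h.left_comp h']; simp only [Matrix.mul_assoc]
    _ = K a * K b * (What' * What * M c * M d * M e) * (W * W') := by
        rw [h.left_comp h']; simp only [Matrix.mul_assoc]
    _ = K a * K b * K c * (What' * What * M d * M e * (W * W')) := by
        rw [h.left_comp h']; simp only [Matrix.mul_assoc]
    _ = _ := by rw [h2]; simp only [Matrix.mul_assoc]

/-- A direct reduction and a composite one agree up to scalars on four sites. -/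
theorem Reduces.compare [Fintype P] [Nonempty k] (h : Reduces M N W What)
    (h' : Reduces N K W' What') (hf : Reduces M K Wf Whatf) (hK : Spanning K) :
    ∃ c c' : ℂ, c * c' = 1 ∧
      (∀ i j g l, What' * What * (M i * M j * M g * M l) = c • (Whatf * (M i * M j * M g * M l))) ∧
      (∀ i j g l, M i * M j * M g * M l * (W * W') = c' • (M i * M j * M g * M l * Wf)) := by
  -- Two sites closed by the composite reduction on the left and by the direct one on the right
  -- intertwine the spanning blocks `K * K`, hence are a multiple of them. The constant `c'` is the
  -- mirror image.
  obtain ⟨c, hc⟩ := (hK.mul hK).exists_smul_of_intertwine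
    (F := fun q => What' * What * M q.1 * M q.2 * Wf) (by
      rintro ⟨i, j⟩ ⟨g, l⟩
      calc What' * What * M i * M j * Wf * (K g * K l)
          = What' * What * M i * (M j * Wf * K g) * K l := by simp only [Matrix.mul_assoc]
        _ = What' * What * M i * M j * (M g * Wf * K l) := by
            rw [← hf.right]; simp only [Matrix.mul_assoc]
        _ = (What' * What * M i * M j * M g) * M l * Wf := by
            rw [← hf.right]; simp only [Matrix.mul_assoc]
        _ = K i * (What' * What * M j * M g * M l) * Wf := by
            rw [h.left_comp h']; simp only [Matrix.mul_assoc]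
        _ = _ := by rw [h.left_comp h']; simp only [Matrix.mul_assoc])
  obtain ⟨c', hc'⟩ := (hK.mul hK).exists_smul_of_intertwine
    (F := fun q => Whatf * M q.1 * M q.2 * (W * W')) (by
      rintro ⟨i, j⟩ ⟨g, l⟩
      symm
      calc K i * K j * (Whatf * M g * M l * (W * W'))
          = K i * (K j * Whatf * M g) * M l * (W * W') := by simp only [Matrix.mul_assoc]
        _ = (K i * Whatf * M j) * M g * M l * (W * W') := by
            rw [← hf.left]; simp only [Matrix.mul_assoc]
        _ = Whatf * M i * (M j * M g * M l * (W * W')) := by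
            rw [← hf.left]; simp only [Matrix.mul_assoc]
        _ = Whatf * (M i * M j * M g * (W * W')) * K l := by
            rw [h.right_comp h']; simp only [Matrix.mul_assoc]
        _ = _ := by rw [h.right_comp h']; simp only [Matrix.mul_assoc])
  have hc1 : ∀ i j, What' * What * M i * M j * Wf = c • (K i * K j) := fun i j => hc (i, j)
  have hc2 : ∀ i j, Whatf * M i * M j * (W * W') = c' • (K i * K j) := fun i j => hc' (i, j)
  refine ⟨c, c', ?_, fun i j g l => ?_, fun i j g l => ?_⟩
  -- Five sites closed by the composite reduction on both ends give `K` on five sites. Inserting the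
  -- direct reduction at the middle site evaluates the two sites on its left by `c` and the two on
  -- its right by `c'`.
  · have key : ∀ i j g l e, (c * c') • (K i * K j * K g * K l * K e) =
        K i * K j * K g * K l * K e := by
      intro i j g l e
      rw [← h.mid_comp h' i j g l e]
      symm
      calc What' * What * (M i * M j * M g * M l * M e) * (W * W')
          = What' * What * M i * (M j * M g * M l) * M e * (W * W') := by
            simp only [Matrix.mul_assoc]
        _ = (What' * What * M i * M j * Wf) * K g * (Whatf * M l * M e * (W * W')) := by
            rw [hf.insert]; simp only [Matrix.mul_assoc]
        _ = (c * c') • (K i * K j * K g * K l * K e) := by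
            rw [hc1, hc2]; simp [Matrix.mul_assoc, mul_smul, smul_comm c c']
        _ = _ := by rw [h.mid_comp h']
    obtain ⟨⟨i, j, g, l, e⟩, hne⟩ :=
      (hK.mul (hK.mul (hK.mul (hK.mul hK)))).exists_ne_zero
    have := key i j g l e
    rw [← sub_eq_zero] at this ⊢
    simp only [Matrix.mul_assoc] at this
    have h0 : (c * c' - 1) • (K i * (K j * (K g * (K l * K e)))) = 0 := by
      rw [sub_smul, one_smul]; exact this
    exact (smul_eq_zero.1 h0).resolve_right hne
  · calc What' * What * (M i * M j * M g * M l)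
        = What' * What * M i * (M j * M g * M l) := by simp only [Matrix.mul_assoc]
      _ = (What' * What * M i * M j * Wf) * K g * Whatf * M l := by
          rw [hf.insert]; simp only [Matrix.mul_assoc]
      _ = c • (K i * K j * (K g * Whatf * M l)) := by
          rw [hc1]; simp [Matrix.mul_assoc]
      _ = c • (K i * (K j * Whatf * M g) * M l) := by
          rw [← hf.left]; simp only [Matrix.mul_assoc]
      _ = c • ((K i * Whatf * M j) * M g * M l) := by
          rw [← hf.left]; simp only [Matrix.mul_assoc]
      _ = _ := by rw [← hf.left]; simp only [Matrix.mul_assoc]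
  · calc M i * M j * M g * M l * (W * W')
        = (M i * M j * M g) * M l * (W * W') := by simp only [Matrix.mul_assoc]
      _ = M i * Wf * K j * (Whatf * M g * M l * (W * W')) := by
          rw [hf.insert]; simp only [Matrix.mul_assoc]
      _ = c' • ((M i * Wf * K j) * K g * K l) := by
          rw [hc2]; simp [Matrix.mul_assoc]
      _ = c' • (M i * (M j * Wf * K g) * K l) := by
          rw [← hf.right]; simp only [Matrix.mul_assoc]
      _ = c' • (M i * M j * (M g * Wf * K l)) := by
          rw [← hf.right]; simp only [Matrix.mul_assoc]
      _ = _ := by rw [← hf.right]; simp only [Matrix.mul_assoc]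

end Composition

end Reduction

/-! ### Fusion of two operator layers on top of a tensor -/

section Fusion

variable {P χ m n l k : Type*} [Fintype P] [DecidableEq P] [Fintype χ] [DecidableEq χ]
  [Fintype m] [DecidableEq m] [Fintype n] [DecidableEq n] [Fintype l] [DecidableEq l]

/-- The row vector `v` closing the upper two layers on the left. -/
def fuseRow (v : χ × χ → ℂ) (m : Type*) [DecidableEq m] : Matrix m (χ × (χ × m)) ℂ :=
  Matrix.of fun d q => if q.2.2 = d then v (q.1, q.2.1) else 0

/-- The column vector `v` closing the upper two layers on the right. -/
def fuseCol (v : χ × χ → ℂ) (m : Type*) [DecidableEq m] : Matrix (χ × (χ × m)) m ℂ :=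
  Matrix.of fun q d => if q.2.2 = d then v (q.1, q.2.1) else 0

/-- The column vector `v` closing everything below the uppermost layer on the right. -/
def lowerCol (χ : Type*) [DecidableEq χ] {x : Type*} (v : x → ℂ) : Matrix (χ × x) χ ℂ :=
  Matrix.of fun q d => if q.1 = d then v q.2 else 0

/-- A double layer on top of a third one, with right-associated virtual legs. -/
def assocKron (X : Matrix (χ × χ) (χ × χ) ℂ) (Y : Matrix m n ℂ) :
    Matrix (χ × (χ × m)) (χ × (χ × n)) ℂ :=
  Matrix.of fun p q => X (p.1, p.2.1) (q.1, q.2.1) * Y p.2.2 q.2.2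

theorem act_act (T : P → P → Matrix χ χ ℂ) (M : P → Matrix m n ℂ) (i : P) :
    act T (act T M) i = ∑ t, assocKron (stack₂ T i t) (M t) := by
  ext ⟨a, b, c⟩ ⟨a', b', c'⟩
  simp only [act, stack₂, assocKron, Matrix.sum_apply, Matrix.kroneckerMap_apply, Matrix.of_apply,
    Finset.sum_mul, Finset.mul_sum]
  rw [Finset.sum_comm]
  simp only [mul_assoc]

theorem fuseRow_mul_assocKron (v : χ × χ → ℂ) (X : Matrix (χ × χ) (χ × χ) ℂ)
    (Y : Matrix m n ℂ) : fuseRow v m * assocKron X Y = Y * fuseRow (v ᵥ* X) n := by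
  ext a ⟨p, q, b⟩
  simp only [fuseRow, assocKron, Matrix.mul_apply, Matrix.of_apply, Fintype.sum_prod_type,
    Matrix.vecMul, dotProduct]
  simp [mul_ite, Finset.mul_sum, mul_comm, mul_left_comm]

theorem assocKron_mul_fuseCol (v : χ × χ → ℂ) (X : Matrix (χ × χ) (χ × χ) ℂ)
    (Y : Matrix m n ℂ) : assocKron X Y * fuseCol v n = fuseCol (X *ᵥ v) m * Y := by
  ext ⟨p, q, b⟩ a
  simp only [fuseCol, assocKron, Matrix.mul_apply, Matrix.of_apply, Fintype.sum_prod_type,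
    Matrix.mulVec, dotProduct]
  simp [mul_ite, Finset.mul_sum, mul_comm, mul_left_comm]

theorem fuseRow_mul_fuseCol (v w : χ × χ → ℂ) :
    fuseRow v m * fuseCol w m = (v ⬝ᵥ w) • (1 : Matrix m m ℂ) := by
  ext a b
  simp only [fuseRow, fuseCol, Matrix.mul_apply, Matrix.of_apply, Fintype.sum_prod_type,
    dotProduct, Matrix.smul_apply, Matrix.one_apply]
  by_cases h : a = b <;> simp [h, eq_comm]

theorem kronecker_mul_lowerCol (v : m → ℂ) (Y : Matrix χ χ ℂ) (X : Matrix l m ℂ) :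
    (Y ⊗ₖ X) * lowerCol χ v = lowerCol χ (X *ᵥ v) * Y := by
  ext ⟨p, q⟩ a
  simp only [lowerCol, Matrix.mul_apply, Matrix.of_apply, Fintype.sum_prod_type,
    Matrix.mulVec, dotProduct, Matrix.kroneckerMap_apply]
  simp [mul_ite, Finset.mul_sum, mul_comm, mul_left_comm]

theorem fuseRow_smul (c : ℂ) (v : χ × χ → ℂ) : fuseRow (c • v) m = c • fuseRow v m := by
  ext; simp [fuseRow]

theorem fuseCol_smul (c : ℂ) (v : χ × χ → ℂ) : fuseCol (c • v) m = c • fuseCol v m := by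
  ext; simp [fuseCol]

theorem lowerCol_smul (c : ℂ) (v : m → ℂ) : lowerCol χ (c • v) = c • lowerCol χ v := by
  ext; simp [lowerCol]

theorem one_kronecker_one_kronecker_mul_fuseCol (v : χ × χ → ℂ) (W : Matrix m n ℂ) :
    ((1 : Matrix χ χ ℂ) ⊗ₖ ((1 : Matrix χ χ ℂ) ⊗ₖ W)) * fuseCol v n = fuseCol v m * W := by
  ext ⟨p, q, b⟩ a
  simp only [fuseCol, Matrix.mul_apply, Matrix.of_apply, Fintype.sum_prod_type,
    Matrix.kroneckerMap_apply, Matrix.one_apply]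
  simp [ite_mul, mul_ite, mul_comm]

/-- With the upper two layers closed on the left and the lower two on the right, one operator leg
remains on each side, and the leg of the bottom tensor is a mere spectator. This brings three layers
over any tensor back to three bare layers. -/
theorem fuseRow_mul_one_kronecker_fuseCol (v w : χ × χ → ℂ) :
    fuseRow v (χ × m) * ((1 : Matrix χ χ ℂ) ⊗ₖ fuseCol w m) =
      (fuseRow v χ * closeLower w) ⊗ₖ (1 : Matrix m m ℂ) := by
  ext ⟨q, a⟩ ⟨p, b⟩
  simp only [fuseRow, fuseCol, closeLower, Matrix.mul_apply, Matrix.of_apply,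
    Fintype.sum_prod_type, Matrix.kroneckerMap_apply, Matrix.one_apply, Prod.mk.injEq]
  by_cases h : a = b
  · subst h
    simp [ite_mul, mul_ite, ite_and]
  · simp [ite_mul, mul_ite, ite_and, h, Ne.symm h]

variable {T : P → P → Matrix χ χ ℂ} {V Vhat : χ × χ → ℂ}

/-- The one-site relations satisfied by a pair of fusion tensors. -/
theorem IsFusionPair.relations (h : IsFusionPair T V Vhat) :
    Vhat ⬝ᵥ V = 1 ∧ (∀ i j, Vhat ⬝ᵥ (stack₂ T i j *ᵥ V) = if i = j then 1 else 0) ∧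
    (∀ i j i' j', stack₂ T i j *ᵥ (stack₂ T i' j' *ᵥ V) =
      (if i' = j' then (1 : ℂ) else 0) • (stack₂ T i j *ᵥ V)) ∧
    (∀ i j i' j', (Vhat ᵥ* stack₂ T i j) ᵥ* stack₂ T i' j' =
      (if i = j then (1 : ℂ) else 0) • (Vhat ᵥ* stack₂ T i' j')) ∧
    ∀ i j i' j' i'' j'', stack₂ T i j * stack₂ T i' j' * stack₂ T i'' j'' =
      (if i' = j' then (1 : ℂ) else 0) • (stack₂ T i j * vecMulVec V Vhat * stack₂ T i'' j'') := by
  have unit : Vhat ⬝ᵥ V = 1 := by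
    have := h.reduce 0 Fin.elim0 Fin.elim0
    simpa [wordProd_zero] using this
  rcases isEmpty_or_nonempty P with hP | ⟨⟨p⟩⟩
  · exact ⟨unit, fun i => hP.elim i, fun i => hP.elim i, fun i => hP.elim i, fun i => hP.elim i⟩
  -- The identity operator is a tensor of bond dimension one, spanning because of its diagonal entry
  -- at `(p, p)`, so fusion is an ordinary reduction and `Reduces.of_words` applies.
  have hr : Reduces (fun q : P × P => stack₂ T q.1 q.2)
      (fun q : P × P => (if q.1 = q.2 then (1 : ℂ) else 0) • (1 : Matrix Unit Unit ℂ))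
      (Matrix.replicateCol Unit V) (Matrix.replicateRow Unit Vhat) := by
    refine .of_words ?_ ?_ ?_ ?_ ?_
    · intro X
      refine ⟨fun q => if q = (p, p) then X () () else 0, ?_⟩
      rw [Finset.sum_eq_single (p, p)]
      · ext
        simp
      · intro b _ hb
        simp [hb]
      · simp
    · ext
      simpa [Matrix.mul_apply, dotProduct] using unit
    · intro i
      have := h.reduce 1 (fun _ => i.1) (fun _ => i.2)
      ext
      simp only [wordProd_succ, wordProd_zero, Matrix.mul_one, funext_iff, forall_const] at this
      rw [Matrix.mul_assoc]
      simpa [Matrix.mul_apply, dotProduct, Matrix.mulVec] using this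
    · intro i j
      have := h.reduce 2 ![i.1, j.1] ![i.2, j.2]
      ext
      simp only [wordProd_succ, wordProd_zero, Matrix.mul_one] at this
      rw [Matrix.mul_assoc]
      simp only [Matrix.mul_apply, dotProduct, Matrix.mulVec] at this ⊢
      simp [Fin.forall_fin_two, funext_iff, ite_and] at this ⊢
      rw [this]
      split_ifs <;> rfl
    · intro i j k
      have := h.insert 0 (fun _ => j.1) (fun _ => j.2) i.1 i.2 k.1 k.2
      simp only [wordProd_succ, wordProd_zero, Matrix.mul_one, funext_iff, forall_const] at this
      rw [this, Matrix.mul_assoc (stack₂ T i.1 i.2)]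
      simp only [vecMulVec_eq Unit, Matrix.mul_assoc, Matrix.smul_mul, Matrix.mul_smul,
        Matrix.one_mul]
  refine ⟨unit, fun i j => ?_, fun i j i' j' => ?_, fun i j i' j' => ?_,
    fun i j i' j' i'' j'' => ?_⟩
  · have := congrFun (congrFun (hr.mid (i, j)) ()) ()
    rw [Matrix.mul_assoc] at this
    simpa [Matrix.mul_apply, dotProduct, Matrix.mulVec] using this
  · have := hr.right (i, j) (i', j')
    apply Matrix.replicateCol_injective (ι := Unit)
    simpa only [Matrix.replicateCol_smul, Matrix.replicateCol_mulVec, Matrix.mul_assoc,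
      Matrix.mul_smul, Matrix.mul_one] using this
  · have := hr.left (i, j) (i', j')
    apply Matrix.replicateRow_injective (ι := Unit)
    simpa only [Matrix.replicateRow_smul, Matrix.replicateRow_vecMul, Matrix.mul_assoc,
      Matrix.smul_mul, Matrix.one_mul] using this
  · have := hr.insert (i, j) (i', j') (i'', j'')
    simp only at this
    rw [this]
    simp only [vecMulVec_eq Unit, Matrix.mul_assoc, Matrix.smul_mul, Matrix.mul_smul,
      Matrix.one_mul]

/-- The fusion tensor sees only the two operator layers, so the bottom tensors may differ from site
to site. In particular it passes through a domain wall without any factor. -/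
theorem IsFusionPair.fuseRow_mul (h : IsFusionPair T V Vhat) (M : P → Matrix m n ℂ)
    (M' : P → Matrix n l ℂ) (i j : P) :
    fuseRow Vhat m * act T (act T M) i * act T (act T M') j =
      M i * fuseRow Vhat n * act T (act T M') j := by
  have hl := h.relations.2.2.2.1
  simp only [act_act, Matrix.mul_sum, Matrix.sum_mul, fuseRow_mul_assocKron]
  simp only [Matrix.mul_assoc, fuseRow_mul_assocKron, hl]
  simp only [fuseRow_smul, Matrix.mul_smul]
  simp only [ite_smul, one_smul, zero_smul, Finset.sum_ite_eq, Finset.mem_univ, if_true]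

theorem IsFusionPair.mul_fuseCol (h : IsFusionPair T V Vhat) (M : P → Matrix m n ℂ)
    (M' : P → Matrix n l ℂ) (i j : P) :
    act T (act T M) i * act T (act T M') j * fuseCol V l =
      act T (act T M) i * fuseCol V n * M' j := by
  have hr := h.relations.2.2.1
  simp only [act_act, Matrix.mul_sum, Matrix.sum_mul, Matrix.mul_assoc, assocKron_mul_fuseCol]
  simp only [← Matrix.mul_assoc, assocKron_mul_fuseCol, hr]
  simp only [fuseCol_smul, Matrix.smul_mul]
  rw [Finset.sum_comm]
  simp only [ite_smul, one_smul, zero_smul, Finset.sum_ite_eq, Finset.mem_univ, if_true]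

theorem assocKron_mul_assocKron (X X' : Matrix (χ × χ) (χ × χ) ℂ) (Y : Matrix m n ℂ)
    (Y' : Matrix n l ℂ) : assocKron X Y * assocKron X' Y' = assocKron (X * X') (Y * Y') := by
  change (X ⊗ₖ Y).submatrix (Equiv.prodAssoc χ χ m).symm (Equiv.prodAssoc χ χ n).symm *
    (X' ⊗ₖ Y').submatrix (Equiv.prodAssoc χ χ n).symm (Equiv.prodAssoc χ χ l).symm = _
  rw [Matrix.submatrix_mul_equiv, ← Matrix.mul_kronecker_mul]
  rfl

theorem fuseCol_mul_mul_fuseRow (v w : χ × χ → ℂ) (Y : Matrix m n ℂ) :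
    fuseCol v m * Y * fuseRow w n = assocKron (vecMulVec v w) Y := by
  ext p q
  simp [assocKron, fuseCol, fuseRow, Matrix.mul_apply, vecMulVec_apply, mul_ite, ite_mul,
    mul_right_comm]

theorem smul_assocKron (c : ℂ) (X : Matrix (χ × χ) (χ × χ) ℂ) (Y : Matrix m n ℂ) :
    assocKron (c • X) Y = c • assocKron X Y := by
  ext; simp [assocKron, mul_assoc]

/-- Two operator layers on top of `M` reduce to `M`. -/
theorem IsFusionPair.reduces (h : IsFusionPair T V Vhat) (M : P → Matrix m m ℂ) :
    Reduces (act T (act T M)) M (fuseCol V m) (fuseRow Vhat m) where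
  unit := by rw [fuseRow_mul_fuseCol, h.relations.1, one_smul]
  mid i := by
    simp only [act_act, Matrix.mul_sum, Matrix.sum_mul, fuseRow_mul_assocKron, Matrix.mul_assoc,
      fuseRow_mul_fuseCol, ← Matrix.dotProduct_mulVec, h.relations.2.1]
    simp [ite_smul]
  right i j := h.mul_fuseCol M M i j
  left i j := h.fuseRow_mul M M i j
  insert i j g := by
    rw [Matrix.mul_assoc (act T (act T M) i) (fuseCol V m),
      Matrix.mul_assoc (act T (act T M) i) (fuseCol V m * M j), fuseCol_mul_mul_fuseRow]
    have hi := h.relations.2.2.2.2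
    simp only [act_act, Matrix.mul_sum, Matrix.sum_mul, assocKron_mul_assocKron, hi]
    simp only [smul_assocKron]
    refine Finset.sum_congr rfl fun x _ => ?_
    rw [Finset.sum_comm]
    simp only [ite_smul, one_smul, zero_smul, Finset.sum_ite_eq, Finset.mem_univ, if_true]

end Fusion

/-! ### The anomaly index -/

section Anomaly

variable {P χ m n l k : Type*} [Fintype P] [DecidableEq P] [Fintype χ] [DecidableEq χ]
  [Fintype m] [DecidableEq m] [Fintype n] [DecidableEq n] [Fintype l] [DecidableEq l]
  {T : P → P → Matrix χ χ ℂ} {V Vhat : χ × χ → ℂ}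

theorem IsFusionPair.nonempty (h : IsFusionPair T V Vhat) : Nonempty χ := by
  by_contra hχ
  rw [not_nonempty_iff] at hχ
  have := h.relations.1
  simp at this

theorem IsFusionPair.closeUpper_mul (h : IsFusionPair T V Vhat) (i j i' j' : P) :
    closeUpper Vhat * stack₃ T i j * stack₃ T i' j' = T i j * closeUpper Vhat * stack₃ T i' j' :=
  h.fuseRow_mul (fun q => T q j) (fun q => T q j') i i'

theorem IsFusionPair.mul_closeLower (h : IsFusionPair T V Vhat) (i j i' j' : P) :
    stack₃ T i j * stack₃ T i' j' * closeLower V = stack₃ T i j * closeLower V * T i' j' := by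
  have hr := h.relations.2.2.1
  have key : ∀ i j (v : χ × χ → ℂ), stack₃ T i j * lowerCol χ v =
      ∑ r, lowerCol χ (stack₂ T r j *ᵥ v) * T i r := by
    intro i j v
    simp [stack₃, act, Matrix.sum_mul, kronecker_mul_lowerCol]
  change stack₃ T i j * stack₃ T i' j' * lowerCol χ V = stack₃ T i j * lowerCol χ V * T i' j'
  rw [Matrix.mul_assoc, key, key, Matrix.mul_sum, Matrix.sum_mul]
  simp only [← Matrix.mul_assoc, key, Matrix.sum_mul, hr]
  simp only [lowerCol_smul, Matrix.smul_mul]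
  rw [Finset.sum_comm]
  simp only [ite_smul, one_smul, zero_smul, Finset.sum_ite_eq', Finset.mem_univ, if_true]

/-- The left closing tensor walks past the first two sites and leaves plain `T` behind, so the
scalar is already decided on the last site. -/
theorem IsFusionPair.isAnomalyIndex_of_one_site (h : IsFusionPair T V Vhat) {ω : ℂ}
    (hω : ∀ i j, closeUpper Vhat * stack₃ T i j * closeLower V = ω • T i j) :
    IsAnomalyIndex T V Vhat ω := by
  intro i j i' j' i'' j''
  calc closeUpper Vhat * (stack₃ T i j * stack₃ T i' j' * stack₃ T i'' j'') * closeLower V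
      = (closeUpper Vhat * stack₃ T i j * stack₃ T i' j') * stack₃ T i'' j'' * closeLower V := by
        simp only [Matrix.mul_assoc]
    _ = T i j * (closeUpper Vhat * stack₃ T i' j' * stack₃ T i'' j'') * closeLower V := by
        rw [h.closeUpper_mul]; simp only [Matrix.mul_assoc]
    _ = T i j * T i' j' * (closeUpper Vhat * stack₃ T i'' j'' * closeLower V) := by
        rw [h.closeUpper_mul]; simp only [Matrix.mul_assoc]
    _ = _ := by rw [hω]; simp

/-- The two ways of fusing three layers differ by a scalar, already on one site. -/
theorem IsFusionPair.exists_one_site (h : IsFusionPair T V Vhat)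
    (hT : Spanning fun p : P × P => T p.1 p.2) :
    ∃ ω : ℂ, ∀ i j, closeUpper Vhat * stack₃ T i j * closeLower V = ω • T i j := by
  obtain ⟨ω, hω⟩ := hT.exists_smul_of_intertwine
    (F := fun p => closeUpper Vhat * stack₃ T p.1 p.2 * closeLower V) (by
      rintro ⟨i, j⟩ ⟨i', j'⟩
      calc closeUpper Vhat * stack₃ T i j * closeLower V * T i' j'
          = closeUpper Vhat * (stack₃ T i j * closeLower V * T i' j') := by
            simp only [Matrix.mul_assoc]
        _ = (closeUpper Vhat * stack₃ T i j * stack₃ T i' j') * closeLower V := by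
            rw [← h.mul_closeLower]; simp only [Matrix.mul_assoc]
        _ = _ := by rw [h.closeUpper_mul]; simp only [Matrix.mul_assoc])
  exact ⟨ω, fun i j => hω (i, j)⟩

theorem IsAnomalyIndex.unique [Nonempty χ] (hT : Spanning fun p : P × P => T p.1 p.2) {ω ω' : ℂ}
    (h : IsAnomalyIndex T V Vhat ω) (h' : IsAnomalyIndex T V Vhat ω') : ω = ω' := by
  obtain ⟨⟨⟨⟨i, j⟩, i', j'⟩, i'', j''⟩, hne⟩ := ((hT.mul hT).mul hT).exists_ne_zero
  have := (h i j i' j' i'' j'').symm.trans (h' i j i' j' i'' j'')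
  rw [← sub_eq_zero, ← sub_smul] at this
  exact sub_eq_zero.1 ((smul_eq_zero.1 this).resolve_right hne)

theorem closeUpper_act_closeLower {ω : ℂ}
    (hω : ∀ i j, closeUpper Vhat * stack₃ T i j * closeLower V = ω • T i j)
    (M : P → Matrix m m ℂ) (i : P) :
    fuseRow Vhat (χ × m) * act T (act T (act T M)) i * ((1 : Matrix χ χ ℂ) ⊗ₖ fuseCol V m) =
      ω • act T M i := by
  have h1 : ∀ j, ∑ r, T r j * (fuseRow (Vhat ᵥ* stack₂ T i r) χ * closeLower V) = ω • T i j := by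
    intro j
    rw [← hω, stack₃]
    change _ = fuseRow Vhat χ * act T (act T (fun q => T q j)) i * closeLower V
    simp only [act_act, Matrix.mul_sum, Matrix.sum_mul, fuseRow_mul_assocKron, Matrix.mul_assoc]
  rw [act_act T (act T M), Matrix.mul_sum, Matrix.sum_mul]
  simp only [fuseRow_mul_assocKron, Matrix.mul_assoc, fuseRow_mul_one_kronecker_fuseCol]
  simp only [act, Matrix.sum_mul, ← Matrix.mul_kronecker_mul, Matrix.mul_one]
  rw [Finset.sum_comm, Finset.smul_sum]
  refine Finset.sum_congr rfl fun t _ => ?_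
  rw [← Matrix.smul_kronecker, ← h1]
  ext p q
  simp [Matrix.sum_apply, Finset.sum_mul]

/-- Closing the lower two of three layers differs from closing the upper two by the anomaly. -/
theorem IsFusionPair.mul_one_kronecker_fuseCol (h : IsFusionPair T V Vhat) {ω : ℂ}
    (hω : ∀ i j, closeUpper Vhat * stack₃ T i j * closeLower V = ω • T i j)
    (M : P → Matrix m m ℂ) (i j g : P) :
    act T (act T (act T M)) i * act T (act T (act T M)) j * act T (act T (act T M)) g *
        ((1 : Matrix χ χ ℂ) ⊗ₖ fuseCol V m) =
      ω • (act T (act T (act T M)) i * act T (act T (act T M)) j * act T (act T (act T M)) g *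
        fuseCol V (χ × m)) := by
  -- Fusing the upper two layers at the middle site leaves only the site `g`, closed by `fuseRow` on
  -- the left. There the two right closings differ by exactly `ω`.
  have hf := h.reduces (act T M)
  have h1 := closeUpper_act_closeLower hω M g
  rw [← hf.mid g] at h1
  rw [hf.insert]
  simp only [Matrix.mul_assoc, ← Matrix.mul_smul] at h1 ⊢
  rw [h1]

end Anomaly

/-! ### Comparing fusion with two successive actions -/

section Associator

variable {P χ α β : Type*} [Fintype P] [DecidableEq P] [Fintype χ] [DecidableEq χ]
  [Fintype α] [DecidableEq α] [Fintype β] [DecidableEq β]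
  {T : P → P → Matrix χ χ ℂ} {V Vhat : χ × χ → ℂ} {A : P → Matrix α α ℂ} {B : P → Matrix β β ℂ}
  {WB : Matrix (χ × α) β ℂ} {WhatB : Matrix β (χ × α) ℂ}
  {WA : Matrix (χ × β) α ℂ} {WhatA : Matrix α (χ × β) ℂ}

theorem act_mul₄ {n : Type*} [Fintype n] {k : Type*} (T : P → P → Matrix χ χ ℂ)
    (M : P → Matrix n n ℂ) (X Y : Matrix n k ℂ) (c : ℂ)
    (h : ∀ i j g l, M i * M j * M g * M l * X = c • (M i * M j * M g * M l * Y)) (i j g l : P) :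
    act T M i * act T M j * act T M g * act T M l * ((1 : Matrix χ χ ℂ) ⊗ₖ X) =
      c • (act T M i * act T M j * act T M g * act T M l * ((1 : Matrix χ χ ℂ) ⊗ₖ Y)) := by
  have key : ∀ X : Matrix n k ℂ,
      act T M i * act T M j * act T M g * act T M l * ((1 : Matrix χ χ ℂ) ⊗ₖ X) =
        ∑ t, ∑ t', ∑ t'', ∑ t''', (T i t * T j t' * T g t'' * T l t''') ⊗ₖ
          (M t * M t' * M t'' * M t''' * X) := by
    intro X
    rw [act_mul_act_mul_act]
    simp only [Matrix.sum_mul]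
    simp only [act, Matrix.mul_sum, ← Matrix.mul_kronecker_mul, Matrix.sum_mul, Matrix.mul_one]
  simp only [key, h, Matrix.kronecker_smul, Finset.smul_sum]

/-- The same chain, closed on the right by three successive actions, is evaluated twice. Either the
first two actions are replaced by a fusion and the layers are regrouped, costing `c` and `ω`; or the
first action is moved to the left, the last two are replaced by a fusion, and the first is moved
back, costing `c'`. A fusion and an action on different layers commute, which is `h₄`. -/
theorem associator_aux {x y z b : Type*} [Fintype x] [DecidableEq x] [Fintype y] [DecidableEq y]
    [Fintype z] [Fintype b] {X : P → Matrix x x ℂ} {Y : P → Matrix y y ℂ}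
    {W : Matrix x y ℂ} {What : Matrix y x ℂ} (hXY : Reduces X Y W What)
    {O : Matrix y z ℂ} {WB : Matrix z b ℂ} {Φ Ψ : Matrix x z ℂ} {C : Matrix y b ℂ} {c c' ω : ℂ}
    (h₁ : ∀ i j g l, X i * X j * X g * X l * (W * O) = c • (X i * X j * X g * X l * Φ))
    (h₂ : ∀ i j g, X i * X j * X g * Φ = ω • (X i * X j * X g * Ψ))
    (h₃ : ∀ i j g l, Y i * Y j * Y g * Y l * (O * WB) = c' • (Y i * Y j * Y g * Y l * C))
    (h₄ : W * C = Ψ * WB) (p i j g l : P) :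
    (ω * c) • (X p * X i * X j * X g * X l * (Ψ * WB)) =
      c' • (X p * X i * X j * X g * X l * (Ψ * WB)) := by
  have e1 : X p * (X i * X j * X g * X l) * W * O * WB =
      (ω * c) • (X p * X i * X j * X g * X l * (Ψ * WB)) :=
    calc X p * (X i * X j * X g * X l) * W * O * WB
        = X p * (X i * X j * X g * X l * (W * O)) * WB := by simp only [Matrix.mul_assoc]
      _ = c • (X p * X i * (X j * X g * X l * Φ) * WB) := by rw [h₁]; simp [Matrix.mul_assoc]
      _ = _ := by rw [h₂]; simp [Matrix.mul_assoc, smul_smul, mul_comm]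
  have e2 : X p * (X i * X j * X g * X l) * W * O * WB =
      c' • (X p * X i * X j * X g * X l * (Ψ * WB)) :=
    calc X p * (X i * X j * X g * X l) * W * O * WB
        = X p * (X i * X j * X g * X l * W) * O * WB := by simp only [Matrix.mul_assoc]
      _ = (X p * X i * W) * Y j * Y g * Y l * O * WB := by
          rw [hXY.word_four_mul]; simp only [Matrix.mul_assoc]
      _ = X p * W * (Y i * Y j * Y g * Y l * (O * WB)) := by
          rw [hXY.right]; simp only [Matrix.mul_assoc]
      _ = c' • ((X p * W * Y i) * Y j * Y g * Y l * C) := by rw [h₃]; simp [Matrix.mul_assoc]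
      _ = c' • (X p * (X i * W * (Y j * Y g * Y l)) * C) := by
          rw [← hXY.right]; simp only [Matrix.mul_assoc]
      _ = c' • (X p * X i * X j * X g * X l * (W * C)) := by
          rw [← hXY.word_four_mul]; simp only [Matrix.mul_assoc]
      _ = _ := by rw [h₄]
  rw [← e1, e2]

/-- The comparison constants of fusion and successive actions on `A` and `B` differ by the
anomaly. -/
theorem associator_eq_anomaly_mul [Nonempty β] (hV : IsFusionPair T V Vhat) (hB : Spanning B)
    (hWB : Reduces (act T A) B WB WhatB) {ω c c' : ℂ}
    (hω : ∀ i j, closeUpper Vhat * stack₃ T i j * closeLower V = ω • T i j)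
    (hc : ∀ i j g l,
      act T (act T A) i * act T (act T A) j * act T (act T A) g * act T (act T A) l *
        (((1 : Matrix χ χ ℂ) ⊗ₖ WB) * WA) =
      c • (act T (act T A) i * act T (act T A) j * act T (act T A) g * act T (act T A) l *
        fuseCol V α))
    (hc' : ∀ i j g l,
      act T (act T B) i * act T (act T B) j * act T (act T B) g * act T (act T B) l *
        (((1 : Matrix χ χ ℂ) ⊗ₖ WA) * WB) =
      c' • (act T (act T B) i * act T (act T B) j * act T (act T B) g * act T (act T B) l *
        fuseCol V β)) : c' = ω * c := by
  obtain ⟨⟨i, j, g, l, e⟩, hne⟩ := (hB.mul (hB.mul (hB.mul (hB.mul hB)))).exists_ne_zero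
  have hm := (hV.reduces (act T A)).mid_comp hWB i j g l e
  have h1A := act_mul₄ T (act T (act T A)) _ _ _ hc
  have hsplit := Matrix.mul_kronecker_mul (1 : Matrix χ χ ℂ) (1 : Matrix χ χ ℂ)
    ((1 : Matrix χ χ ℂ) ⊗ₖ WB) WA
  rw [Matrix.one_mul] at hsplit
  rw [hsplit] at h1A
  have h0 := associator_aux (z := χ × α) (b := β) (O := (1 : Matrix χ χ ℂ) ⊗ₖ WA)
    ((hWB.lift T).lift T) h1A (hV.mul_one_kronecker_fuseCol hω A) hc'
    (one_kronecker_one_kronecker_mul_fuseCol V WB) i j g l e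
  -- Closing the left end by fusion and one action turns the common network into a word of five `B`,
  -- chosen nonzero above.
  have h1 := congrArg (fun Z => WhatB * fuseRow Vhat (χ × α) * Z) h0.symm
  simp only [Matrix.mul_smul, Matrix.mul_assoc] at h1 hm
  rw [hm, ← sub_eq_zero, ← sub_smul] at h1
  exact sub_eq_zero.1 ((smul_eq_zero.1 h1).resolve_right hne)

/-- The associator relation also holds with `A` and `B` interchanged, so `cB' = ω * cA'` and `cA' =
ω * cB'` with `cA'` invertible. -/
theorem anomaly_mul_self [Nonempty α] [Nonempty β] (hV : IsFusionPair T V Vhat)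
    (hA : Spanning A) (hB : Spanning B)
    (hWB : Reduces (act T A) B WB WhatB) (hWA : Reduces (act T B) A WA WhatA) {ω : ℂ}
    (hω : ∀ i j, closeUpper Vhat * stack₃ T i j * closeLower V = ω • T i j) : ω * ω = 1 := by
  obtain ⟨cA, cA', hcA, -, hA2⟩ := (hWB.lift T).compare hWA (hV.reduces A) hA
  obtain ⟨cB, cB', hcB, -, hB2⟩ := (hWA.lift T).compare hWB (hV.reduces B) hB
  have h1 := associator_eq_anomaly_mul hV hB hWB hω hA2 hB2
  have h2 := associator_eq_anomaly_mul hV hA hWA hω hB2 hA2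
  have h3 : cA' ≠ 0 := right_ne_zero_of_mul_eq_one hcA
  refine mul_right_cancel₀ h3 ?_
  rw [one_mul, mul_assoc, ← h1, ← h2]

/-- Two evaluations of a doubly layered wall with four sites on each side. Pulling the inner pair of
actions up to the wall gives `c₁`, then the outer pair gives `c₂`. Replacing the actions by fusions
gives `c` on the left and `c'` on the right; the fusion row then crosses the wall by `hZ` and `hZ'`
and leaves `e` intact. -/
theorem mul_eq_anomaly_aux {x y a b : Type*} [Fintype x] [DecidableEq x] [Fintype y]
    [DecidableEq y] [Fintype a] [DecidableEq a] [Fintype b] [DecidableEq b]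
    {X : P → Matrix x x ℂ} {Y : P → Matrix y y ℂ} {Z : P → Matrix x y ℂ}
    {M : P → Matrix a a ℂ} {N : P → Matrix b b ℂ} {F : P → Matrix b a ℂ}
    {e : P → Matrix α β ℂ} {O₁ : Matrix x b ℂ} {O : Matrix b x ℂ} {O' : Matrix y a ℂ}
    {O₂ : Matrix a y ℂ} {WB : Matrix a β ℂ} {WhatB : Matrix β a ℂ}
    {WA : Matrix b α ℂ} {WhatA : Matrix α b ℂ}
    {CA : Matrix x α ℂ} {RA : Matrix α x ℂ} {CB : Matrix y β ℂ} {RB : Matrix β y ℂ}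
    (hXN : Reduces X N O₁ O) (hYM : Reduces Y M O' O₂) (hWA : Reduces N A WA WhatA)
    (hWB : Reduces M B WB WhatB) (hXA : Reduces X A CA RA) (hYB : Reduces Y B CB RB)
    (hZ : ∀ l p, RA * X l * Z p = A l * RA * Z p) (hZ' : ∀ p l, RA * Z p * Y l = e p * RB * Y l)
    {c c' c₁ c₂ : ℂ}
    (h₁ : ∀ i j k, O * X i * Z j * Y k * O' = c₁ • (N i * F j * M k))
    (h₂ : ∀ i j k, WhatA * N i * F j * M k * WB = c₂ • (A i * e j * B k))
    (hc : ∀ i j g l, WhatA * O * (X i * X j * X g * X l) = c • (RA * (X i * X j * X g * X l)))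
    (hc' : ∀ i j g l, Y i * Y j * Y g * Y l * (O' * WB) = c' • (Y i * Y j * Y g * Y l * CB))
    (i j g l p i' j' g' l' : P) :
    (c₁ * c₂) • (A i * A j * A g * A l * e p * (B i' * B j' * B g' * B l')) =
      (c * c') • (A i * A j * A g * A l * e p * (B i' * B j' * B g' * B l')) := by
  have lhs : WhatA * O * (X i * X j * X g * X l) * Z p * (Y i' * Y j' * Y g' * Y l') *
      (O' * WB) = (c₁ * c₂) • (A i * A j * A g * A l * e p * (B i' * B j' * B g' * B l')) :=
    calc WhatA * O * (X i * X j * X g * X l) * Z p * (Y i' * Y j' * Y g' * Y l') * (O' * WB)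
        = WhatA * (O * (X i * X j * X g * X l)) * Z p * (Y i' * Y j' * Y g' * Y l' * O') * WB := by
          simp only [Matrix.mul_assoc]
      _ = WhatA * (N i * N j * N g) * (O * X l * Z p * Y i' * O') *
            (M j' * M g' * M l') * WB := by
          rw [hXN.mul_word_four, hYM.word_four_mul]; simp only [Matrix.mul_assoc]
      _ = c₁ • ((WhatA * (N i * N j * N g * N l)) * F p * (M i' * M j' * M g' * M l' * WB)) := by
          rw [h₁]; simp [Matrix.mul_assoc]
      _ = c₁ • (A i * A j * A g * (WhatA * N l * F p * M i' * WB) * (B j' * B g' * B l')) := by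
          rw [hWA.mul_word_four, hWB.word_four_mul]; simp only [Matrix.mul_assoc]
      _ = _ := by rw [h₂]; simp [Matrix.mul_assoc, smul_smul]
  have rhs : WhatA * O * (X i * X j * X g * X l) * Z p * (Y i' * Y j' * Y g' * Y l') *
      (O' * WB) = (c * c') • (A i * A j * A g * A l * e p * (B i' * B j' * B g' * B l')) :=
    calc WhatA * O * (X i * X j * X g * X l) * Z p * (Y i' * Y j' * Y g' * Y l') * (O' * WB)
        = WhatA * O * (X i * X j * X g * X l) * Z p *
            (Y i' * Y j' * Y g' * Y l' * (O' * WB)) := by simp only [Matrix.mul_assoc]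
      _ = (c * c') • ((RA * (X i * X j * X g * X l)) * Z p *
            (Y i' * Y j' * Y g' * Y l') * CB) := by
          rw [hc, hc']; simp [Matrix.mul_assoc, smul_smul, mul_comm]
      _ = (c * c') • (A i * A j * A g * (RA * X l * Z p) * (Y i' * Y j' * Y g' * Y l') * CB) := by
          rw [hXA.mul_word_four]; simp only [Matrix.mul_assoc]
      _ = (c * c') • (A i * A j * A g * A l * (RA * Z p * Y i') * (Y j' * Y g' * Y l') * CB) := by
          rw [hZ]; simp only [Matrix.mul_assoc]
      _ = (c * c') • (A i * A j * A g * A l * e p * (RB * (Y i' * Y j' * Y g' * Y l')) * CB) := by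
          rw [hZ']; simp only [Matrix.mul_assoc]
      _ = (c * c') • (A i * A j * A g * A l * e p * (B i' * B j' * B g') *
            (RB * Y l' * CB)) := by
          rw [hYB.mul_word_four]; simp only [Matrix.mul_assoc]
      _ = _ := by rw [hYB.mid]; simp only [Matrix.mul_assoc]
  rw [← lhs, rhs]

/-- The product of the two domain wall factors is the anomaly. -/
theorem mul_eq_anomaly [Nonempty α] [Nonempty β] (hV : IsFusionPair T V Vhat)
    (hA : Spanning A) (hB : Spanning B)
    (hWB : Reduces (act T A) B WB WhatB) (hWA : Reduces (act T B) A WA WhatA) {ω : ℂ}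
    (hω : ∀ i j, closeUpper Vhat * stack₃ T i j * closeLower V = ω • T i j)
    {e : P → Matrix α β ℂ} {f : P → Matrix β α ℂ} (he : e ≠ 0) {c₁ c₂ : ℂ}
    (h₁ : ∀ i j k, WhatB * act T A i * act T e j * act T B k * WA = c₁ • (B i * f j * A k))
    (h₂ : ∀ i j k, WhatA * act T B i * act T f j * act T A k * WB = c₂ • (A i * e j * B k)) :
    c₁ * c₂ = ω := by
  obtain ⟨c, d, hcd, hc, hd⟩ := (hWB.lift T).compare hWA (hV.reduces A) hA
  obtain ⟨d', c', hcd', -, hc'⟩ := (hWA.lift T).compare hWB (hV.reduces B) hB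
  -- `c'` belongs to the right end over `B` and equals `ω * d`, where `d` belongs to the right end
  -- over `A` and is inverse to `c`.
  obtain rfl : c * c' = ω := by
    rw [associator_eq_anomaly_mul hV hB hWB hω hd hc', mul_left_comm, hcd, mul_one]
  have lift₁ : ∀ i j k, ((1 : Matrix χ χ ℂ) ⊗ₖ WhatB) * act T (act T A) i * act T (act T e) j *
      act T (act T B) k * ((1 : Matrix χ χ ℂ) ⊗ₖ WA) =
      c₁ • (act T B i * act T f j * act T A k) := by
    intro i j k
    rw [one_kronecker_mul_act, Matrix.mul_assoc _ _ (_ ⊗ₖ _), act_mul_one_kronecker,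
      act_mul_act_mul_act, act_mul_act_mul_act]
    simp only [← Matrix.mul_assoc, h₁, Matrix.kronecker_smul, Finset.smul_sum]
  have key := mul_eq_anomaly_aux (hWB.lift T) (hWA.lift T) hWA hWB (hV.reduces A) (hV.reduces B)
    (fun l p => hV.fuseRow_mul A e l p) (fun p l => hV.fuseRow_mul e B p l) lift₁ h₂ hc hc'
  by_contra hne
  apply he
  funext p
  -- If the constants differed, the wall padded by four sites on either side would vanish; the
  -- padding spans, so `e` itself would vanish.
  have hA4 := (hA.mul hA).mul (hA.mul hA)
  have hB4 := (hB.mul hB).mul (hB.mul hB)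
  refine hA4.mul_left_cancel fun q => hB4.mul_right_cancel fun q' => ?_
  have := key q.1.1 q.1.2 q.2.1 q.2.2 p q'.1.1 q'.1.2 q'.2.1 q'.2.2
  rw [← sub_eq_zero, ← sub_smul] at this
  have h0 := (smul_eq_zero.1 this).resolve_left (sub_ne_zero.2 hne)
  simpa [Matrix.mul_assoc] using h0

end Associator

/-! ### Tensor networks on an open chain, built site by site from the left -/

section Chain

variable {P χ m n k : Type*} [Fintype P] [Fintype χ] [DecidableEq χ]
  [Fintype m] [DecidableEq m] [Fintype n] [DecidableEq n] {L : ℕ}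

/-- One more site with tensor `M` to the left of the network `Ψ`. -/
def prepend (M : P → Matrix m n ℂ) (Ψ : (Fin L → P) → Matrix n k ℂ) (s : Fin (L + 1) → P) :
    Matrix m k ℂ :=
  M (s 0) * Ψ (Fin.tail s)

/-- `r` more sites with the same tensor `M` to the left of the network `Ψ`. -/
def prependN (M : P → Matrix m m ℂ) (Ψ : (Fin L → P) → Matrix m k ℂ) :
    (r : ℕ) → (Fin (L + r) → P) → Matrix m k ℂ
  | 0 => Ψ
  | r + 1 => prepend M (prependN M Ψ r)

theorem prependN_succ (M : P → Matrix m m ℂ) (Ψ : (Fin L → P) → Matrix m k ℂ) (r : ℕ) :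
    prependN M Ψ (r + 1) = prepend M (prependN M Ψ r) := rfl

theorem word_succ (M : P → Matrix m m ℂ) (L : ℕ) : word M (L + 1) = prepend M (word M L) := by
  funext s
  simp only [word, prepend, wordProd_succ]
  rfl

theorem word_add (M : P → Matrix m m ℂ) (L r : ℕ) :
    word M (L + r) = prependN M (word M L) r := by
  induction r with
  | zero => rfl
  | succ r ih => rw [prependN_succ, ← ih]; exact word_succ M (L + r)

theorem prepend_smul (M : P → Matrix m n ℂ) (Ψ : (Fin L → P) → Matrix n k ℂ) (c : ℂ) :
    prepend M (c • Ψ) = c • prepend M Ψ := by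
  funext s
  simp [prepend]

theorem prependN_smul (M : P → Matrix m m ℂ) (Ψ : (Fin L → P) → Matrix m k ℂ) (c : ℂ) (r : ℕ) :
    prependN M (c • Ψ) r = c • prependN M Ψ r := by
  induction r with
  | zero => rfl
  | succ r ih => rw [prependN_succ, ih, prepend_smul]; rfl

theorem sum_fin_succ {E : Type*} [AddCommMonoid E] (F : (Fin (L + 1) → P) → E) :
    ∑ t, F t = ∑ q : P, ∑ t : Fin L → P, F (Fin.cons q t) := by
  rw [← (Fin.consEquiv fun _ : Fin (L + 1) => P).sum_comp, Fintype.sum_prod_type]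
  rfl

theorem siteProd_succ (p : Fin (L + 1) → Prop) [DecidablePred p]
    (M : Fin (L + 1) → Matrix m m ℂ) :
    siteProd p M =
      (if p 0 then M 0 else 1) * siteProd (fun k => p k.succ) (fun k => M k.succ) := by
  simp only [siteProd, List.finRange_succ, List.filter_cons, List.filter_map]
  by_cases h : p 0 <;> simp [h, Function.comp_def]

theorem siteProd_of_forall (p : Fin L → Prop) [DecidablePred p] (M : Fin L → Matrix m m ℂ)
    (hp : ∀ k, p k) : siteProd p M = wordProd M := by
  induction L with
  | zero => rfl
  | succ L ih => rw [siteProd_succ, wordProd_succ, if_pos (hp 0), ih _ _ fun k => hp k.succ]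

theorem siteProd_of_forall_not (p : Fin L → Prop) [DecidablePred p] (M : Fin L → Matrix m m ℂ)
    (hp : ∀ k, ¬ p k) : siteProd p M = 1 := by
  induction L with
  | zero => rfl
  | succ L ih => rw [siteProd_succ, if_neg (hp 0), ih _ _ fun k => hp k.succ, Matrix.one_mul]

theorem siteProd_congr {p q : Fin L → Prop} [DecidablePred p] [DecidablePred q]
    (M : Fin L → Matrix m m ℂ) (h : ∀ k, p k ↔ q k) : siteProd p M = siteProd q M := by
  obtain rfl : p = q := funext fun k => propext (h k)
  congr

theorem siteProd_succ_of_not {p : Fin (L + 1) → Prop} [DecidablePred p] (q : Fin L → Prop)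
    [DecidablePred q] (M : Fin (L + 1) → Matrix m m ℂ) (h0 : ¬ p 0) (h : ∀ k, p k.succ ↔ q k) :
    siteProd p M = siteProd q fun k => M k.succ := by
  rw [siteProd_succ, if_neg h0, Matrix.one_mul, siteProd_congr _ h]

theorem siteProd_succ_of_pos {p : Fin (L + 1) → Prop} [DecidablePred p] (q : Fin L → Prop)
    [DecidablePred q] (M : Fin (L + 1) → Matrix m m ℂ) (h0 : p 0) (h : ∀ k, p k.succ ↔ q k) :
    siteProd p M = M 0 * siteProd q fun k => M k.succ := by
  rw [siteProd_succ, if_pos h0, siteProd_congr _ h]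

/-- A layer of operator tensors on all sites of a network. -/
def onTop (T : P → P → Matrix χ χ ℂ) (Ψ : (Fin L → P) → Matrix m n ℂ) (s : Fin L → P) :
    Matrix (χ × m) (χ × n) ℂ :=
  ∑ t, (wordProd fun k => T (s k) (t k)) ⊗ₖ Ψ t

theorem onTop_prepend (T : P → P → Matrix χ χ ℂ) (M : P → Matrix m n ℂ)
    (Ψ : (Fin L → P) → Matrix n k ℂ) :
    onTop T (prepend M Ψ) = prepend (act T M) (onTop T Ψ) := by
  funext s
  simp only [onTop, prepend, sum_fin_succ, wordProd_succ, Fin.cons_zero, Fin.cons_succ,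
    Fin.tail_cons, act, Matrix.sum_mul, Matrix.mul_kronecker_mul]
  simp only [Matrix.mul_sum]
  rfl

theorem onTop_prependN (T : P → P → Matrix χ χ ℂ) (M : P → Matrix m m ℂ)
    (Ψ : (Fin L → P) → Matrix m k ℂ) (r : ℕ) :
    onTop T (prependN M Ψ r) = prependN (act T M) (onTop T Ψ) r := by
  induction r with
  | zero => rfl
  | succ r ih => rw [prependN_succ, prependN_succ, ← ih]; exact onTop_prepend T M _

theorem onTop_word (T : P → P → Matrix χ χ ℂ) (M : P → Matrix m m ℂ) :
    onTop T (word M L) = word (act T M) L := by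
  induction L with
  | zero => funext s; simp [onTop, word, wordProd_zero]
  | succ L ih => rw [word_succ, word_succ, onTop_prepend, ih]

theorem mpo_mulVec_trace (T : P → P → Matrix χ χ ℂ) (Ψ : (Fin L → P) → Matrix m m ℂ) :
    (mpo T L *ᵥ fun t => (Ψ t).trace) = fun s => (onTop T Ψ s).trace := by
  funext s
  simp [onTop, Matrix.trace_sum, Matrix.trace_kronecker, Matrix.mulVec, dotProduct, mpo]

/-- The row vector `v` next to the matrix `M`, with the leg of `v` on the right. -/
def rowKron (v : χ → ℂ) (M : Matrix m n ℂ) : Matrix m (χ × n) ℂ :=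
  Matrix.of fun a q => v q.1 * M a q.2

/-- The column vector `v` next to the matrix `M`, with the leg of `v` on the left. -/
def colKron (v : χ → ℂ) (M : Matrix m n ℂ) : Matrix (χ × m) n ℂ :=
  Matrix.of fun q b => v q.1 * M q.2 b

theorem rowKron_mul_kronecker (v : χ → ℂ) (M : Matrix m n ℂ) (Y : Matrix χ χ ℂ)
    (X : Matrix n k ℂ) : rowKron v M * (Y ⊗ₖ X) = rowKron (v ᵥ* Y) (M * X) := by
  ext a ⟨q, b⟩
  simp only [rowKron, Matrix.mul_apply, Matrix.of_apply, Matrix.kroneckerMap_apply,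
    Fintype.sum_prod_type, Matrix.vecMul, dotProduct, Finset.sum_mul_sum]
  refine Finset.sum_congr rfl fun _ _ => Finset.sum_congr rfl fun _ _ => ?_
  ring

theorem kronecker_mul_colKron (v : χ → ℂ) (M : Matrix n k ℂ) (Y : Matrix χ χ ℂ)
    (X : Matrix m n ℂ) : (Y ⊗ₖ X) * colKron v M = colKron (Y *ᵥ v) (X * M) := by
  ext ⟨q, b⟩ a
  simp only [colKron, Matrix.mul_apply, Matrix.of_apply, Matrix.kroneckerMap_apply,
    Fintype.sum_prod_type, Matrix.mulVec, dotProduct, Finset.sum_mul_sum]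
  refine Finset.sum_congr rfl fun _ _ => Finset.sum_congr rfl fun _ _ => ?_
  ring

theorem rowKron_mul_colKron (v w : χ → ℂ) (M : Matrix m n ℂ) (N : Matrix n k ℂ) :
    rowKron v M * colKron w N = (v ⬝ᵥ w) • (M * N) := by
  ext a b
  simp only [rowKron, colKron, Matrix.mul_apply, Matrix.of_apply, Fintype.sum_prod_type,
    dotProduct, Matrix.smul_apply, smul_eq_mul, Finset.sum_mul_sum]
  refine Finset.sum_congr rfl fun _ _ => Finset.sum_congr rfl fun _ _ => ?_
  ring

theorem mul_rowKron (v : χ → ℂ) (M : Matrix n k ℂ) (X : Matrix m n ℂ) :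
    X * rowKron v M = rowKron v (X * M) := by
  ext a q
  simp [rowKron, Matrix.mul_apply, Finset.mul_sum, mul_left_comm]

theorem colKron_mul (v : χ → ℂ) (M : Matrix m n ℂ) (X : Matrix n k ℂ) :
    colKron v M * X = colKron v (M * X) := by
  ext a q
  simp [colKron, Matrix.mul_apply, Finset.mul_sum, mul_assoc]

end Chain

/-! ### Endpoint operators on a chain -/

namespace DWData

variable {P χ α β m n k : Type*} [Fintype P] [DecidableEq P] [Fintype χ] [DecidableEq χ]
  [Fintype α] [DecidableEq α] [Fintype β] [DecidableEq β]
  [Fintype m] [DecidableEq m] [Fintype n] [DecidableEq n] {L : ℕ} (S : DWData P χ α β)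

/-- The left endpoint tensor on top of `M`. -/
def leftTop (M : P → Matrix m n ℂ) (p : P) : Matrix m (χ × n) ℂ :=
  ∑ t, rowKron (S.leftEnd p t) (M t)

/-- The right endpoint tensor on top of `M`. -/
def rightTop (M : P → Matrix m n ℂ) (p : P) : Matrix (χ × m) n ℂ :=
  ∑ t, colKron (S.rightEnd p t) (M t)

/-- The half chain operator on a network. -/
def halfAct (i : Fin L) (Ψ : (Fin L → P) → Matrix m n ℂ) (s : Fin L → P) : Matrix m (χ × n) ℂ :=
  ∑ t, rowKron (fun x => S.halfOp i x s t) (Ψ t)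

/-- The MPU string ending at the site `j`, with an open leg on the left. -/
def rightVec (j : Fin L) (s t : Fin L → P) : χ → ℂ :=
  if ∀ k, j < k → s k = t k then
    siteProd (fun k => k < j) (fun k => S.T (s k) (t k)) *ᵥ S.rightEnd (s j) (t j)
  else 0

/-- The MPU string ending at the site `j`, on a network. -/
def rightAct (j : Fin L) (Ψ : (Fin L → P) → Matrix m n ℂ) (s : Fin L → P) :
    Matrix (χ × m) n ℂ :=
  ∑ t, colKron (S.rightVec j s t) (Ψ t)

/-- The pair operator on a network. -/
def pairAct (i j : Fin L) (Ψ : (Fin L → P) → Matrix m n ℂ) (s : Fin L → P) : Matrix m n ℂ :=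
  ∑ t, S.pairOp i j s t • Ψ t

theorem halfAct_smul (i : Fin L) (Ψ : (Fin L → P) → Matrix m n ℂ) (c : ℂ) :
    S.halfAct i (c • Ψ) = c • S.halfAct i Ψ := by
  funext s
  ext a b
  simp [halfAct, rowKron, Matrix.sum_apply, Finset.mul_sum, mul_left_comm]

theorem halfOp_mulVec (i : Fin L) (x : χ) (Ψ : (Fin L → P) → Matrix m n ℂ) (a : m) (b : n) :
    (S.halfOp i x *ᵥ fun t => Ψ t a b) = fun s => S.halfAct i Ψ s a (x, b) := by
  funext s
  simp [halfAct, rowKron, Matrix.sum_apply, Matrix.mulVec, dotProduct]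

theorem pairOp_mulVec_trace (i j : Fin L) (Ψ : (Fin L → P) → Matrix m m ℂ) :
    (S.pairOp i j *ᵥ fun t => (Ψ t).trace) = fun s => (S.pairAct i j Ψ s).trace := by
  funext s
  simp [pairAct, Matrix.trace_sum, Matrix.mulVec, dotProduct]

theorem halfOp_zero (x : χ) (s t : Fin (L + 1) → P) :
    S.halfOp 0 x s t = (S.leftEnd (s 0) (t 0) ᵥ*
      wordProd fun k => S.T (Fin.tail s k) (Fin.tail t k)) x := by
  simp only [halfOp, Matrix.of_apply, Fin.not_lt_zero, false_imp_iff, implies_true, if_true]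
  rw [siteProd_succ, if_neg (lt_irrefl _), Matrix.one_mul,
    siteProd_of_forall _ _ fun k => k.succ_pos]
  rfl

theorem halfOp_succ (i : Fin L) (x : χ) (s t : Fin (L + 1) → P) :
    S.halfOp i.succ x s t =
      if s 0 = t 0 then S.halfOp i x (Fin.tail s) (Fin.tail t) else 0 := by
  have hc : (∀ k, k < i.succ → s k = t k) ↔
      s 0 = t 0 ∧ ∀ k, k < i → Fin.tail s k = Fin.tail t k := by
    rw [Fin.forall_fin_succ]; simp [Fin.tail]
  simp only [halfOp, Matrix.of_apply, hc, ite_and]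
  rw [siteProd_succ_of_not (fun k => i < k) _ (by simp) (by simp)]
  rfl

/-- The operator is consumed from the left: sites before the endpoint are untouched, the endpoint
consumes one site, and everything after it carries a full layer. -/
theorem halfAct_zero (M : P → Matrix m n ℂ) (Ψ : (Fin L → P) → Matrix n k ℂ) :
    S.halfAct 0 (prepend M Ψ) = prepend (S.leftTop M) (onTop S.T Ψ) := by
  funext s
  simp only [halfAct, prepend, leftTop, onTop, sum_fin_succ, Matrix.sum_mul]
  simp only [Matrix.mul_sum, rowKron_mul_kronecker, halfOp_zero, Fin.cons_zero, Fin.tail_cons]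

theorem halfAct_succ (i : Fin L) (M : P → Matrix m n ℂ) (Ψ : (Fin L → P) → Matrix n k ℂ) :
    S.halfAct i.succ (prepend M Ψ) = prepend M (S.halfAct i Ψ) := by
  funext s
  simp only [halfAct, prepend, sum_fin_succ, Matrix.mul_sum, halfOp_succ, Fin.cons_zero,
    Fin.tail_cons, mul_rowKron]
  rw [Finset.sum_eq_single (s 0)]
  · simp
  · intro q _ hq
    ext
    simp [Ne.symm hq, rowKron, Matrix.sum_apply]
  · simp

theorem rightVec_zero (s t : Fin (L + 1) → P) :
    S.rightVec 0 s t =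
      if Fin.tail s = Fin.tail t then S.rightEnd (s 0) (t 0) else 0 := by
  have hc : (∀ k, 0 < k → s k = t k) ↔ Fin.tail s = Fin.tail t := by
    rw [Fin.forall_fin_succ]; simp [Fin.tail, funext_iff]
  simp only [rightVec, hc]
  rw [siteProd_of_forall_not _ _ fun k => Fin.not_lt_zero k, Matrix.one_mulVec]

theorem rightVec_succ (j : Fin L) (s t : Fin (L + 1) → P) :
    S.rightVec j.succ s t = S.T (s 0) (t 0) *ᵥ S.rightVec j (Fin.tail s) (Fin.tail t) := by
  have hc : (∀ k, j.succ < k → s k = t k) ↔ ∀ k, j < k → Fin.tail s k = Fin.tail t k := by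
    rw [Fin.forall_fin_succ]; simp [Fin.tail]
  simp only [rightVec, hc]
  rw [siteProd_succ_of_pos (fun k => k < j) _ (by simp) (by simp), ← Matrix.mulVec_mulVec]
  split_ifs
  · rfl
  · simp

theorem rightAct_zero (M : P → Matrix m n ℂ) (Ψ : (Fin L → P) → Matrix n k ℂ) :
    S.rightAct 0 (prepend M Ψ) = prepend (S.rightTop M) Ψ := by
  funext s
  simp only [rightAct, prepend, rightTop, sum_fin_succ, Matrix.sum_mul, rightVec_zero,
    Fin.cons_zero, Fin.tail_cons, colKron_mul]
  refine Finset.sum_congr rfl fun q _ => ?_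
  rw [Finset.sum_eq_single (Fin.tail s)]
  · simp
  · intro t _ ht
    ext
    simp [Ne.symm ht, colKron]
  · simp

theorem rightAct_succ (j : Fin L) (M : P → Matrix m n ℂ) (Ψ : (Fin L → P) → Matrix n k ℂ) :
    S.rightAct j.succ (prepend M Ψ) = prepend (act S.T M) (S.rightAct j Ψ) := by
  funext s
  simp only [rightAct, prepend, act, sum_fin_succ, Matrix.sum_mul]
  simp only [Matrix.mul_sum, kronecker_mul_colKron, rightVec_succ, Fin.cons_zero, Fin.tail_cons]

theorem pairOp_zero (j : Fin L) (s t : Fin (L + 1) → P) :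
    S.pairOp 0 j.succ s t =
      S.leftEnd (s 0) (t 0) ⬝ᵥ S.rightVec j (Fin.tail s) (Fin.tail t) := by
  have hc : (∀ k, k < 0 ∨ j.succ < k → s k = t k) ↔
      ∀ k, j < k → Fin.tail s k = Fin.tail t k := by
    rw [Fin.forall_fin_succ]; simp [Fin.tail]
  simp only [pairOp, rightVec, Matrix.of_apply, hc]
  rw [siteProd_succ_of_not (fun k => k < j) _ (by simp) (by simp), ← Matrix.dotProduct_mulVec]
  split_ifs
  · rfl
  · simp

theorem pairOp_succ (i j : Fin L) (s t : Fin (L + 1) → P) :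
    S.pairOp i.succ j.succ s t =
      if s 0 = t 0 then S.pairOp i j (Fin.tail s) (Fin.tail t) else 0 := by
  have hc : (∀ k, k < i.succ ∨ j.succ < k → s k = t k) ↔
      s 0 = t 0 ∧ ∀ k, k < i ∨ j < k → Fin.tail s k = Fin.tail t k := by
    rw [Fin.forall_fin_succ]; simp [Fin.tail]
  simp only [pairOp, Matrix.of_apply, hc, ite_and]
  rw [siteProd_succ_of_not (fun k => i < k ∧ k < j) _ (by simp) (by simp)]
  rfl

theorem pairAct_zero (j : Fin L) (M : P → Matrix m n ℂ) (Ψ : (Fin L → P) → Matrix n k ℂ) :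
    S.pairAct 0 j.succ (prepend M Ψ) = prepend (S.leftTop M) (S.rightAct j Ψ) := by
  funext s
  simp only [pairAct, prepend, leftTop, rightAct, sum_fin_succ, Matrix.sum_mul]
  simp only [Matrix.mul_sum, rowKron_mul_colKron, pairOp_zero, Fin.cons_zero, Fin.tail_cons]

theorem pairAct_succ (i j : Fin L) (M : P → Matrix m n ℂ) (Ψ : (Fin L → P) → Matrix n k ℂ) :
    S.pairAct i.succ j.succ (prepend M Ψ) = prepend M (S.pairAct i j Ψ) := by
  funext s
  simp only [pairAct, prepend, sum_fin_succ, Matrix.mul_sum, pairOp_succ, Fin.cons_zero,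
    Fin.tail_cons]
  rw [Finset.sum_eq_single (s 0)]
  · simp
  · intro q _ hq
    simp [Ne.symm hq]
  · simp

/-! The same rules in terms of the positions of the sites. -/

theorem halfAct_prependN {r : ℕ} {i : Fin (L + r)} {i' : Fin L} (h : (i : ℕ) = i' + r)
    (M : P → Matrix m m ℂ) (Ψ : (Fin L → P) → Matrix m k ℂ) :
    S.halfAct i (prependN M Ψ r) = prependN M (S.halfAct i' Ψ) r := by
  induction r with
  | zero => obtain rfl : i = i' := Fin.ext h; rfl
  | succ r ih =>
    obtain rfl : i = Fin.succ (⟨i' + r, Nat.add_lt_add_right i'.2 r⟩ : Fin (L + r)) := Fin.ext h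
    rw [prependN_succ, prependN_succ, ← ih (i := ⟨i' + r, Nat.add_lt_add_right i'.2 r⟩) rfl]
    exact S.halfAct_succ _ M _

theorem halfAct_prepend {i : Fin (L + 1)} {i' : Fin L} (h : (i : ℕ) = i' + 1)
    (M : P → Matrix m n ℂ) (Ψ : (Fin L → P) → Matrix n k ℂ) :
    S.halfAct i (prepend M Ψ) = prepend M (S.halfAct i' Ψ) := by
  obtain rfl : i = i'.succ := Fin.ext h
  exact S.halfAct_succ _ M _

theorem halfAct_here {r : ℕ} {i : Fin (L + 1 + r)} (h : (i : ℕ) = r)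
    (M : P → Matrix m m ℂ) (M' : P → Matrix m n ℂ) (Ψ : (Fin L → P) → Matrix n k ℂ) :
    S.halfAct i (prependN M (prepend M' Ψ) r) =
      prependN M (prepend (S.leftTop M') (onTop S.T Ψ)) r := by
  rw [S.halfAct_prependN (i' := 0) (by simpa using h), halfAct_zero]

theorem pairAct_prependN {r : ℕ} {i j : Fin (L + r)} {i' j' : Fin L} (hi : (i : ℕ) = i' + r)
    (hj : (j : ℕ) = j' + r) (M : P → Matrix m m ℂ) (Ψ : (Fin L → P) → Matrix m k ℂ) :
    S.pairAct i j (prependN M Ψ r) = prependN M (S.pairAct i' j' Ψ) r := by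
  induction r with
  | zero =>
    obtain rfl : i = i' := Fin.ext hi
    obtain rfl : j = j' := Fin.ext hj
    rfl
  | succ r ih =>
    obtain rfl : i = Fin.succ (⟨i' + r, Nat.add_lt_add_right i'.2 r⟩ : Fin (L + r)) := Fin.ext hi
    obtain rfl : j = Fin.succ (⟨j' + r, Nat.add_lt_add_right j'.2 r⟩ : Fin (L + r)) := Fin.ext hj
    rw [prependN_succ, prependN_succ, ← ih (i := ⟨i' + r, Nat.add_lt_add_right i'.2 r⟩)
      (j := ⟨j' + r, Nat.add_lt_add_right j'.2 r⟩)
      rfl rfl]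
    exact S.pairAct_succ _ _ M _

theorem pairAct_prepend {i j : Fin (L + 1)} {i' j' : Fin L} (hi : (i : ℕ) = i' + 1)
    (hj : (j : ℕ) = j' + 1) (M : P → Matrix m n ℂ) (Ψ : (Fin L → P) → Matrix n k ℂ) :
    S.pairAct i j (prepend M Ψ) = prepend M (S.pairAct i' j' Ψ) := by
  obtain rfl : i = i'.succ := Fin.ext hi
  obtain rfl : j = j'.succ := Fin.ext hj
  exact S.pairAct_succ _ _ M _

theorem pairAct_here {r : ℕ} {i j : Fin (L + 1 + r)} {j' : Fin L} (hi : (i : ℕ) = r)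
    (hj : (j : ℕ) = j' + 1 + r) (M : P → Matrix m m ℂ) (M' : P → Matrix m n ℂ)
    (Ψ : (Fin L → P) → Matrix n k ℂ) :
    S.pairAct i j (prependN M (prepend M' Ψ) r) =
      prependN M (prepend (S.leftTop M') (S.rightAct j' Ψ)) r := by
  rw [S.pairAct_prependN (i' := 0) (j' := j'.succ) (by simpa using hi) (by simpa using hj),
    pairAct_zero]

theorem rightAct_prependN {r : ℕ} {j : Fin (L + r)} {j' : Fin L} (h : (j : ℕ) = j' + r)
    (M : P → Matrix m m ℂ) (Ψ : (Fin L → P) → Matrix m k ℂ) :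
    S.rightAct j (prependN M Ψ r) = prependN (act S.T M) (S.rightAct j' Ψ) r := by
  induction r with
  | zero => obtain rfl : j = j' := Fin.ext h; rfl
  | succ r ih =>
    obtain rfl : j = Fin.succ (⟨j' + r, Nat.add_lt_add_right j'.2 r⟩ : Fin (L + r)) := Fin.ext h
    rw [prependN_succ, prependN_succ, ← ih (j := ⟨j' + r, Nat.add_lt_add_right j'.2 r⟩) rfl]
    exact S.rightAct_succ _ M _

theorem rightAct_prepend {j : Fin (L + 1)} {j' : Fin L} (h : (j : ℕ) = j' + 1)
    (M : P → Matrix m n ℂ) (Ψ : (Fin L → P) → Matrix n k ℂ) :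
    S.rightAct j (prepend M Ψ) = prepend (act S.T M) (S.rightAct j' Ψ) := by
  obtain rfl : j = j'.succ := Fin.ext h
  exact S.rightAct_succ _ M _

theorem rightAct_here {r : ℕ} {j : Fin (L + 1 + r)} (h : (j : ℕ) = r)
    (M : P → Matrix m m ℂ) (M' : P → Matrix m n ℂ) (Ψ : (Fin L → P) → Matrix n k ℂ) :
    S.rightAct j (prependN M (prepend M' Ψ) r) =
      prependN (act S.T M) (prepend (S.rightTop M') Ψ) r := by
  rw [S.rightAct_prependN (j' := 0) (by simpa using h), rightAct_zero]

end DWData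

/-! ### Moving reduction tensors through networks -/

section Push

variable {P χ m n k l : Type*} [Fintype P] [Fintype χ] [DecidableEq χ]
  [Fintype m] [DecidableEq m] [Fintype n] [DecidableEq n] [Fintype k] [DecidableEq k]
  [Fintype l] [DecidableEq l] {L : ℕ}

/-- A fixed matrix on the left of a network. -/
def mulNet (X : Matrix m n ℂ) (Ψ : (Fin L → P) → Matrix n k ℂ) (s : Fin L → P) : Matrix m k ℂ :=
  X * Ψ s

theorem prepend_mul (M : P → Matrix m n ℂ) (X : Matrix n l ℂ) (Ψ : (Fin L → P) → Matrix l k ℂ) :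
    prepend (fun p => M p * X) Ψ = prepend M (mulNet X Ψ) := by
  funext s
  simp [prepend, mulNet, Matrix.mul_assoc]

theorem mul_prepend (M : P → Matrix n l ℂ) (X : Matrix m n ℂ) (Ψ : (Fin L → P) → Matrix l k ℂ) :
    prepend (fun p => X * M p) Ψ = mulNet X (prepend M Ψ) := by
  funext s
  simp [prepend, mulNet, Matrix.mul_assoc]

theorem onTop_mulNet (T : P → P → Matrix χ χ ℂ) (X : Matrix m n ℂ)
    (Ψ : (Fin L → P) → Matrix n k ℂ) :
    onTop T (mulNet X Ψ) = mulNet ((1 : Matrix χ χ ℂ) ⊗ₖ X) (onTop T Ψ) := by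
  funext s
  simp [onTop, mulNet, Matrix.mul_sum, ← Matrix.mul_kronecker_mul]

variable {M : P → Matrix m m ℂ} {N : P → Matrix n n ℂ} {W : Matrix m n ℂ} {What : Matrix n m ℂ}

theorem Reduces.mulNet_prepend (h : Reduces M N W What) (Ψ : (Fin L → P) → Matrix m k ℂ) :
    mulNet What (prepend M (prepend M Ψ)) = prepend N (mulNet What (prepend M Ψ)) := by
  funext s
  simp only [mulNet, prepend, ← Matrix.mul_assoc, h.left]

theorem Reduces.mulNet_prependN (h : Reduces M N W What) (Ψ : (Fin L → P) → Matrix m k ℂ)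
    (r : ℕ) :
    mulNet What (prependN M (prepend M Ψ) r) = prependN N (mulNet What (prepend M Ψ)) r := by
  induction r with
  | zero => rfl
  | succ r ih =>
    rw [prependN_succ, prependN_succ, ← ih]
    cases r with
    | zero => exact h.mulNet_prepend Ψ
    | succ r => exact h.mulNet_prepend (prependN M (prepend M Ψ) r)

theorem Reduces.mulNet_word (h : Reduces M N W What) (L r : ℕ) :
    mulNet What (word M (L + 1 + r)) = prependN N (mulNet What (word M (L + 1))) r := by
  rw [word_add, word_succ]
  exact h.mulNet_prependN _ r

/-- Here `W` waits at the far end, so the site next to it is reduced by `mid` and nothing of `M`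
remains. -/
theorem Reduces.mulNet_prependN_close (h : Reduces M N W What) (Ψ : (Fin L → P) → Matrix n k ℂ)
    (r : ℕ) :
    mulNet What (prependN M (mulNet W Ψ) (r + 1)) = prependN N Ψ (r + 1) := by
  induction r with
  | zero =>
    funext s
    change What * (M (s 0) * (W * Ψ _)) = N (s 0) * Ψ _
    rw [← h.mid]
    simp only [Matrix.mul_assoc]
  | succ r ih =>
    change _ = prepend N (prependN N Ψ (r + 1))
    rw [← ih]
    exact h.mulNet_prepend (prependN M (mulNet W Ψ) r)

theorem Reduces.prepend_prependN_mulNet (h : Reduces M N W What)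
    (Ψ : (Fin L → P) → Matrix n k ℂ) (r : ℕ) :
    prepend M (prependN M (mulNet W Ψ) r) = prepend M (mulNet W (prependN N Ψ r)) := by
  induction r with
  | zero => rfl
  | succ r ih =>
    rw [prependN_succ, ih, prependN_succ]
    funext s
    simp only [mulNet, prepend, ← Matrix.mul_assoc, h.right]

/-- Opens a cut in the middle of a chain. It supplies a closing tensor where the chain has none, as
at an open right end. -/
theorem Reduces.prepend_three (h : Reduces M N W What) (Ψ : (Fin L → P) → Matrix m k ℂ) :
    prepend M (prepend M (prepend M Ψ)) =
      prepend M (mulNet W (prepend N (mulNet What (prepend M Ψ)))) := by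
  funext s
  simp only [mulNet, prepend, ← Matrix.mul_assoc, h.insert]

end Push

/-! ### A closing tensor crossing a domain wall -/

section Wall

variable {P χ α β k : Type*} [Fintype P] [DecidableEq P] [Fintype χ] [DecidableEq χ]
  [Fintype α] [DecidableEq α] [Fintype β] [DecidableEq β] [Fintype k] [DecidableEq k] {L : ℕ}
  {T : P → P → Matrix χ χ ℂ} {A : P → Matrix α α ℂ} {B : P → Matrix β β ℂ}
  {WB : Matrix (χ × α) β ℂ} {WhatB : Matrix β (χ × α) ℂ}
  {WA : Matrix (χ × β) α ℂ} {WhatA : Matrix α (χ × β) ℂ}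
  {e : P → Matrix α β ℂ} {f : P → Matrix β α ℂ} {c : ℂ}

/-- The local transformation of a domain wall inside a network. -/
theorem mulNet_wall (hB : Reduces (act T A) B WB WhatB)
    (hc : ∀ i j k, WhatB * act T A i * act T e j * act T B k * WA = c • (B i * f j * A k))
    {Ψ : (Fin L → P) → Matrix (χ × β) k ℂ} {Ψ' : (Fin L → P) → Matrix α k ℂ}
    (hΨ : prepend (act T B) Ψ = prepend (act T B) (mulNet WA Ψ')) (r : ℕ) :
    mulNet WhatB (prependN (act T A) (prepend (act T e) (prepend (act T B) Ψ)) (r + 1)) =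
      c • prependN B (prepend f (prepend A Ψ')) (r + 1) := by
  induction r with
  | zero =>
    rw [hΨ]
    funext s
    change WhatB * (act T A _ * (act T e _ * (act T B _ * (WA * Ψ' _)))) =
      c • (B _ * (f _ * (A _ * Ψ' _)))
    simp only [← Matrix.mul_assoc, hc]
    simp
  | succ r ih =>
    change _ = c • prepend B (prependN B (prepend f (prepend A Ψ')) (r + 1))
    rw [← prepend_smul, ← ih]
    exact hB.mulNet_prepend
      (prependN (act T A) (prepend (act T e) (prepend (act T B) Ψ)) r)

/-- The tensor `WA` that the wall relation requires on the right is created by cutting the three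
sites behind the wall. Its partner `WhatA` is then moved back to the wall and is what emerges on the
other side. -/
theorem mulNet_wall_open (hB : Reduces (act T A) B WB WhatB) (hA : Reduces (act T B) A WA WhatA)
    (hc : ∀ i j k, WhatB * act T A i * act T e j * act T B k * WA = c • (B i * f j * A k))
    (Ψ : (Fin L → P) → Matrix (χ × β) k ℂ) (r : ℕ) :
    mulNet WhatB (prependN (act T A) (prepend (act T e)
        (prepend (act T B) (prepend (act T B) (prepend (act T B) Ψ)))) (r + 1)) =
      c • prependN B (prepend f
        (mulNet WhatA (prepend (act T B) (prepend (act T B) (prepend (act T B) Ψ))))) (r + 1) := by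
  rw [mulNet_wall hB hc (hA.prepend_three Ψ), hA.mulNet_prepend, hA.mulNet_prepend]

theorem mulNet_wall_closed (hB : Reduces (act T A) B WB WhatB)
    (hA : Reduces (act T B) A WA WhatA)
    (hc : ∀ i j k, WhatB * act T A i * act T e j * act T B k * WA = c • (B i * f j * A k))
    (Ψ : (Fin L → P) → Matrix α k ℂ) (q r : ℕ) :
    mulNet WhatB (prependN (act T A) (prepend (act T e)
        (prependN (act T B) (mulNet WA Ψ) (q + 1))) (r + 1)) =
      c • prependN B (prepend f (prependN A Ψ (q + 1))) (r + 1) :=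
  mulNet_wall hB hc (hA.prepend_prependN_mulNet Ψ q) r

end Wall

/-! ### Exchange of domain wall operators -/

namespace DWData

variable {P χ α β : Type*} [Fintype P] [DecidableEq P] [Fintype χ] [DecidableEq χ]
  [Fintype α] [DecidableEq α] [Fintype β] [DecidableEq β] (S : DWData P χ α β)

/-- The local relations used to move domain walls. -/
structure LocalRules (cAB cBA : ℂ) : Prop where
  left_inverse_A : IsLeftInverse S.Ahat S.A
  left_inverse_B : IsLeftInverse S.Bhat S.B
  separate_AB : Annihilates S.Ahat S.B
  separate_BA : Annihilates S.Bhat S.A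
  redB : Reduces (act S.T S.A) S.B S.WB S.WhatB
  redA : Reduces (act S.T S.B) S.A S.WA S.WhatA
  cAB : S.IsCAB cAB
  cBA : S.IsCBA cBA

/-- Exchanging the roles of the two ground states. -/
def swap : DWData P χ β α where
  T := S.T
  V := S.V
  Vhat := S.Vhat
  A := S.B
  B := S.A
  Ahat := S.Bhat
  Bhat := S.Ahat
  WB := S.WA
  WhatB := S.WhatA
  WA := S.WB
  WhatA := S.WhatB
  eAB := S.eBA
  eBA := S.eAB

theorem swap_leftEnd : S.swap.leftEnd = S.leftEnd := by
  funext s t q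
  exact add_comm _ _

theorem swap_halfOp {L : ℕ} (i : Fin L) (x : χ) : S.swap.halfOp i x = S.halfOp i x := by
  simp only [halfOp, swap_leftEnd]
  rfl

variable {S} {cAB cBA : ℂ}

theorem LocalRules.swap (h : S.LocalRules cAB cBA) : S.swap.LocalRules cBA cAB :=
  ⟨h.left_inverse_B, h.left_inverse_A, h.separate_BA, h.separate_AB, h.redA, h.redB, h.cBA, h.cAB⟩

theorem sum_sum_mul {ι κ : Type*} [Fintype ι] [Fintype κ] (X : ι → κ → ℂ) (F : P → ι → κ → ℂ)
    (g : P → ℂ) :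
    ∑ t, (∑ c, ∑ d, X c d * F t c d) * g t = ∑ c, ∑ d, X c d * ∑ t, F t c d * g t := by
  simp only [Finset.sum_mul, Finset.mul_sum, mul_assoc]
  rw [Finset.sum_comm]
  exact Finset.sum_congr rfl fun _ _ => Finset.sum_comm

/-- `Ahat` contracted with `A` is the identity on the virtual legs and `Bhat` contracted with `A`
vanishes, so one summand of the endpoint tensor survives. -/
theorem LocalRules.leftTop_A (h : S.LocalRules cAB cBA) :
    S.leftTop S.A = fun p => S.eAB p * S.WhatB := by
  funext p
  ext a ⟨q, b⟩
  have h1 : ∀ c d, ∑ t, S.Ahat t c d * S.A t a b = if c = a ∧ d = b then 1 else 0 :=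
    fun c d => h.left_inverse_A c d a b
  have h2 : ∀ c d, ∑ t, S.Bhat t c d * S.A t a b = 0 := fun c d => h.separate_BA c d a b
  simp only [leftTop, Matrix.sum_apply, rowKron, Matrix.of_apply, leftEnd, add_mul,
    Finset.sum_add_distrib]
  rw [sum_sum_mul (fun c d => (S.eAB p * S.WhatB) c (q, d)) S.Ahat,
    sum_sum_mul (fun c d => (S.eBA p * S.WhatA) c (q, d)) S.Bhat]
  simp [h1, h2, ite_and]

theorem LocalRules.leftTop_B (h : S.LocalRules cAB cBA) :
    S.leftTop S.B = fun p => S.eBA p * S.WhatA := by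
  funext p
  have := congrFun h.swap.leftTop_A p
  rw [leftTop, swap_leftEnd] at this
  exact this

theorem LocalRules.rightTop_A (h : S.LocalRules cAB cBA) :
    S.rightTop S.A = fun p => S.WB * S.eBA p := by
  funext p
  ext ⟨q, a⟩ b
  have h1 : ∀ c d, ∑ t, S.Ahat t c d * S.A t a b = if c = a ∧ d = b then 1 else 0 :=
    fun c d => h.left_inverse_A c d a b
  have h2 : ∀ c d, ∑ t, S.Bhat t c d * S.A t a b = 0 := fun c d => h.separate_BA c d a b
  simp only [rightTop, Matrix.sum_apply, colKron, Matrix.of_apply, rightEnd, add_mul,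
    Finset.sum_add_distrib]
  rw [sum_sum_mul (fun c d => (S.WB * S.eBA p) (q, c) d) S.Ahat,
    sum_sum_mul (fun c d => (S.WA * S.eAB p) (q, c) d) S.Bhat]
  simp [h1, h2, ite_and]

theorem LocalRules.rightTop_B (h : S.LocalRules cAB cBA) :
    S.rightTop S.B = fun p => S.WA * S.eAB p := by
  funext p
  have he : S.swap.rightEnd = S.rightEnd := by
    funext s t q
    exact add_comm _ _
  have := congrFun h.swap.rightTop_A p
  rw [rightTop, he] at this
  exact this

/-- Exchange of two domain walls on the half chain. -/
theorem LocalRules.halfAct_halfAct (h : S.LocalRules cAB cBA) {L : ℕ} {i j : Fin L}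
    (hji : (j : ℕ) + 2 ≤ i) (hi : (i : ℕ) + 5 ≤ L) :
    S.halfAct j (S.halfAct i (word S.A L)) = cAB • S.halfAct i (S.halfAct j (word S.A L)) := by
  obtain ⟨m, hm⟩ := Nat.exists_eq_add_of_le hji
  obtain ⟨n, hn⟩ := Nat.exists_eq_add_of_le hi
  obtain ⟨r, hr⟩ : ∃ r, r = (j : ℕ) := ⟨_, rfl⟩
  -- Read from the right end: `n + 1 + 3` sites behind the wall at `i`, the wall, `m + 1` sites, the
  -- wall at `j`, `r` sites. The `3` are the sites cut open behind the wall, and one further site is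
  -- needed to push the first closing tensor beyond them.
  obtain rfl : L = n + 1 + 3 + 1 + (m + 1) + 1 + r := by omega
  have hw : word S.A (n + 1 + 3 + 1 + (m + 1) + 1 + r) = prependN S.A (prepend S.A
      (prependN S.A (prepend S.A (word S.A (n + 1 + 3))) (m + 1))) r := by
    rw [word_add, word_succ, word_add, word_succ]
  have lhs : S.halfAct j (S.halfAct i (word S.A (n + 1 + 3 + 1 + (m + 1) + 1 + r))) =
      prependN S.A (prepend S.eAB (mulNet S.WhatB (prependN (act S.T S.A) (prepend (act S.T S.eAB)
        (mulNet ((1 : Matrix χ χ ℂ) ⊗ₖ S.WhatB) (word (act S.T (act S.T S.A)) (n + 1 + 3))))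
        (m + 1)))) r := by
    rw [hw, S.halfAct_prependN (i' := ⟨m + 1 + 1, by omega⟩) (by simp; omega),
      S.halfAct_prepend (i' := ⟨m + 1, by omega⟩) rfl,
      S.halfAct_here (i := (⟨m + 1, by omega⟩ : Fin (n + 1 + 3 + 1 + (m + 1)))) rfl,
      S.halfAct_here hr.symm,
      h.leftTop_A, prepend_mul, prepend_mul, onTop_word, onTop_prependN, onTop_prepend,
      onTop_mulNet, onTop_word]
  have rhs : S.halfAct i (S.halfAct j (word S.A (n + 1 + 3 + 1 + (m + 1) + 1 + r))) =
      prependN S.A (prepend S.eAB (prependN S.B (prepend S.eBA (mulNet S.WhatA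
        (mulNet ((1 : Matrix χ χ ℂ) ⊗ₖ S.WhatB) (word (act S.T (act S.T S.A)) (n + 1 + 3)))))
        (m + 1))) r := by
    have h1 : mulNet S.WhatB (word (act S.T S.A) (n + 1 + 3 + 1 + (m + 1))) =
        prependN S.B (prepend S.B (mulNet S.WhatB (word (act S.T S.A) (n + 1 + 3)))) (m + 1) := by
      rw [h.redB.mulNet_word]
      congr 1
      exact h.redB.mulNet_word (n + 1 + 2) 1
    rw [word_add, word_succ, S.halfAct_here hr.symm, onTop_word, h.leftTop_A, prepend_mul, h1,
      S.halfAct_prependN (i' := ⟨m + 1 + 1, by omega⟩) (by simp; omega),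
      S.halfAct_prepend (i' := ⟨m + 1, by omega⟩) rfl,
      S.halfAct_here (i := (⟨m + 1, by omega⟩ : Fin (n + 1 + 3 + 1 + (m + 1)))) rfl,
      h.leftTop_B, prepend_mul, onTop_mulNet, onTop_word]
  -- The only crossing: in the other order the left operator acts before the right wall exists.
  have key : mulNet S.WhatB (prependN (act S.T S.A) (prepend (act S.T S.eAB)
      (mulNet ((1 : Matrix χ χ ℂ) ⊗ₖ S.WhatB) (word (act S.T (act S.T S.A)) (n + 1 + 3))))
      (m + 1)) = cAB • prependN S.B (prepend S.eBA (mulNet S.WhatA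
        (mulNet ((1 : Matrix χ χ ℂ) ⊗ₖ S.WhatB) (word (act S.T (act S.T S.A)) (n + 1 + 3)))))
        (m + 1) := by
    rw [(h.redB.lift S.T).mulNet_word]
    exact mulNet_wall_open h.redB h.redA h.cAB _ m
  rw [lhs, rhs, key, prepend_smul, prependN_smul]

/-- Moving a domain wall through two others on the half chain. -/
theorem LocalRules.halfAct_halfAct_halfAct (h : S.LocalRules cAB cBA) {L : ℕ} {i j k : Fin L}
    (hkj : (k : ℕ) + 2 ≤ j) (hji : (j : ℕ) + 4 ≤ i) (hi : (i : ℕ) + 6 ≤ L) :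
    S.halfAct k (S.halfAct i (S.halfAct j (word S.A L))) =
      cBA • S.halfAct i (S.halfAct k (S.halfAct j (word S.A L))) := by
  obtain ⟨q, hq⟩ := Nat.exists_eq_add_of_le hkj
  obtain ⟨m, hm⟩ := Nat.exists_eq_add_of_le hji
  obtain ⟨n, hn⟩ := Nat.exists_eq_add_of_le hi
  obtain ⟨r, hr⟩ : ∃ r, r = (k : ℕ) := ⟨_, rfl⟩
  -- The layer of the operator at `k` crosses the walls at `j` and at `i`. The `m + 3` sites between
  -- those walls provide the cut for the first crossing; behind `i` two nested closing tensors must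
  -- be pushed away, each of which uses up one site beyond the three that are cut.
  obtain rfl : L = n + 1 + 4 + 1 + (m + 3) + 1 + (q + 1) + 1 + r := by omega
  set TA := act S.T S.A with hTA
  set O : Matrix (χ × β) (χ × (χ × α)) ℂ := (1 : Matrix χ χ ℂ) ⊗ₖ S.WhatB with hO
  have hlift := h.redB.lift S.T
  have hlift2 := hlift.lift S.T
  have hj : S.halfAct j (word S.A (n + 1 + 4 + 1 + (m + 3) + 1 + (q + 1) + 1 + r)) =
      prependN S.A (prepend S.A (prependN S.A (prepend S.eAB (mulNet S.WhatB
        (word TA (n + 1 + 4 + 1 + (m + 3))))) (q + 1))) r := by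
    rw [word_add, word_succ, word_add, word_succ,
      S.halfAct_prependN (i' := ⟨q + 1 + 1, by omega⟩) (by simp; omega),
      S.halfAct_prepend (i' := ⟨q + 1, by omega⟩) rfl,
      S.halfAct_here (i := (⟨q + 1, by omega⟩ : Fin (n + 1 + 4 + 1 + (m + 3) + 1 + (q + 1)))) rfl,
      onTop_word, h.leftTop_A, prepend_mul]
  have hij : S.halfAct i (S.halfAct j
      (word S.A (n + 1 + 4 + 1 + (m + 3) + 1 + (q + 1) + 1 + r))) =
      prependN S.A (prepend S.A (prependN S.A (prepend S.eAB (prependN S.B (prepend S.eBA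
        (mulNet S.WhatA (mulNet O (word (act S.T TA) (n + 1 + 4))))) (m + 3))) (q + 1))) r := by
    have h1 : mulNet S.WhatB (word TA (n + 1 + 4 + 1 + (m + 3))) =
        prependN S.B (prepend S.B (mulNet S.WhatB (word TA (n + 1 + 4)))) (m + 3) := by
      rw [h.redB.mulNet_word]
      congr 1
      exact h.redB.mulNet_word (n + 1 + 3) 1
    rw [hj, h1, S.halfAct_prependN (i' := ⟨m + 3 + 1 + (q + 1) + 1, by omega⟩) (by simp; omega),
      S.halfAct_prepend (i' := ⟨m + 3 + 1 + (q + 1), by omega⟩) rfl,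
      S.halfAct_prependN (i' := ⟨m + 3 + 1, by omega⟩) rfl,
      S.halfAct_prepend (i' := ⟨m + 3, by omega⟩) rfl,
      S.halfAct_here (i := (⟨m + 3, by omega⟩ : Fin (n + 1 + 4 + 1 + (m + 3)))) rfl,
      h.leftTop_B, prepend_mul, onTop_mulNet, onTop_word]
  have hkij : S.halfAct k (S.halfAct i (S.halfAct j
      (word S.A (n + 1 + 4 + 1 + (m + 3) + 1 + (q + 1) + 1 + r)))) =
      prependN S.A (prepend S.eAB (mulNet S.WhatB (prependN TA (prepend (act S.T S.eAB)
        (prependN (act S.T S.B) (prepend (act S.T S.eBA)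
          (mulNet ((1 : Matrix χ χ ℂ) ⊗ₖ S.WhatA) (mulNet ((1 : Matrix χ χ ℂ) ⊗ₖ O)
            (word (act S.T (act S.T TA)) (n + 1 + 4))))) (m + 3))) (q + 1)))) r := by
    rw [hij, S.halfAct_here hr.symm, h.leftTop_A, prepend_mul, onTop_prependN, onTop_prepend,
      onTop_prependN, onTop_prepend, onTop_mulNet, onTop_mulNet, onTop_word]
  have hkj : S.halfAct k (S.halfAct j
      (word S.A (n + 1 + 4 + 1 + (m + 3) + 1 + (q + 1) + 1 + r))) =
      prependN S.A (prepend S.eAB (mulNet S.WhatB (prependN TA (prepend (act S.T S.eAB)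
        (mulNet O (word (act S.T TA) (n + 1 + 4 + 1 + (m + 3))))) (q + 1)))) r := by
    rw [hj, S.halfAct_here hr.symm, h.leftTop_A, prepend_mul, onTop_prependN, onTop_prepend,
      onTop_mulNet, onTop_word]
  have hkj' : S.halfAct k (S.halfAct j
      (word S.A (n + 1 + 4 + 1 + (m + 3) + 1 + (q + 1) + 1 + r))) =
      cAB • prependN S.A (prepend S.eAB (prependN S.B (prepend S.eBA (prependN S.A (prepend S.A
        (mulNet S.WhatA (mulNet O (word (act S.T TA) (n + 1 + 4))))) (m + 3))) (q + 1))) r := by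
    have h1 : mulNet S.WhatA (mulNet O (word (act S.T TA) (n + 1 + 4 + 1 + (m + 3)))) =
        prependN S.A (prepend S.A (mulNet S.WhatA (mulNet O (word (act S.T TA) (n + 1 + 4)))))
          (m + 3) := by
      have e1 : mulNet O (word (act S.T TA) (n + 1 + 4 + 1)) =
          prepend (act S.T S.B) (mulNet O (word (act S.T TA) (n + 1 + 4))) :=
        hlift.mulNet_word (n + 1 + 3) 1
      have e2 : mulNet O (word (act S.T TA) (n + 1 + 4)) =
          prepend (act S.T S.B) (mulNet O (word (act S.T TA) (n + 1 + 3))) :=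
        hlift.mulNet_word (n + 1 + 2) 1
      rw [hlift.mulNet_word, e1, h.redA.mulNet_prependN, e2, h.redA.mulNet_prepend]
    have h2 : mulNet S.WhatB (prependN TA (prepend (act S.T S.eAB)
        (mulNet O (word (act S.T TA) (n + 1 + 4 + 1 + (m + 3))))) (q + 1)) =
        cAB • prependN S.B (prepend S.eBA (mulNet S.WhatA
          (mulNet O (word (act S.T TA) (n + 1 + 4 + 1 + (m + 3)))))) (q + 1) := by
      rw [hlift.mulNet_word]
      exact mulNet_wall_open h.redB h.redA h.cAB _ q
    rw [hkj, h2, h1, prepend_smul, prependN_smul]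
  have hikj : S.halfAct i (S.halfAct k (S.halfAct j
      (word S.A (n + 1 + 4 + 1 + (m + 3) + 1 + (q + 1) + 1 + r)))) =
      cAB • prependN S.A (prepend S.eAB (prependN S.B (prepend S.eBA (prependN S.A (prepend S.eAB
        (mulNet S.WhatB (mulNet ((1 : Matrix χ χ ℂ) ⊗ₖ S.WhatA) (mulNet ((1 : Matrix χ χ ℂ) ⊗ₖ O)
          (word (act S.T (act S.T TA)) (n + 1 + 4)))))) (m + 3))) (q + 1))) r := by
    rw [hkj', halfAct_smul,
      S.halfAct_prependN (i' := ⟨m + 3 + 1 + (q + 1) + 1, by omega⟩) (by simp; omega),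
      S.halfAct_prepend (i' := ⟨m + 3 + 1 + (q + 1), by omega⟩) rfl,
      S.halfAct_prependN (i' := ⟨m + 3 + 1, by omega⟩) rfl,
      S.halfAct_prepend (i' := ⟨m + 3, by omega⟩) rfl,
      S.halfAct_here (i := (⟨m + 3, by omega⟩ : Fin (n + 1 + 4 + 1 + (m + 3)))) rfl,
      h.leftTop_A, prepend_mul, onTop_mulNet, onTop_mulNet, onTop_word]
  have w1 : ∀ {κ : Type _} [Fintype κ] [DecidableEq κ]
      (Ψ : (Fin (n + 1 + 4 + 1 + m) → P) → Matrix (χ × β) κ ℂ),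
      mulNet S.WhatB (prependN TA (prepend (act S.T S.eAB)
        (prepend (act S.T S.B) (prepend (act S.T S.B) (prepend (act S.T S.B) Ψ)))) (q + 1)) =
      cAB • prependN S.B (prepend S.eBA (mulNet S.WhatA
        (prepend (act S.T S.B) (prepend (act S.T S.B) (prepend (act S.T S.B) Ψ))))) (q + 1) :=
    fun Ψ => mulNet_wall_open h.redB h.redA h.cAB Ψ q
  have w2 : mulNet S.WhatA (prependN (act S.T S.B) (prepend (act S.T S.eBA)
        (mulNet ((1 : Matrix χ χ ℂ) ⊗ₖ S.WhatA) (mulNet ((1 : Matrix χ χ ℂ) ⊗ₖ O)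
          (word (act S.T (act S.T TA)) (n + 1 + 4))))) (m + 3)) =
      cBA • prependN S.A (prepend S.eAB (mulNet S.WhatB
        (mulNet ((1 : Matrix χ χ ℂ) ⊗ₖ S.WhatA) (mulNet ((1 : Matrix χ χ ℂ) ⊗ₖ O)
          (word (act S.T (act S.T TA)) (n + 1 + 4)))))) (m + 3) := by
    rw [hlift2.mulNet_word]
    have e : mulNet ((1 : Matrix χ χ ℂ) ⊗ₖ S.WhatA) (prependN (act S.T (act S.T S.B))
        (mulNet ((1 : Matrix χ χ ℂ) ⊗ₖ O) (word (act S.T (act S.T TA)) (n + 1))) 4) =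
        prependN TA (mulNet ((1 : Matrix χ χ ℂ) ⊗ₖ S.WhatA) (prepend (act S.T (act S.T S.B))
          (mulNet ((1 : Matrix χ χ ℂ) ⊗ₖ O) (word (act S.T (act S.T TA)) (n + 1))))) 3 :=
      (h.redA.lift S.T).mulNet_prependN (mulNet ((1 : Matrix χ χ ℂ) ⊗ₖ O)
        (word (act S.T (act S.T TA)) (n + 1))) 3
    rw [e]
    exact mulNet_wall_open h.redA h.redB h.cBA _ (m + 2)
  -- Acting last, the operator at `k` crosses both walls and collects `cAB` and `cBA`. Acting before
  -- the one at `i`, it crosses only the wall at `j`, so `cAB` is common to both sides.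
  rw [hkij, hikj, smul_comm]
  have w3 := w1 (prependN (act S.T S.B) (prepend (act S.T S.eBA)
          (mulNet ((1 : Matrix χ χ ℂ) ⊗ₖ S.WhatA) (mulNet ((1 : Matrix χ χ ℂ) ⊗ₖ O)
            (word (act S.T (act S.T TA)) (n + 1 + 4))))) m)
  change mulNet S.WhatB (prependN TA (prepend (act S.T S.eAB)
        (prependN (act S.T S.B) (prepend (act S.T S.eBA)
          (mulNet ((1 : Matrix χ χ ℂ) ⊗ₖ S.WhatA) (mulNet ((1 : Matrix χ χ ℂ) ⊗ₖ O)
            (word (act S.T (act S.T TA)) (n + 1 + 4))))) (m + 3))) (q + 1)) =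
      cAB • prependN S.B (prepend S.eBA (mulNet S.WhatA (prependN (act S.T S.B)
        (prepend (act S.T S.eBA)
          (mulNet ((1 : Matrix χ χ ℂ) ⊗ₖ S.WhatA) (mulNet ((1 : Matrix χ χ ℂ) ⊗ₖ O)
            (word (act S.T (act S.T TA)) (n + 1 + 4))))) (m + 3)))) (q + 1) at w3
  rw [w3, w2]
  simp only [prepend_smul, prependN_smul]

/-- Nested pairs of domain walls on the periodic chain. -/
theorem LocalRules.pairAct_pairAct (h : S.LocalRules cAB cBA) {N : ℕ} {i₁ j₁ i₂ j₂ : Fin N}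
    (hi : (i₂ : ℕ) + 2 ≤ i₁) (hm : (i₁ : ℕ) + 4 ≤ j₁) (hj : (j₁ : ℕ) + 2 ≤ j₂) :
    S.pairAct i₂ j₂ (S.pairAct i₁ j₁ (word S.A N)) =
      (cAB * cBA) • S.pairAct i₁ j₁ (S.pairAct i₂ j₂ (word S.A N)) := by
  obtain ⟨a, ha⟩ := Nat.exists_eq_add_of_le hi
  obtain ⟨b, hb⟩ := Nat.exists_eq_add_of_le hm
  obtain ⟨c, hc⟩ := Nat.exists_eq_add_of_le hj
  obtain ⟨r, hr⟩ : ∃ r, r = (i₂ : ℕ) := ⟨_, rfl⟩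
  obtain ⟨d, hd⟩ := Nat.exists_eq_add_of_le j₂.2
  -- From the right: `d` sites behind `j₂`, `c + 1` between `j₁` and `j₂`, `b + 3` between `i₁` and
  -- `j₁`, `a + 1` between `i₂` and `i₁`, `r` before `i₂`.
  obtain rfl : N = d + 1 + (c + 1) + 1 + (b + 3) + 1 + (a + 1) + 1 + r := by omega
  have hw : word S.A (d + 1 + (c + 1) + 1 + (b + 3) + 1 + (a + 1) + 1 + r) =
      prependN S.A (prepend S.A (prependN S.A (prepend S.A (prependN S.A (prepend S.A
        (prependN S.A (prepend S.A (word S.A d)) (c + 1))) (b + 3))) (a + 1))) r := by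
    simp only [word_add, word_succ]
  have h₁ : S.pairAct i₁ j₁ (word S.A (d + 1 + (c + 1) + 1 + (b + 3) + 1 + (a + 1) + 1 + r)) =
      prependN S.A (prepend S.A (prependN S.A (prepend S.eAB (prependN S.B (prepend S.eBA
        (prependN S.A (prepend S.A (word S.A d)) (c + 1))) (b + 3))) (a + 1))) r := by
    rw [hw, S.pairAct_prependN (i' := ⟨a + 1 + 1, by omega⟩)
        (j' := ⟨b + 3 + 1 + (a + 1) + 1, by omega⟩) (by simp; omega) (by simp; omega),
      S.pairAct_prepend (i' := ⟨a + 1, by omega⟩) (j' := ⟨b + 3 + 1 + (a + 1), by omega⟩) rfl rfl,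
      S.pairAct_here
        (i := (⟨a + 1, by omega⟩ : Fin (d + 1 + (c + 1) + 1 + (b + 3) + 1 + (a + 1))))
        (j' := ⟨b + 3, by omega⟩) rfl rfl,
      S.rightAct_here (j := (⟨b + 3, by omega⟩ : Fin (d + 1 + (c + 1) + 1 + (b + 3)))) rfl,
      h.leftTop_A, prepend_mul, h.rightTop_A, mul_prepend, h.redB.mulNet_prependN_close]
  have h₂₁ : S.pairAct i₂ j₂ (S.pairAct i₁ j₁
      (word S.A (d + 1 + (c + 1) + 1 + (b + 3) + 1 + (a + 1) + 1 + r))) =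
      prependN S.A (prepend S.eAB (mulNet S.WhatB (prependN (act S.T S.A) (prepend (act S.T S.eAB)
        (prependN (act S.T S.B) (prepend (act S.T S.eBA) (prependN (act S.T S.A)
          (mulNet S.WB (prepend S.eBA (word S.A d))) (c + 1))) (b + 3))) (a + 1)))) r := by
    rw [h₁, S.pairAct_here (j' := ⟨c + 1 + 1 + (b + 3) + 1 + (a + 1), by omega⟩) hr.symm
        (by simp; omega),
      S.rightAct_prependN (j' := ⟨c + 1 + 1 + (b + 3) + 1, by omega⟩) rfl,
      S.rightAct_prepend (j' := ⟨c + 1 + 1 + (b + 3), by omega⟩) rfl,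
      S.rightAct_prependN (j' := ⟨c + 1 + 1, by omega⟩) rfl,
      S.rightAct_prepend (j' := ⟨c + 1, by omega⟩) rfl,
      S.rightAct_here (j := (⟨c + 1, by omega⟩ : Fin (d + 1 + (c + 1)))) rfl,
      h.leftTop_A, prepend_mul, h.rightTop_A, mul_prepend]
  have h₂ : S.pairAct i₂ j₂ (word S.A (d + 1 + (c + 1) + 1 + (b + 3) + 1 + (a + 1) + 1 + r)) =
      prependN S.A (prepend S.eAB (prependN S.B (prepend S.B (prependN S.B (prepend S.B
        (prependN S.B (prepend S.eBA (word S.A d)) (c + 1))) (b + 3))) (a + 1))) r := by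
    have e : ∀ {L : ℕ} (Ψ : (Fin L → P) → Matrix (χ × α) α ℂ) (q : ℕ),
        mulNet S.WhatB (prepend (act S.T S.A) (prependN (act S.T S.A) Ψ (q + 1))) =
          prepend S.B (mulNet S.WhatB (prependN (act S.T S.A) Ψ (q + 1))) :=
      fun Ψ q => h.redB.mulNet_prepend (prependN (act S.T S.A) Ψ q)
    rw [hw, S.pairAct_here (j' := ⟨c + 1 + 1 + (b + 3) + 1 + (a + 1), by omega⟩) hr.symm
        (by simp; omega),
      S.rightAct_prependN (j' := ⟨c + 1 + 1 + (b + 3) + 1, by omega⟩) rfl,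
      S.rightAct_prepend (j' := ⟨c + 1 + 1 + (b + 3), by omega⟩) rfl,
      S.rightAct_prependN (j' := ⟨c + 1 + 1, by omega⟩) rfl,
      S.rightAct_prepend (j' := ⟨c + 1, by omega⟩) rfl,
      S.rightAct_here (j := (⟨c + 1, by omega⟩ : Fin (d + 1 + (c + 1)))) rfl,
      h.leftTop_A, prepend_mul, h.rightTop_A, mul_prepend, h.redB.mulNet_prependN, e,
      h.redB.mulNet_prependN, e, h.redB.mulNet_prependN_close]
  have h₁₂ : S.pairAct i₁ j₁ (S.pairAct i₂ j₂
      (word S.A (d + 1 + (c + 1) + 1 + (b + 3) + 1 + (a + 1) + 1 + r))) =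
      prependN S.A (prepend S.eAB (prependN S.B (prepend S.eBA (prependN S.A (prepend S.eAB
        (prependN S.B (prepend S.eBA (word S.A d)) (c + 1))) (b + 3))) (a + 1))) r := by
    rw [h₂, S.pairAct_prependN (i' := ⟨a + 1 + 1, by omega⟩)
        (j' := ⟨b + 3 + 1 + (a + 1) + 1, by omega⟩) (by simp; omega) (by simp; omega),
      S.pairAct_prepend (i' := ⟨a + 1, by omega⟩) (j' := ⟨b + 3 + 1 + (a + 1), by omega⟩) rfl rfl,
      S.pairAct_here
        (i := (⟨a + 1, by omega⟩ : Fin (d + 1 + (c + 1) + 1 + (b + 3) + 1 + (a + 1))))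
        (j' := ⟨b + 3, by omega⟩) rfl rfl,
      S.rightAct_here (j := (⟨b + 3, by omega⟩ : Fin (d + 1 + (c + 1) + 1 + (b + 3)))) rfl,
      h.leftTop_B, prepend_mul, h.rightTop_B, mul_prepend, h.redA.mulNet_prependN_close]
  rw [h₂₁, h₁₂]
  have w : ∀ {L : ℕ} (Ψ : (Fin L → P) → Matrix (χ × β) α ℂ),
      mulNet S.WhatB (prependN (act S.T S.A) (prepend (act S.T S.eAB)
        (prependN (act S.T S.B) Ψ (b + 3))) (a + 1)) =
      cAB • prependN S.B (prepend S.eBA (mulNet S.WhatA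
        (prependN (act S.T S.B) Ψ (b + 3)))) (a + 1) :=
    fun Ψ => mulNet_wall_open h.redB h.redA h.cAB (prependN (act S.T S.B) Ψ b) a
  -- The outer string crosses the wall at `i₁` by means of a cut among the `b + 3` inner sites. At
  -- `j₁` no cut is needed: the outer right endpoint supplies `WB`.
  rw [w, mulNet_wall_closed h.redA h.redB h.cBA (prepend S.eBA (word S.A d)) c (b + 2)]
  simp only [prepend_smul, prependN_smul, smul_smul]

end DWData

/-! ### Existence of the domain wall factors -/

section PairState

variable {P α β : Type*} [Fintype P] [Fintype α] [DecidableEq α] [Fintype β] [DecidableEq β]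

/-- A chain of `B` ending with `f` at the site `l` and continued by `A`. -/
def rightWall (A : P → Matrix α α ℂ) (B : P → Matrix β β ℂ) (f : P → Matrix β α ℂ) {N : ℕ}
    (l : Fin N) (s : Fin N → P) : Matrix β α ℂ :=
  siteProd (fun x => x < l) (fun x => B (s x)) * f (s l) *
    siteProd (fun x => l < x) (fun x => A (s x))

/-- The matrix whose trace is `pairState`. -/
def pairNet (A : P → Matrix α α ℂ) (B : P → Matrix β β ℂ) (e : P → Matrix α β ℂ)
    (f : P → Matrix β α ℂ) {N : ℕ} (k l : Fin N) (s : Fin N → P) : Matrix α α ℂ :=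
  siteProd (fun x => x < k) (fun x => A (s x)) * e (s k) *
    siteProd (fun x => k < x ∧ x < l) (fun x => B (s x)) * f (s l) *
    siteProd (fun x => l < x) (fun x => A (s x))

variable (A : P → Matrix α α ℂ) (B : P → Matrix β β ℂ) (e : P → Matrix α β ℂ)
  (f : P → Matrix β α ℂ)

theorem rightWall_zero (n : ℕ) : rightWall A B f (0 : Fin (n + 1)) = prepend f (word A n) := by
  funext s
  rw [rightWall, siteProd_of_forall_not _ _ fun k => Fin.not_lt_zero k, Matrix.one_mul,
    siteProd_succ, if_neg (lt_irrefl _), Matrix.one_mul, siteProd_of_forall _ _ fun k => k.succ_pos]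
  rfl

theorem rightWall_succ {N : ℕ} (l : Fin N) :
    rightWall A B f l.succ = prepend B (rightWall A B f l) := by
  funext s
  rw [rightWall, siteProd_succ_of_pos (fun x => x < l) _ (by simp) (by simp),
    siteProd_succ_of_not (fun x => l < x) _ (by simp) (by simp)]
  simp only [prepend, rightWall, Matrix.mul_assoc]
  rfl

theorem rightWall_prependN {L r : ℕ} {l : Fin (L + r)} {l' : Fin L} (h : (l : ℕ) = l' + r) :
    rightWall A B f l = prependN B (rightWall A B f l') r := by
  induction r with
  | zero => obtain rfl : l = l' := Fin.ext h; rfl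
  | succ r ih =>
    obtain rfl : l = Fin.succ (⟨l' + r, Nat.add_lt_add_right l'.2 r⟩ : Fin (L + r)) := Fin.ext h
    rw [prependN_succ, ← ih (l := ⟨l' + r, Nat.add_lt_add_right l'.2 r⟩) rfl]
    exact rightWall_succ A B f _

theorem pairNet_zero {N : ℕ} (l : Fin N) :
    pairNet A B e f 0 l.succ = prepend e (rightWall A B f l) := by
  funext s
  rw [pairNet, siteProd_of_forall_not _ _ fun k => Fin.not_lt_zero k, Matrix.one_mul,
    siteProd_succ_of_not (fun x => x < l) _ (by simp) (by simp),
    siteProd_succ_of_not (fun x => l < x) _ (by simp) (by simp)]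
  simp only [prepend, rightWall, Matrix.mul_assoc]
  rfl

theorem pairNet_succ {N : ℕ} (k l : Fin N) :
    pairNet A B e f k.succ l.succ = prepend A (pairNet A B e f k l) := by
  funext s
  rw [pairNet, siteProd_succ_of_pos (fun x => x < k) _ (by simp) (by simp),
    siteProd_succ_of_not (fun x => k < x ∧ x < l) _ (by simp) (by simp),
    siteProd_succ_of_not (fun x => l < x) _ (by simp) (by simp)]
  simp only [prepend, pairNet, Matrix.mul_assoc]
  rfl

theorem pairNet_prependN {L r : ℕ} {k l : Fin (L + r)} {k' l' : Fin L} (hk : (k : ℕ) = k' + r)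
    (hl : (l : ℕ) = l' + r) :
    pairNet A B e f k l = prependN A (pairNet A B e f k' l') r := by
  induction r with
  | zero =>
    obtain rfl : k = k' := Fin.ext hk
    obtain rfl : l = l' := Fin.ext hl
    rfl
  | succ r ih =>
    obtain rfl : k = Fin.succ (⟨k' + r, Nat.add_lt_add_right k'.2 r⟩ : Fin (L + r)) := Fin.ext hk
    obtain rfl : l = Fin.succ (⟨l' + r, Nat.add_lt_add_right l'.2 r⟩ : Fin (L + r)) := Fin.ext hl
    rw [prependN_succ, ← ih (k := ⟨k' + r, Nat.add_lt_add_right k'.2 r⟩)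
      (l := ⟨l' + r, Nat.add_lt_add_right l'.2 r⟩) rfl rfl]
    exact pairNet_succ A B e f _ _

/-- A chain of `A` with a domain `B`, with `e` and `f` at its ends, built site by site. -/
def pairChain (n m r : ℕ) : (Fin (n + 1 + 1 + m + 1 + 1 + r) → P) → Matrix α α ℂ :=
  prependN A (prepend A (prepend e (prependN B (prepend B (prepend f (word A n))) m))) r

theorem pairState_eq_trace {n m r : ℕ} {k l : Fin (n + 1 + 1 + m + 1 + 1 + r)}
    (hk : (k : ℕ) = 1 + r) (hl : (l : ℕ) = 1 + m + 1 + 1 + r) :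
    pairState A B e f k l = fun s => (pairChain A B e f n m r s).trace := by
  have h : pairNet A B e f k l = pairChain A B e f n m r := by
    rw [pairNet_prependN A B e f (k' := (0 : Fin (n + 1 + 1 + m + 1)).succ)
      (l' := ((⟨1 + m, by omega⟩ : Fin (n + 1 + 1 + m)).succ).succ) hk hl, pairNet_succ,
      pairNet_zero, rightWall_prependN A B f (l' := (0 : Fin (n + 1)).succ) rfl, rightWall_succ,
      rightWall_zero]
    rfl
  rw [← h]
  rfl

end PairState

/-! ### Localizing an identity of periodic states -/

section Peel

variable {P m n k : Type*} [Fintype P] [Fintype m] [DecidableEq m] [Fintype n] [DecidableEq n]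
  [Fintype k] [DecidableEq k] {L : ℕ}

/-- After one cut near the right end, `W` is moved left through the block, so that only its first
and last sites keep the layer. The sites in between become spanning tensors that can be peeled. -/
theorem Reduces.prependN_cut {M : P → Matrix m m ℂ} {N : P → Matrix n n ℂ} {W : Matrix m n ℂ}
    {What : Matrix n m ℂ} (h : Reduces M N W What) (Ψ : (Fin L → P) → Matrix m k ℂ) (r : ℕ) :
    prependN M (prepend M Ψ) (r + 2) =
      prepend M (mulNet W (prependN N (mulNet What (prepend M Ψ)) (r + 1))) := by
  induction r with
  | zero => exact h.prepend_three Ψ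
  | succ r ih =>
    rw [prependN_succ, ih, prependN_succ N _ (r + 1)]
    funext s
    simp only [mulNet, prepend, ← Matrix.mul_assoc, h.right]

/-- A block of spanning tensors in a network may be replaced by an arbitrary matrix. -/
theorem Spanning.peel {B : P → Matrix m m ℂ} (hB : Spanning B) {l : Type*} [Fintype l]
    {k : Type*} [Fintype k] {r : ℕ}
    {Ψ : (Fin L → P) → Matrix m k ℂ} {Ψ' : (Fin L → P) → Matrix m l ℂ}
    {X : Matrix k m ℂ} {X' : Matrix l m ℂ}
    (h : ∀ s, (X * prependN B Ψ (r + 1) s).trace = (X' * prependN B Ψ' (r + 1) s).trace)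
    (Z : Matrix m m ℂ) (s : Fin L → P) : (X * Z * Ψ s).trace = (X' * Z * Ψ' s).trace := by
  induction r generalizing X X' Z s with
  | zero =>
    obtain ⟨c, rfl⟩ := hB Z
    simp only [Matrix.mul_sum, Matrix.sum_mul, Matrix.trace_sum, Matrix.mul_smul,
      Matrix.smul_mul, Matrix.trace_smul, Matrix.mul_assoc]
    refine Finset.sum_congr rfl fun p _ => congrArg _ ?_
    simpa [prependN, prepend] using h (Fin.cons p s)
  | succ r ih =>
    have h1 : ∀ p s, (X * B p * prependN B Ψ (r + 1) s).trace =
        (X' * B p * prependN B Ψ' (r + 1) s).trace := by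
      intro p s
      simpa [prependN_succ, prepend, Matrix.mul_assoc] using h (Fin.cons p s)
    have h2 := fun p => ih (h1 p) Z s
    -- A single site suffices to produce the arbitrary `Z`; all surplus sites are summed to the
    -- identity.
    obtain ⟨c, hc⟩ := hB 1
    rw [← Matrix.mul_one X, ← Matrix.mul_one X', ← hc]
    simp only [Matrix.mul_sum, Matrix.sum_mul, Matrix.trace_sum, Matrix.mul_smul,
      Matrix.smul_mul, Matrix.trace_smul, h2]

end Peel

section Factor

variable {P χ α β : Type*} [Fintype P] [DecidableEq P] [Fintype χ] [DecidableEq χ]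
  [Fintype α] [DecidableEq α] [Fintype β] [DecidableEq β]

theorem Spanning.mul_mul_ne_zero {A : P → Matrix α α ℂ} {B : P → Matrix β β ℂ}
    {e : P → Matrix α β ℂ} (hA : Spanning A) (hB : Spanning B) (he : e ≠ 0) :
    ∃ i j k a b, (A i * e j * B k) a b ≠ 0 := by
  by_contra! h
  refine he (funext fun j => hA.mul_left_cancel fun i => hB.mul_right_cancel fun k => ?_)
  ext a b
  simp [h]

/-- A matrix unit between two local tensors decouples them into a product of entries. -/
theorem mul_single_mul_apply {l m n k : Type*} [Fintype m] [DecidableEq m] [Fintype n]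
    [DecidableEq n] (X : Matrix l m ℂ) (Y : Matrix n k ℂ) (a : l) (b : m) (c : n) (d : k) :
    (X * Matrix.single b c (1 : ℂ) * Y) a d = X a b * Y c d := by
  rw [Matrix.mul_assoc]
  simp [Matrix.mul_apply, Matrix.single_apply, ite_and]

/-- If the state vanished, peeling all domains would leave `e j * Z * f j' = 0` for every `Z`,
contradicted by the matrix unit that joins nonzero entries of `e` and `f`. This is what rules out a
vanishing transformation factor. -/
theorem pairChain_trace_ne_zero {A : P → Matrix α α ℂ} {B : P → Matrix β β ℂ}
    {e : P → Matrix α β ℂ} {f : P → Matrix β α ℂ} (hA : Spanning A) (hB : Spanning B)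
    (he : e ≠ 0) (hf : f ≠ 0) (n m r : ℕ) :
    (fun s => (pairChain A B e f (n + 1) (m + 1) (r + 1) s).trace) ≠ 0 := by
  intro h
  have h1 := hA.peel (X := (1 : Matrix α α ℂ)) (X' := (0 : Matrix α α ℂ)) (Ψ' := 0)
    (fun s => by rw [Matrix.one_mul, Matrix.zero_mul, Matrix.trace_zero]; exact congrFun h s)
  have h2 := fun i j => hB.peel (X := A i * e j) (X' := (0 : Matrix α β ℂ)) (Ψ' := 0)
    (fun s => by
      simpa [prepend, Matrix.mul_assoc] using h1 1 (Fin.cons i (Fin.cons j s)))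
  have h3 : ∀ (i j : P) (Z : Matrix β β ℂ) (k j' : P), A i * e j * Z * B k * f j' = 0 := by
    intro i j Z k j'
    refine (hA.word n).trace_ext fun s => ?_
    rw [Matrix.trace_mul_comm]
    simpa [prepend, Matrix.mul_assoc] using h2 i j Z (Fin.cons k (Fin.cons j' s))
  have h4 : ∀ (j : P) (Z : Matrix β β ℂ) (j' : P), e j * Z * f j' = 0 := by
    intro j Z j'
    obtain ⟨c, hc⟩ := hB 1
    refine hA.mul_left_cancel fun i => ?_
    rw [← Matrix.mul_one Z, ← hc]
    simp only [Matrix.mul_assoc] at h3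
    simp [Matrix.mul_sum, Matrix.sum_mul, Matrix.mul_assoc, h3]
  obtain ⟨j, hj⟩ := Function.ne_iff.1 he
  obtain ⟨j', hj'⟩ := Function.ne_iff.1 hf
  obtain ⟨a, b, hab⟩ : ∃ a b, e j a b ≠ 0 := by
    by_contra! h; exact hj (Matrix.ext h)
  obtain ⟨c, d, hcd⟩ : ∃ a b, f j' a b ≠ 0 := by
    by_contra! h; exact hj' (Matrix.ext h)
  have := congrFun (congrFun (h4 j (Matrix.single b c 1) j') a) d
  rw [mul_single_mul_apply] at this
  exact mul_ne_zero hab hcd this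

variable {T : P → P → Matrix χ χ ℂ} {A : P → Matrix α α ℂ} {B : P → Matrix β β ℂ}
  {WB : Matrix (χ × α) β ℂ} {WhatB : Matrix β (χ × α) ℂ}
  {WA : Matrix (χ × β) α ℂ} {WhatA : Matrix α (χ × β) ℂ}
  {e : P → Matrix α β ℂ} {f : P → Matrix β α ℂ} {c : ℂ}

/-- A chain with two domain walls, with an operator tensor on top, in terms of the local
tensors. -/
theorem onTop_pairChain (hB : Reduces (act T A) B WB WhatB) (hA : Reduces (act T B) A WA WhatA)
    (n m r : ℕ) :
    onTop T (pairChain A B e f (0 + 1 + (n + 2)) (m + 2) (r + 2)) =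
      prepend (act T A) (mulNet WB (prependN B (mulNet WhatB (prepend (act T A)
        (prepend (act T e) (prepend (act T B) (mulNet WA (prependN A (mulNet WhatA
        (prepend (act T B) (prepend (act T f) (prepend (act T A) (mulNet WB (prependN B
        (mulNet WhatB (prepend (act T A) (word (act T A) 0))) (n + 1))))))) (m + 1)))))))
        (r + 1))) := by
  rw [pairChain, onTop_prependN, onTop_prepend, onTop_prepend, onTop_prependN, onTop_prepend,
    onTop_prepend, onTop_word, word_add, word_succ, hB.prependN_cut, hA.prependN_cut,
    hB.prependN_cut]

/-- The local form of the transformation of a pair of domain walls. -/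
theorem pair_local (hsA : Spanning A) (hsB : Spanning B) (hB : Reduces (act T A) B WB WhatB)
    (hA : Reduces (act T B) A WA WhatA) {n m r : ℕ}
    (h : mpo T (0 + 1 + (n + 2) + 1 + 1 + (m + 2) + 1 + 1 + (r + 2)) *ᵥ
        (fun s => (pairChain A B e f (0 + 1 + (n + 2)) (m + 2) (r + 2) s).trace) =
      c • fun s => (pairChain B A f e (0 + 1 + (n + 2)) (m + 2) (r + 2) s).trace)
    (Z : Matrix α α ℂ) (i j k i' j' k' : P) :
    (WhatB * act T A i * act T e j * act T B k * WA) * Z *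
        (WhatA * act T B i' * act T f j' * act T A k' * WB) =
      c • ((B i * f j * A k) * Z * (A i' * e j' * B k')) := by
  rw [mpo_mulVec_trace, onTop_pairChain hB hA, pairChain, word_add, word_succ] at h
  -- The three reduced blocks, over `B`, `A` and again `B`, are peeled in turn. Later the block
  -- between the two walls becomes the free `Z` and the other two become the identity.
  have h1 := fun p => hsB.peel (X := act T A p * WB) (X' := c • B p)
    (fun s => by
      simpa [prependN_succ, prepend, mulNet, Matrix.mul_assoc] using congrFun h (Fin.cons p s))
  set E := WhatB * act T A i * act T e j * act T B k * WA with hE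
  set F := WhatA * act T B i' * act T f j' * act T A k' * WB with hF
  have h2 := fun p (X : Matrix β β ℂ) => hsA.peel (X := act T A p * WB * X * E)
    (X' := c • B p * X * (B i * f j * A k))
    (fun s => by
      simpa [prependN_succ, prepend, mulNet, Matrix.mul_assoc, hE] using
        h1 p X (Fin.cons i (Fin.cons j (Fin.cons k s))))
  have h3 := fun p (X : Matrix β β ℂ) (Y : Matrix α α ℂ) => hsB.peel
    (Ψ := mulNet WhatB (prepend (act T A) (word (act T A) 0))) (Ψ' := prepend B (word B 0))
    (X := act T A p * WB * X * E * Y * F)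
    (X' := c • B p * X * (B i * f j * A k) * Y * (A i' * e j' * B k'))
    (fun s => by
      simpa [prependN_succ, prepend, mulNet, Matrix.mul_assoc, hF] using
        h2 p X Y (Fin.cons i' (Fin.cons j' (Fin.cons k' s))))
  refine (hsB.mul hsB).trace_ext ?_
  rintro ⟨q, p⟩
  have h4 := h3 p 1 Z 1 (fun _ => q)
  simp only [mulNet, prepend, word, wordProd_zero, Matrix.mul_one] at h4
  -- By cyclicity of the trace the leftover halves at the two ends of the ring join to `B q * B p`,
  -- and such products span.
  have e1 : B q * B p = WhatB * act T A q * act T A p * WB := by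
    rw [hB.left, Matrix.mul_assoc, Matrix.mul_assoc, ← hB.mid p, Matrix.mul_assoc]
  calc (B q * B p * (E * Z * F)).trace
      = (act T A p * WB * E * Z * F * (WhatB * act T A q)).trace := by
        rw [e1, Matrix.trace_mul_comm (_ * F) (WhatB * act T A q)]
        simp only [Matrix.mul_assoc]
    _ = (c • B p * (B i * f j * A k) * Z * (A i' * e j' * B k') * B q).trace := h4
    _ = _ := by
        rw [Matrix.trace_mul_comm _ (B q)]
        simp only [Matrix.mul_assoc, Matrix.smul_mul, Matrix.mul_smul]

/-- At a point where `F₀` does not vanish, `F` cannot vanish either, since some `E₀ p` is nonzero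
and `c ≠ 0`. Dividing by that value isolates `E`. -/
theorem exists_factor_of_mul_eq {ι κ : Type*} {E E₀ : ι → ℂ} {F F₀ : κ → ℂ} {c : ℂ} (hc : c ≠ 0)
    (h : ∀ p q, E p * F q = c * (E₀ p * F₀ q)) (hE : ∃ p, E₀ p ≠ 0) (hF : ∃ q, F₀ q ≠ 0) :
    ∃ c', ∀ p, E p = c' * E₀ p := by
  obtain ⟨p, hp⟩ := hE
  obtain ⟨q, hq⟩ := hF
  have hFq : F q ≠ 0 := fun h0 => by
    have := h p q
    rw [h0, mul_zero] at this
    exact mul_ne_zero hc (mul_ne_zero hp hq) this.symm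
  refine ⟨c * F₀ q / F q, fun p' => ?_⟩
  rw [eq_comm, div_mul_eq_mul_div, div_eq_iff hFq, h]
  ring

end Factor

namespace DWData

variable {P χ α β : Type*} [Fintype P] [DecidableEq P] [Fintype χ] [DecidableEq χ]
  [Fintype α] [DecidableEq α] [Fintype β] [DecidableEq β] {S : DWData P χ α β}

theorem IsDomainWallSystem.spanning_A (h : S.IsDomainWallSystem) : Spanning S.A :=
  h.left_inverse_A.spanning

theorem IsDomainWallSystem.spanning_B (h : S.IsDomainWallSystem) : Spanning S.B :=
  h.left_inverse_B.spanning

theorem IsDomainWallSystem.reduces_B (h : S.IsDomainWallSystem) :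
    Reduces (act S.T S.A) S.B S.WB S.WhatB :=
  h.action_B.reduces h.spanning_B

theorem IsDomainWallSystem.reduces_A (h : S.IsDomainWallSystem) :
    Reduces (act S.T S.B) S.A S.WA S.WhatA :=
  h.action_A.reduces h.spanning_A

theorem IsDomainWallSystem.localRules (h : S.IsDomainWallSystem) {cAB cBA : ℂ}
    (h₁ : S.IsCAB cAB) (h₂ : S.IsCBA cBA) : S.LocalRules cAB cBA :=
  ⟨h.left_inverse_A, h.left_inverse_B, h.separate_AB, h.separate_BA, h.reduces_B, h.reduces_A,
    h₁, h₂⟩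

theorem IsDomainWallSystem.exists_pair_factor (h : S.IsDomainWallSystem) :
    ∃ c : ℂ, c ≠ 0 ∧ ∀ (Z : Matrix α α ℂ) (i j k i' j' k' : P),
      (S.WhatB * act S.T S.A i * act S.T S.eAB j * act S.T S.B k * S.WA) * Z *
        (S.WhatA * act S.T S.B i' * act S.T S.eBA j' * act S.T S.A k' * S.WB) =
      c • ((S.B i * S.eBA j * S.A k) * Z * (S.A i' * S.eAB j' * S.B k')) := by
  obtain ⟨R, hR⟩ := h.map_pair
  -- Each domain gets more than `R` sites, with enough spare sites for a cut and a nonempty block to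
  -- peel.
  have hk : 1 + (R + 2) < 0 + 1 + (R + 2) + 1 + 1 + (R + 2) + 1 + 1 + (R + 2) := by omega
  have hl : 1 + (R + 2) + 1 + 1 + (R + 2) <
    0 + 1 + (R + 2) + 1 + 1 + (R + 2) + 1 + 1 + (R + 2) := by omega
  obtain ⟨c, hc⟩ := hR _ ⟨_, hk⟩ ⟨_, hl⟩ (Fin.lt_def.2 (by simp))
    (by dsimp only; omega) (by dsimp only; omega)
  rw [pairState_eq_trace _ _ _ _ rfl rfl, pairState_eq_trace _ _ _ _ rfl rfl] at hc
  refine ⟨c, ?_, pair_local h.spanning_A h.spanning_B h.reduces_B h.reduces_A hc⟩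
  rintro rfl
  -- The symmetry squares to one, hence is injective, and a nonzero pair state cannot be sent to
  -- zero.
  rw [zero_smul] at hc
  refine pairChain_trace_ne_zero h.spanning_A h.spanning_B h.eAB_ne_zero h.eBA_ne_zero
    (0 + 1 + (R + 1)) (R + 1) (R + 1) ?_
  have h2 := congrArg (mpo S.T _ *ᵥ ·) hc
  simp only [Matrix.mulVec_mulVec, Matrix.mulVec_zero] at h2
  rwa [h.order_two _ (by omega), Matrix.one_mulVec] at h2

theorem IsDomainWallSystem.existsUnique_cAB_cBA (h : S.IsDomainWallSystem) :
    (∃! c, S.IsCAB c) ∧ ∃! c, S.IsCBA c := by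
  obtain ⟨c, hc, hEF⟩ := h.exists_pair_factor
  obtain ⟨i, j, k, a, b, hE⟩ := h.spanning_B.mul_mul_ne_zero h.spanning_A h.eBA_ne_zero
  obtain ⟨i', j', k', a', b', hF⟩ := h.spanning_A.mul_mul_ne_zero h.spanning_B h.eAB_ne_zero
  set E := fun p : P × P × P × β × α => (S.WhatB * act S.T S.A p.1 * act S.T S.eAB p.2.1 *
    act S.T S.B p.2.2.1 * S.WA) p.2.2.2.1 p.2.2.2.2
  set F := fun p : P × P × P × α × β => (S.WhatA * act S.T S.B p.1 * act S.T S.eBA p.2.1 *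
    act S.T S.A p.2.2.1 * S.WB) p.2.2.2.1 p.2.2.2.2
  set E₀ := fun p : P × P × P × β × α => (S.B p.1 * S.eBA p.2.1 * S.A p.2.2.1) p.2.2.2.1 p.2.2.2.2
  set F₀ := fun p : P × P × P × α × β => (S.A p.1 * S.eAB p.2.1 * S.B p.2.2.1) p.2.2.2.1 p.2.2.2.2
  have hEF' : ∀ p q, E p * F q = c * (E₀ p * F₀ q) := by
    rintro ⟨i, j, k, a, b⟩ ⟨i', j', k', a', b'⟩
    -- The matrix unit linking column `b` of the first factor to row `a'` of the second turns the
    -- matrix identity into a product of scalars.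
    have := congrFun (congrFun (hEF (Matrix.single b a' 1) i j k i' j' k') a) b'
    rwa [Matrix.smul_apply, mul_single_mul_apply, mul_single_mul_apply] at this
  have hE₀ : ∃ p, E₀ p ≠ 0 := ⟨(i, j, k, a, b), hE⟩
  have hF₀ : ∃ p, F₀ p ≠ 0 := ⟨(i', j', k', a', b'), hF⟩
  obtain ⟨c₁, h₁⟩ := exists_factor_of_mul_eq hc hEF' hE₀ hF₀
  obtain ⟨c₂, h₂⟩ := exists_factor_of_mul_eq (E := F) (F := E) (E₀ := F₀) (F₀ := E₀) hc
    (fun p q => by rw [mul_comm, hEF', mul_comm (E₀ q)]) hF₀ hE₀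
  have hu₁ : S.IsCAB c₁ := fun i j k => Matrix.ext fun a b => h₁ (i, j, k, a, b)
  have hu₂ : S.IsCBA c₂ := fun i j k => Matrix.ext fun a b => h₂ (i, j, k, a, b)
  refine ⟨⟨c₁, hu₁, fun d hd => ?_⟩, ⟨c₂, hu₂, fun d hd => ?_⟩⟩
  · have := congrFun (congrFun ((hd i j k).symm.trans (hu₁ i j k)) a) b
    exact mul_right_cancel₀ hE this
  · have := congrFun (congrFun ((hd i' j' k').symm.trans (hu₂ i' j' k')) a') b'
    exact mul_right_cancel₀ hF this

end DWData

/-! ### Rank one tensors -/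

section RankOne

variable {P χ m n : Type*} [Fintype P] [DecidableEq P] [Fintype χ] [DecidableEq χ]

theorem wordProd_vecMulVec {L : ℕ} (u v : Fin (L + 1) → χ → ℂ) :
    (wordProd fun k => vecMulVec (u k) (v k)) =
      (∏ k : Fin L, v k.castSucc ⬝ᵥ u k.succ) • vecMulVec (u 0) (v (Fin.last L)) := by
  induction L with
  | zero => simp [wordProd_succ, wordProd_zero]
  | succ L ih =>
    rw [wordProd_succ, ih (fun k => u k.succ) fun k => v k.succ, Matrix.mul_smul,
      Matrix.vecMulVec_mul_vecMulVec, Fin.prod_univ_succ, Matrix.vecMulVec_smul, smul_smul,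
      mul_comm]
    rfl

theorem trace_wordProd_vecMulVec {N : ℕ} [NeZero N] (u v : Fin N → χ → ℂ) :
    (wordProd fun k => vecMulVec (u k) (v k)).trace = ∏ k, v k ⬝ᵥ u (k + 1) := by
  obtain ⟨L, rfl⟩ := Nat.exists_eq_succ_of_ne_zero (NeZero.ne N)
  rw [wordProd_vecMulVec, Matrix.trace_smul, Matrix.trace_vecMulVec, Fin.prod_univ_castSucc]
  simp [dotProduct_comm (u 0), Fin.coeSucc_eq_succ]

theorem wordProd_eq_zero [Fintype m] [DecidableEq m] {L : ℕ} {M : Fin L → Matrix m m ℂ}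
    (k : Fin L) (h : M k = 0) : wordProd M = 0 :=
  List.prod_eq_zero (by rw [← h]; exact List.mem_ofFn.2 ⟨k, rfl⟩)

/-- An operator tensor that flips the physical index by an involution `σ` and has rank one
virtual matrices. -/
structure IsFlip (T : P → P → Matrix χ χ ℂ) (σ : P → P) (u v : P → χ → ℂ) : Prop where
  invol : ∀ s, σ (σ s) = s
  eq : ∀ s t, T s t = if s = σ t then vecMulVec (u s) (v s) else 0

variable {T : P → P → Matrix χ χ ℂ} {σ : P → P} {u v : P → χ → ℂ}

theorem IsFlip.mpo_apply (h : IsFlip T σ u v) {N : ℕ} [NeZero N] (s t : Fin N → P) :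
    mpo T N s t = if s = σ ∘ t then ∏ k, v (s k) ⬝ᵥ u (s (k + 1)) else 0 := by
  simp only [mpo, Matrix.of_apply]
  split_ifs with hst
  · rw [← trace_wordProd_vecMulVec (fun k => u (s k)) fun k => v (s k)]
    simp [h.eq, hst]
  · obtain ⟨k, hk⟩ := Function.ne_iff.1 hst
    rw [wordProd_eq_zero k, Matrix.trace_zero]
    exact (h.eq _ _).trans (if_neg hk)

theorem IsFlip.act (h : IsFlip T σ u v) (M : P → Matrix m n ℂ) (s : P) :
    act T M s = vecMulVec (u s) (v s) ⊗ₖ M (σ s) := by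
  rw [MPUDomainWall.act, Finset.sum_eq_single (σ s)]
  · rw [h.eq, h.invol, if_pos rfl]
  · intro t _ ht
    rw [h.eq, if_neg fun hs => ht (by rw [hs, h.invol]), Matrix.zero_kronecker]
  · simp

theorem IsFlip.stack₂ (h : IsFlip T σ u v) (s t : P) :
    stack₂ T s t = vecMulVec (u s) (v s) ⊗ₖ T (σ s) t :=
  h.act _ s

/-- Two flips cancel, so the lowest layer sees the original indices. -/
theorem IsFlip.stack₃ (h : IsFlip T σ u v) (s t : P) :
    stack₃ T s t = vecMulVec (u s) (v s) ⊗ₖ (vecMulVec (u (σ s)) (v (σ s)) ⊗ₖ T s t) := by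
  have := h.act (fun r => MPUDomainWall.stack₂ T r t) s
  rw [h.stack₂, h.invol] at this
  exact this

theorem vecMulVec_kronecker_vecMulVec {l k : Type*} (u : l → ℂ) (v : k → ℂ) (u' : m → ℂ)
    (v' : n → ℂ) : vecMulVec u v ⊗ₖ vecMulVec u' v' =
      vecMulVec (fun q => u q.1 * u' q.2) fun q => v q.1 * v' q.2 := by
  ext
  simp only [Matrix.kroneckerMap_apply, vecMulVec_apply]
  ring

theorem close_vecMulVec (V Vhat : χ × χ → ℂ) (u v u' v' u'' v'' : χ → ℂ) :
    closeUpper Vhat * (vecMulVec u v ⊗ₖ (vecMulVec u' v' ⊗ₖ vecMulVec u'' v'')) * closeLower V =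
      ((Vhat ⬝ᵥ fun q => u q.1 * u' q.2) * ((fun q => v' q.1 * v'' q.2) ⬝ᵥ V)) •
        vecMulVec u'' v := by
  have h1 : closeUpper Vhat *ᵥ (fun q => u q.1 * (u' q.2.1 * u'' q.2.2)) =
      (Vhat ⬝ᵥ fun q => u q.1 * u' q.2) • u'' := by
    funext d
    simp only [closeUpper, Matrix.mulVec, dotProduct, Matrix.of_apply, Fintype.sum_prod_type,
      ite_mul, zero_mul, Finset.sum_ite_eq', Finset.mem_univ, if_true, Pi.smul_apply, smul_eq_mul,
      Finset.sum_mul, mul_assoc]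
  have h2 : (fun q : χ × χ × χ => v q.1 * (v' q.2.1 * v'' q.2.2)) ᵥ* closeLower V =
      ((fun q => v' q.1 * v'' q.2) ⬝ᵥ V) • v := by
    funext d
    simp only [closeLower, Matrix.vecMul, dotProduct, Matrix.of_apply, Fintype.sum_prod_type,
      mul_ite, mul_zero, Pi.smul_apply, smul_eq_mul, Finset.sum_mul]
    rw [Finset.sum_eq_single d]
    · simp only [if_true]
      refine Finset.sum_congr rfl fun _ _ => Finset.sum_congr rfl fun _ _ => ?_
      ring
    · intro b _ hb
      simp [hb]
    · simp
  rw [vecMulVec_kronecker_vecMulVec, vecMulVec_kronecker_vecMulVec, Matrix.mul_vecMulVec,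
    Matrix.vecMulVec_mul, h1, h2, Matrix.smul_vecMulVec, Matrix.vecMulVec_smul, smul_smul]

theorem IsFlip.fusion_apply (h : IsFlip T σ u v) (V Vhat : χ × χ → ℂ) (s : P) :
    Vhat ⬝ᵥ (MPUDomainWall.stack₂ T s s *ᵥ V) =
      (Vhat ⬝ᵥ fun q => u s q.1 * u (σ s) q.2) * ((fun q => v s q.1 * v (σ s) q.2) ⬝ᵥ V) := by
  rw [h.stack₂, h.eq, if_pos rfl]
  rw [vecMulVec_kronecker_vecMulVec, Matrix.vecMulVec_mulVec]
  simp [dotProduct_smul, mul_comm]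

end RankOne

/-! ### From one-site relations to words of every length -/

section Blocks

variable {Q m n : Type*} [Fintype m] [DecidableEq m] [Fintype n] [DecidableEq n]
  {M : Q → Matrix m m ℂ} {N : Q → Matrix n n ℂ} {W : Matrix m n ℂ} {What : Matrix n m ℂ}

/-- In a concrete model `M i * W * What * M j = M i * M j` holds without any site in between, and
the projection `W * What` may be inserted at every bond. -/
theorem mul_word_mul_right (mid : ∀ i, What * M i * W = N i)
    (ins : ∀ i j, M i * W * What * M j = M i * M j) (i : Q) {l : ℕ} (s : Fin l → Q) :
    M i * word M l s * W = M i * W * word N l s := by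
  induction l generalizing i with
  | zero => simp [word, wordProd_zero]
  | succ l ih =>
    simp only [word, wordProd_succ] at ih ⊢
    rw [← mid, ← Matrix.mul_assoc, ← ins, Matrix.mul_assoc _ (M (s 0)), Matrix.mul_assoc,
      ih (s 0) fun k => s k.succ]
    simp only [Matrix.mul_assoc]

theorem word_reduce (unit : What * W = 1) (mid : ∀ i, What * M i * W = N i)
    (ins : ∀ i j, M i * W * What * M j = M i * M j) {l : ℕ} (s : Fin l → Q) :
    What * word M l s * W = word N l s := by
  cases l with
  | zero => simp [word, wordProd_zero, unit]
  | succ l =>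
    have := mul_word_mul_right mid ins (s 0) fun k => s k.succ
    simp only [word, wordProd_succ] at this ⊢
    rw [Matrix.mul_assoc, this, ← mid]
    simp only [Matrix.mul_assoc]

theorem word_insert (mid : ∀ i, What * M i * W = N i)
    (ins : ∀ i j, M i * W * What * M j = M i * M j) (i j : Q) {l : ℕ} (s : Fin l → Q) :
    M i * word M l s * M j = M i * W * word N l s * What * M j := by
  induction l generalizing i with
  | zero => simp [word, wordProd_zero, ins]
  | succ l ih =>
    simp only [word, wordProd_succ] at ih ⊢
    rw [← mid, ← Matrix.mul_assoc, ← ins, Matrix.mul_assoc _ (M (s 0)), Matrix.mul_assoc,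
      ih (s 0) fun k => s k.succ]
    simp only [Matrix.mul_assoc]

end Blocks

/-! ### Order two and unitarity of flip operators -/

section FlipOperator

variable {P χ : Type*} [Fintype P] [DecidableEq P] [Fintype χ] [DecidableEq χ]
  {T : P → P → Matrix χ χ ℂ} {σ : P → P} {u v : P → χ → ℂ}

theorem IsFlip.blockTwo (h : IsFlip T σ u v) :
    IsFlip (blockTwo T) (Prod.map σ σ) (fun s => (v s.1 ⬝ᵥ u s.2) • u s.1) fun s => v s.2 where
  invol s := Prod.ext (h.invol _) (h.invol _)
  eq s t := by
    by_cases h1 : s.1 = σ t.1 <;> by_cases h2 : s.2 = σ t.2 <;>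
      simp [MPUDomainWall.blockTwo, h.eq, Prod.ext_iff, h1, h2, Matrix.vecMulVec_mul_vecMulVec,
        Matrix.smul_vecMulVec, Matrix.vecMulVec_smul]

theorem IsFlip.mpo_mulVec (h : IsFlip T σ u v) {N : ℕ} [NeZero N] (τ : Fin N → P) :
    (mpo T N *ᵥ fun t => if t = τ then 1 else 0) =
      (∏ k, v (σ (τ k)) ⬝ᵥ u (σ (τ (k + 1)))) • fun s => if s = σ ∘ τ then (1 : ℂ) else 0 := by
  funext s
  simp only [Matrix.mulVec, dotProduct, mul_ite, mul_one, mul_zero, Finset.sum_ite_eq',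
    Finset.mem_univ, if_true, h.mpo_apply, Pi.smul_apply, smul_eq_mul]
  split_ifs with hs
  · subst hs
    rfl
  · rfl

theorem prod_cyclic_succ {N : ℕ} [NeZero N] (F : Fin N → ℂ) : ∏ k, F (k + 1) = ∏ k, F k :=
  Equiv.prod_comp (Equiv.addRight 1) F

/-- Around the ring every `g (s k)` occurs twice, once for the bond on each side of the site, and
`g` squares to one. -/
theorem prod_weight_mul_flip {g : P → ℂ} (hg : ∀ s, g s * g s = 1)
    (hw : ∀ s s', (v s ⬝ᵥ u s') * (v (σ s) ⬝ᵥ u (σ s')) = g s * g s') {N : ℕ} [NeZero N]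
    (s : Fin N → P) :
    (∏ k, v (s k) ⬝ᵥ u (s (k + 1))) * ∏ k, v (σ (s k)) ⬝ᵥ u (σ (s (k + 1))) = 1 := by
  rw [← Finset.prod_mul_distrib]
  simp only [hw]
  rw [Finset.prod_mul_distrib, prod_cyclic_succ fun k => g (s k), ← Finset.prod_mul_distrib]
  simp [hg]

theorem IsFlip.mpo_mul_mpo (h : IsFlip T σ u v) {g : P → ℂ} (hg : ∀ s, g s * g s = 1)
    (hw : ∀ s s', (v s ⬝ᵥ u s') * (v (σ s) ⬝ᵥ u (σ s')) = g s * g s') (N : ℕ) (hN : 0 < N) :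
    mpo T N * mpo T N = 1 := by
  have : NeZero N := ⟨hN.ne'⟩
  ext s t
  have hst : σ ∘ σ ∘ t = t := funext fun k => h.invol (t k)
  rw [Matrix.mul_apply, Finset.sum_eq_single (σ ∘ t), h.mpo_apply, h.mpo_apply, if_pos rfl, hst,
    Matrix.one_apply]
  · split_ifs with hs
    · subst hs
      exact prod_weight_mul_flip hg hw s
    · simp
  · intro r _ hr
    rw [h.mpo_apply r t, if_neg hr, mul_zero]
  · simp

/-- The weights are real with square one, and those of a configuration and of its flip multiply to
one, hence agree. So the operator is self-adjoint, and order two makes it unitary. -/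
theorem IsFlip.isMPU (h : IsFlip T σ u v) {g : P → ℂ} (hg : ∀ s, g s * g s = 1)
    (hw : ∀ s s', (v s ⬝ᵥ u s') * (v (σ s) ⬝ᵥ u (σ s')) = g s * g s')
    (hw1 : ∀ s s', (v s ⬝ᵥ u s') * (v s ⬝ᵥ u s') = 1)
    (hw2 : ∀ s s', star (v s ⬝ᵥ u s') = v s ⬝ᵥ u s') : IsMPU T := by
  intro N hN
  have : NeZero N := ⟨hN.ne'⟩
  have hs : star (mpo T N) = mpo T N := by
    ext s t
    rw [Matrix.star_apply, h.mpo_apply, h.mpo_apply]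
    have hst : t = σ ∘ s ↔ s = σ ∘ t := by
      constructor <;> rintro rfl <;> funext k <;> simp [h.invol]
    simp only [hst]
    split_ifs with hc
    · subst hc
      rw [star_prod]
      simp only [hw2, Function.comp_apply]
      have h1 := prod_weight_mul_flip (σ := σ) hg hw t
      have h2 : (∏ k, v (t k) ⬝ᵥ u (t (k + 1))) * ∏ k, v (t k) ⬝ᵥ u (t (k + 1)) = 1 := by
        rw [← Finset.prod_mul_distrib]
        simp [hw1]
      exact mul_left_cancel₀ (left_ne_zero_of_mul_eq_one h2) (h2.trans h1.symm)
    · simp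
  have h1 := h.mpo_mul_mpo hg hw N hN
  exact Matrix.mem_unitaryGroup_iff.2 (by rw [hs, h1])

end FlipOperator

/-! ### The CZX tensor -/

section CZX

theorem czxTensor_isFlip : IsFlip czxTensor (fun s => 1 - s)
    (fun s l => (-1) ^ (s : ℕ) * (-1) ^ ((l : ℕ) * (s : ℕ))) fun s => Pi.single s 1 where
  invol s := by fin_cases s <;> rfl
  eq s t := by
    ext l r
    by_cases hs : s = 1 - t <;> by_cases hr : r = s <;>
      simp [czxTensor, hs, hr, vecMulVec_apply, Pi.single_apply]

theorem mpo_czxTensor (N : ℕ) [NeZero N] : mpo czxTensor N = czxOperator N := by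
  ext s t
  rw [czxTensor_isFlip.mpo_apply, czxOperator, Matrix.diagonal_mul, Matrix.of_apply]
  have : ((fun s : Fin 2 => 1 - s) ∘ t) = fun i => 1 - t i := rfl
  rw [this, mul_ite, mul_one, mul_zero]
  congr 1
  simp only [single_one_dotProduct]
  rw [Finset.prod_mul_distrib, Finset.prod_mul_distrib,
    prod_cyclic_succ fun k => (-1 : ℂ) ^ (s k : ℕ)]

/-- The left virtual leg of two blocked sites of the CZX tensor. -/
def czxLeft (s : Fin 2 × Fin 2) (l : Fin 2) : ℂ :=
  (-1) ^ ((s.2 : ℕ) + s.1 * s.2 + s.1 + l * s.1)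

theorem czxBlock_isFlip : IsFlip (blockTwo czxTensor) (fun s => (1 - s.1, 1 - s.2)) czxLeft
    fun s => Pi.single s.2 1 := by
  have h := czxTensor_isFlip.blockTwo
  have hl : (fun s : Fin 2 × Fin 2 => ((Pi.single s.1 1 : Fin 2 → ℂ) ⬝ᵥ fun l =>
      (-1) ^ (s.2 : ℕ) * (-1) ^ ((l : ℕ) * (s.2 : ℕ))) • fun l : Fin 2 =>
        (-1 : ℂ) ^ (s.1 : ℕ) * (-1) ^ ((l : ℕ) * (s.1 : ℕ))) = czxLeft := by
    funext s l
    simp only [single_one_dotProduct, Pi.smul_apply, smul_eq_mul, czxLeft, pow_add]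
    ring
  rw [hl] at h
  exact h

theorem czxBlock_weight (s s' : Fin 2 × Fin 2) :
    (Pi.single s.2 1 : Fin 2 → ℂ) ⬝ᵥ czxLeft s' =
      (-1) ^ ((s'.2 : ℕ) + s'.1 * s'.2 + s'.1 + s.2 * s'.1) := by
  rw [single_one_dotProduct, czxLeft]

/-- Under the flip each `Z` contributes `-1` and each bond `(a, b)` contributes `-(-1)^(a + b)`. A
block has two of each, so the signs cancel, and its first qubit lies on both bonds and drops out. -/
theorem czxBlock_weight_mul_flip (s s' : Fin 2 × Fin 2) :
    ((Pi.single s.2 1 : Fin 2 → ℂ) ⬝ᵥ czxLeft s') *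
      ((Pi.single (1 - s.2) 1 : Fin 2 → ℂ) ⬝ᵥ czxLeft (1 - s'.1, 1 - s'.2)) =
      (-1) ^ (s.2 : ℕ) * (-1) ^ (s'.2 : ℕ) := by
  obtain ⟨a, b⟩ := s
  obtain ⟨c, d⟩ := s'
  fin_cases b <;> fin_cases c <;> fin_cases d <;> norm_num [czxLeft]

theorem czxBlock_injective :
    IsInjectiveTensor fun p : (Fin 2 × Fin 2) × (Fin 2 × Fin 2) => blockTwo czxTensor p.1 p.2 := by
  -- For each right index the two left vectors are orthogonal with entries `±1`; their squared
  -- length `2` explains the factor.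
  refine ⟨fun p => (1 / 2 : ℂ) • blockTwo czxTensor p.1 p.2, fun a b c d => ?_⟩
  simp only [czxBlock_isFlip.eq]
  rw [Fintype.sum_prod_type_right, Fintype.sum_prod_type]
  fin_cases a <;> fin_cases b <;> fin_cases c <;> fin_cases d <;>
    norm_num [Fintype.sum_prod_type, Fin.sum_univ_two, czxLeft, vecMulVec_apply]

theorem czxBlock_order_two (N : ℕ) (hN : 0 < N) :
    mpo (blockTwo czxTensor) N * mpo (blockTwo czxTensor) N = 1 :=
  czxBlock_isFlip.mpo_mul_mpo (g := fun s => (-1) ^ (s.2 : ℕ)) (fun s => by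
    rw [← mul_pow]; simp) czxBlock_weight_mul_flip N hN

theorem czxBlock_isMPU : IsMPU (blockTwo czxTensor) :=
  czxBlock_isFlip.isMPU (g := fun s => (-1) ^ (s.2 : ℕ)) (fun s => by
    rw [← mul_pow]; simp) czxBlock_weight_mul_flip
    (fun s s' => by rw [czxBlock_weight, ← mul_pow]; simp)
    (fun s s' => by rw [czxBlock_weight]; simp)

/-- The anomaly index of every pair of fusion tensors for the blocked CZX tensor. -/
theorem czxBlock_isAnomalyIndex {V Vhat : Fin 2 × Fin 2 → ℂ}
    (h : IsFusionPair (blockTwo czxTensor) V Vhat) :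
    IsAnomalyIndex (blockTwo czxTensor) V Vhat (-1) := by
  have h1 : ∀ s, Vhat ⬝ᵥ (stack₂ (blockTwo czxTensor) s s *ᵥ V) = 1 := fun s => by
    simpa [wordProd_succ, wordProd_zero] using h.reduce 1 (fun _ => s) fun _ => s
  simp only [czxBlock_isFlip.fusion_apply] at h1
  refine h.isAnomalyIndex_of_one_site fun i j => ?_
  rw [czxBlock_isFlip.stack₃, czxBlock_isFlip.eq i j]
  split_ifs with hij
  · rw [close_vecMulVec]
    congr 1
    -- Flipping the second qubit of `i` gives the normalization with the same component of `V` and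
    -- the same combination of `Vhat`, but with the opposite sign. That sign is the anomaly.
    have h2 := h1 (i.1, 1 - i.2)
    obtain ⟨a, b⟩ := i
    fin_cases a <;> fin_cases b <;>
      (norm_num [dotProduct, Fintype.sum_prod_type, Fin.sum_univ_two, czxLeft, Pi.single_apply]
        at h2 ⊢
       linear_combination -h2)
  · simp

end CZX

/-! ### Fusion and action tensors of flip tensors -/

section FlipReduction

variable {P χ : Type*} [Fintype P] [DecidableEq P] [Fintype χ] [DecidableEq χ]
  {T : P → P → Matrix χ χ ℂ} {σ : P → P} {u v : P → χ → ℂ}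

theorem vecMulVec_insert {m n k : Type*} [Fintype m] [Fintype n] (x : k → ℂ) (y w : m → ℂ)
    (y' x' : m → ℂ) (z : n → ℂ) (h : (y ⬝ᵥ w) * (y' ⬝ᵥ x') = y ⬝ᵥ x') :
    vecMulVec x y * vecMulVec w y' * vecMulVec x' z = vecMulVec x y * vecMulVec x' z := by
  simp only [Matrix.vecMulVec_mul_vecMulVec, smul_dotProduct, smul_eq_mul, h]

/-- All matrices of the double layer have rank one, so each condition on a fusion pair collapses to
an identity of scalar products. -/
theorem IsFlip.isFusionPair (h : IsFlip T σ u v) {V Vhat : χ × χ → ℂ} (unit : Vhat ⬝ᵥ V = 1)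
    (mid : ∀ s, (Vhat ⬝ᵥ fun q => u s q.1 * u (σ s) q.2) *
      ((fun q => v s q.1 * v (σ s) q.2) ⬝ᵥ V) = 1)
    (ins : ∀ s s', ((fun q : χ × χ => v s q.1 * v (σ s) q.2) ⬝ᵥ V) *
      (Vhat ⬝ᵥ fun q => u s' q.1 * u (σ s') q.2) =
        (fun q : χ × χ => v s q.1 * v (σ s) q.2) ⬝ᵥ fun q => u s' q.1 * u (σ s') q.2) :
    IsFusionPair T V Vhat := by
  set M : P × P → Matrix (χ × χ) (χ × χ) ℂ := fun p => MPUDomainWall.stack₂ T p.1 p.2 with hM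
  set N : P × P → Matrix Unit Unit ℂ := fun p => if p.1 = p.2 then 1 else 0 with hN
  have hst : ∀ s t, MPUDomainWall.stack₂ T s t = if s = t then
      vecMulVec (fun q => u s q.1 * u (σ s) q.2) (fun q => v s q.1 * v (σ s) q.2) else 0 := by
    intro s t
    rw [h.stack₂, h.eq]
    by_cases hs : s = t
    · rw [if_pos hs, if_pos (by rw [hs]), vecMulVec_kronecker_vecMulVec]
    · rw [if_neg hs, if_neg fun h0 => hs (by rw [← h.invol s, h0, h.invol]),
        Matrix.kronecker_zero]
  have hrow : ∀ X : Matrix (χ × χ) (χ × χ) ℂ,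
      (Matrix.replicateRow Unit Vhat * X * Matrix.replicateCol Unit V) () () =
        Vhat ⬝ᵥ (X *ᵥ V) := by
    intro X
    rw [Matrix.mul_assoc]
    rfl
  have hunit : Matrix.replicateRow Unit Vhat * Matrix.replicateCol Unit V = 1 := by
    ext
    simpa [Matrix.mul_apply, dotProduct] using unit
  have hmid : ∀ p, Matrix.replicateRow Unit Vhat * M p * Matrix.replicateCol Unit V = N p := by
    rintro ⟨s, t⟩
    ext
    rw [hrow]
    by_cases hs : s = t
    · subst hs
      simp only [hM, hN, if_true, h.fusion_apply, mid, Matrix.one_apply]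
    · simp [hM, hN, hst, hs]
  have hins : ∀ p q, M p * Matrix.replicateCol Unit V * Matrix.replicateRow Unit Vhat * M q =
      M p * M q := by
    rintro ⟨s, t⟩ ⟨s', t'⟩
    rw [Matrix.mul_assoc (M _), ← Matrix.vecMulVec_eq]
    simp only [hM, hst]
    split_ifs
    · exact vecMulVec_insert _ _ _ _ _ _ (ins s s')
    all_goals simp
  have hword : ∀ {l : ℕ} (s t : Fin l → P), word N l (fun k => (s k, t k)) =
      if s = t then 1 else 0 := by
    intro l s t
    split_ifs with hs
    · subst hs
      exact List.prod_eq_one (by simp [hN])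
    · obtain ⟨k, hk⟩ := Function.ne_iff.1 hs
      exact wordProd_eq_zero k (if_neg hk)
  refine ⟨fun l s t => ?_, fun l s t i j i' j' => ?_⟩
  · have := word_reduce hunit hmid hins fun k => (s k, t k)
    rw [hword] at this
    have h2 := congrFun (congrFun this ()) ()
    rw [hrow] at h2
    refine h2.trans ?_
    split_ifs <;> simp
  · have := word_insert hmid hins (i, j) (i', j') fun k => (s k, t k)
    rw [hword] at this
    refine this.trans ?_
    rw [Matrix.vecMulVec_eq Unit]
    simp only [hM]
    split_ifs <;> simp [Matrix.mul_assoc]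

theorem productTensor_eq (p s : P) :
    productTensor p s = if s = p then vecMulVec (fun _ => 1) (fun _ => 1) else 0 := by
  ext
  by_cases h : s = p <;> simp [productTensor, h, vecMulVec_apply]

theorem IsFlip.isActionPair (h : IsFlip T σ u v) {a b : P} (hab : σ a = b) {w what : χ → ℂ}
    (unit : what ⬝ᵥ w = 1) (mid : (what ⬝ᵥ u b) * (v b ⬝ᵥ w) = 1) (ins : v b ⬝ᵥ u b = 1) :
    IsActionPair T (productTensor a) (productTensor b)
      (Matrix.of fun q (_ : Unit) => w q.1) (Matrix.of fun (_ : Unit) q => what q.1) := by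
  have hM : ∀ s, MPUDomainWall.act T (productTensor a) s =
      if s = b then vecMulVec (fun q : χ × Unit => u b q.1) (fun q : χ × Unit => v b q.1)
        else 0 := by
    intro s
    rw [h.act, productTensor_eq]
    by_cases hs : s = b
    · subst hs
      rw [← hab, if_pos (h.invol a), if_pos rfl, vecMulVec_kronecker_vecMulVec]
      simp
    · rw [if_neg hs, if_neg fun h0 => hs (by rw [← h.invol s, h0, hab]), Matrix.kronecker_zero]
  have hW : (Matrix.of fun (q : χ × Unit) (_ : Unit) => w q.1) =
      vecMulVec (fun q => w q.1) fun _ => 1 := by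
    ext; simp [vecMulVec_apply]
  have hWhat : (Matrix.of fun (_ : Unit) (q : χ × Unit) => what q.1) =
      vecMulVec (fun _ => 1) fun q => what q.1 := by
    ext; simp [vecMulVec_apply]
  have hd : ∀ x y : χ → ℂ, ((fun q : χ × Unit => x q.1) ⬝ᵥ fun q => y q.1) = x ⬝ᵥ y := by
    intro x y
    simp [dotProduct, Fintype.sum_prod_type]
  have hunit : (Matrix.of fun (_ : Unit) (q : χ × Unit) => what q.1) *
      (Matrix.of fun (q : χ × Unit) (_ : Unit) => w q.1) = 1 := by
    rw [hW, hWhat, Matrix.vecMulVec_mul_vecMulVec, hd, unit]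
    ext
    simp [vecMulVec_apply]
  have hmid : ∀ s, (Matrix.of fun (_ : Unit) (q : χ × Unit) => what q.1) *
      MPUDomainWall.act T (productTensor a) s *
      (Matrix.of fun (q : χ × Unit) (_ : Unit) => w q.1) = productTensor b s := by
    intro s
    rw [hM, productTensor_eq]
    split_ifs
    · rw [hW, hWhat, Matrix.vecMulVec_mul_vecMulVec, Matrix.vecMulVec_mul_vecMulVec,
        smul_dotProduct, hd, hd, smul_eq_mul, mid, one_smul]
    · simp
  have hins : ∀ s s', MPUDomainWall.act T (productTensor a) s *
      (Matrix.of fun (q : χ × Unit) (_ : Unit) => w q.1) *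
      (Matrix.of fun (_ : Unit) (q : χ × Unit) => what q.1) *
      MPUDomainWall.act T (productTensor a) s' =
      MPUDomainWall.act T (productTensor a) s * MPUDomainWall.act T (productTensor a) s' := by
    intro s s'
    rw [hW, hWhat, Matrix.mul_assoc (MPUDomainWall.act T _ s), Matrix.vecMulVec_mul_vecMulVec]
    simp only [hM]
    split_ifs
    · have : ((fun _ : Unit => (1 : ℂ)) ⬝ᵥ fun _ : Unit => (1 : ℂ)) = 1 := by simp
      rw [this, one_smul]
      refine vecMulVec_insert _ _ _ _ _ _ ?_
      rw [hd, hd, hd, mul_comm, mid, ins]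
    all_goals simp
  exact ⟨fun l s => word_reduce hunit hmid hins s,
    fun l s i j => word_insert hmid hins i j s⟩

end FlipReduction

/-! ### Product states and their domain walls -/

section ProductStates

variable {P : Type*} [Fintype P] [DecidableEq P]

theorem productTensor_isLeftInverse (p : P) :
    IsLeftInverse (productTensor p) (productTensor p) := by
  intro a b c d
  rw [Finset.sum_eq_single p] <;> simp +contextual [productTensor]

theorem productTensor_annihilates {p q : P} (h : p ≠ q) :
    Annihilates (productTensor p) (productTensor q) := by
  intro a b c d
  refine Finset.sum_eq_zero fun s _ => ?_
  by_cases hs : s = p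
  · rw [hs, productTensor, productTensor, if_neg h, Matrix.zero_apply, mul_zero]
  · rw [productTensor, if_neg hs, Matrix.zero_apply, zero_mul]

theorem mps_productTensor (p : P) (N : ℕ) :
    mps (productTensor p) N = fun s => if s = fun _ => p then 1 else 0 := by
  funext s
  rw [mps]
  split_ifs with h
  · subst h
    rw [wordProd, List.prod_eq_one (by simp [productTensor])]
    simp
  · obtain ⟨k, hk⟩ := Function.ne_iff.1 h
    rw [wordProd_eq_zero k (if_neg hk), Matrix.trace_zero]

theorem siteProd_eq_one {m : Type*} [Fintype m] [DecidableEq m] {N : ℕ} {p : Fin N → Prop}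
    [DecidablePred p] {M : Fin N → Matrix m m ℂ} (h : ∀ k, p k → M k = 1) : siteProd p M = 1 :=
  List.prod_eq_one (by simpa using h)

theorem siteProd_eq_zero {m : Type*} [Fintype m] [DecidableEq m] {N : ℕ} {p : Fin N → Prop}
    [DecidablePred p] {M : Fin N → Matrix m m ℂ} (k : Fin N) (hk : p k) (h : M k = 0) :
    siteProd p M = 0 :=
  List.prod_eq_zero (by rw [← h]; exact List.mem_map.2 ⟨k, by simpa using hk, rfl⟩)

/-- The wall tensors are product tensors themselves: the left wall site still carries `p`, while the
right one already carries `q`. -/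
theorem pairState_productTensor (p q : P) {N : ℕ} {k l : Fin N} (hkl : k < l) :
    pairState (productTensor p) (productTensor q) (productTensor p) (productTensor q) k l =
      fun s => if s = fun x => if k < x ∧ x ≤ l then q else p then 1 else 0 := by
  funext s
  rw [pairState]
  split_ifs with h
  · subst h
    rw [siteProd_eq_one, siteProd_eq_one, siteProd_eq_one]
    · simp [productTensor, hkl]
    · intro x hx
      simp [productTensor, not_le.2 hx]
    · intro x hx
      simp [productTensor, hx.1, hx.2.le]
    · intro x hx
      simp [productTensor, not_lt.2 hx.le]
  · obtain ⟨x, hx⟩ := Function.ne_iff.1 h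
    rcases lt_trichotomy x k with h1 | rfl | h1
    · rw [siteProd_eq_zero x h1]
      · simp
      · rw [if_neg (by simp [not_lt.2 h1.le])] at hx
        exact if_neg hx
    · rw [if_neg (by simp)] at hx
      simp [productTensor, hx]
    · rcases lt_trichotomy x l with h2 | rfl | h2
      · rw [if_pos ⟨h1, h2.le⟩] at hx
        rw [siteProd_eq_zero (p := fun x => k < x ∧ x < l) x ⟨h1, h2⟩ (if_neg hx)]
        simp
      · rw [if_pos ⟨h1, le_rfl⟩] at hx
        simp [productTensor, hx]
      · rw [if_neg (by simp [not_le.2 h2])] at hx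
        rw [siteProd_eq_zero (p := fun x => l < x) x h2 (if_neg hx)]
        simp

end ProductStates

/-- The CZX symmetry with two qubits per site, exchanging two product states. -/
def czxSystem : DWData (Fin 2 × Fin 2) (Fin 2) Unit Unit where
  T := blockTwo czxTensor
  -- `Vhat` evaluates the left legs of the double layer at `s` to `(-1) ^ s.2`; the relative sign in
  -- `V` compensates this.
  V := Pi.single (0, 1) 1 - Pi.single (1, 0) 1
  Vhat := Pi.single (0, 1) 1
  A := productTensor (0, 0)
  B := productTensor (1, 1)
  Ahat := productTensor (0, 0)
  Bhat := productTensor (1, 1)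
  WB := Matrix.of fun q _ => (Pi.single 1 1 : Fin 2 → ℂ) q.1
  WhatB := Matrix.of fun _ q => (Pi.single 1 1 : Fin 2 → ℂ) q.1
  WA := Matrix.of fun q _ => (Pi.single 0 1 : Fin 2 → ℂ) q.1
  WhatA := Matrix.of fun _ q => (Pi.single 0 1 : Fin 2 → ℂ) q.1
  eAB := productTensor (0, 0)
  eBA := productTensor (1, 1)

theorem productTensor_ne_zero {P : Type*} [DecidableEq P] (p : P) : productTensor p ≠ 0 := by
  intro h
  have := congrFun (congrFun (congrFun h p) ()) ()
  simp [productTensor] at this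

theorem czxBlock_mulVec_constant (p q : Fin 2) (hpq : 1 - p = q) (N : ℕ) (hN : 0 < N) :
    mpo (blockTwo czxTensor) N *ᵥ mps (productTensor (p, p)) N = mps (productTensor (q, q)) N := by
  have : NeZero N := ⟨hN.ne'⟩
  rw [mps_productTensor, mps_productTensor, czxBlock_isFlip.mpo_mulVec]
  subst hpq
  rw [Finset.prod_eq_one, one_smul]
  · rfl
  · intro k _
    fin_cases p <;> norm_num [czxLeft]

theorem czxSystem_isDomainWallSystem : czxSystem.IsDomainWallSystem where
  injective_T := czxBlock_injective
  unitary := czxBlock_isMPU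
  order_two := czxBlock_order_two
  fusion := by
    refine czxBlock_isFlip.isFusionPair ?_ ?_ ?_
    · simp [czxSystem]
    · rintro ⟨a, b⟩
      fin_cases a <;> fin_cases b <;>
        norm_num [czxSystem, czxLeft, dotProduct, Fintype.sum_prod_type, Fin.sum_univ_two,
          Pi.single_apply]
    · rintro ⟨a, b⟩ ⟨c, d⟩
      fin_cases a <;> fin_cases b <;> fin_cases c <;> fin_cases d <;>
        norm_num [czxSystem, czxLeft, dotProduct, Fintype.sum_prod_type, Fin.sum_univ_two,
          Pi.single_apply]
  left_inverse_A := productTensor_isLeftInverse _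
  left_inverse_B := productTensor_isLeftInverse _
  separate_AB := productTensor_annihilates (by decide)
  separate_BA := productTensor_annihilates (by decide)
  map_A := czxBlock_mulVec_constant 0 1 rfl
  map_B := czxBlock_mulVec_constant 1 0 rfl
  action_B := czxBlock_isFlip.isActionPair rfl (by simp) (by norm_num [czxLeft])
    (by norm_num [czxLeft])
  action_A := czxBlock_isFlip.isActionPair rfl (by simp) (by norm_num [czxLeft])
    (by norm_num [czxLeft])
  eAB_ne_zero := productTensor_ne_zero _
  eBA_ne_zero := productTensor_ne_zero _
  map_pair := by
    -- Product states need no separation of the walls; the factor is the product of signs coming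
    -- from `IsFlip.mpo_mulVec`.
    refine ⟨0, fun N k l hkl _ _ => ?_⟩
    have : NeZero N := ⟨(Nat.zero_le _).trans_lt k.2 |>.ne'⟩
    simp only [czxSystem]
    rw [pairState_productTensor _ _ hkl, pairState_productTensor _ _ hkl,
      czxBlock_isFlip.mpo_mulVec]
    refine ⟨_, congrArg _ ?_⟩
    funext s
    congr 2
    funext x
    simp only [Function.comp_apply]
    split_ifs <;> rfl

/-! ### Domain wall systems -/

namespace DWData

variable {P χ α β : Type*} [Fintype P] [DecidableEq P] [Fintype χ] [DecidableEq χ]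
  [Fintype α] [DecidableEq α] [Fintype β] [DecidableEq β] {S : DWData P χ α β}

theorem IsDomainWallSystem.exists_anomaly (h : S.IsDomainWallSystem) :
    ∃ ω, S.IsAnomaly ω ∧ (∀ ω', S.IsAnomaly ω' → ω' = ω) ∧ (ω = 1 ∨ ω = -1) ∧
      ∀ cAB cBA, S.IsCAB cAB → S.IsCBA cBA → cAB * cBA = ω := by
  obtain ⟨That, hThat⟩ := h.injective_T
  have hT := hThat.spanning
  -- A nonzero entry of the wall tensor shows that both bond spaces are nonempty, which is needed to
  -- find nonzero words of `A` and `B`.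
  obtain ⟨p, hp⟩ := Function.ne_iff.1 h.eAB_ne_zero
  obtain ⟨a, b, hab⟩ : ∃ a b, S.eAB p a b ≠ 0 := by
    by_contra! h0
    exact hp (Matrix.ext h0)
  have : Nonempty α := ⟨a⟩
  have : Nonempty β := ⟨b⟩
  have := h.fusion.nonempty
  obtain ⟨ω, hω⟩ := h.fusion.exists_one_site hT
  have hω' := h.fusion.isAnomalyIndex_of_one_site hω
  refine ⟨ω, hω', fun ω' h' => IsAnomalyIndex.unique hT h' hω', ?_, fun cAB cBA h₁ h₂ => ?_⟩
  · exact mul_self_eq_one_iff.1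
      (anomaly_mul_self h.fusion h.spanning_A h.spanning_B h.reduces_B h.reduces_A hω)
  · exact mul_eq_anomaly h.fusion h.spanning_A h.spanning_B h.reduces_B h.reduces_A hω
      h.eAB_ne_zero h₁ h₂

theorem LocalRules.exchange_A {cAB cBA : ℂ} (h : S.LocalRules cAB cBA) {L : ℕ} {i j : Fin L}
    (hji : (j : ℕ) + 2 ≤ i) (hi : (i : ℕ) + 5 ≤ L) (x y : χ) (a a' : α) :
    S.halfOp j x *ᵥ (S.halfOp i y *ᵥ openMPS S.A L a a') =
      cAB • S.halfOp i x *ᵥ (S.halfOp j y *ᵥ openMPS S.A L a a') := by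
  have e : openMPS S.A L a a' = fun s => word S.A L s a a' := rfl
  simp only [e, halfOp_mulVec, h.halfAct_halfAct hji hi]
  rfl

/-- The endpoint operators are symmetric under interchanging the two ground states, so this is the
swapped form of the exchange on `A`. -/
theorem LocalRules.exchange_B {cAB cBA : ℂ} (h : S.LocalRules cAB cBA) {L : ℕ} {i j : Fin L}
    (hji : (j : ℕ) + 2 ≤ i) (hi : (i : ℕ) + 5 ≤ L) (x y : χ) (b b' : β) :
    S.halfOp j x *ᵥ (S.halfOp i y *ᵥ openMPS S.B L b b') =
      cBA • S.halfOp i x *ᵥ (S.halfOp j y *ᵥ openMPS S.B L b b') := by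
  have := h.swap.exchange_A hji hi x y b b'
  simp only [swap_halfOp] at this
  exact this

theorem LocalRules.double_exchange {cAB cBA : ℂ} (h : S.LocalRules cAB cBA) {L : ℕ}
    {i j k : Fin L} (hkj : (k : ℕ) + 2 ≤ j) (hji : (j : ℕ) + 4 ≤ i) (hi : (i : ℕ) + 6 ≤ L)
    (x y z : χ) (a a' : α) :
    S.halfOp k z *ᵥ (S.halfOp i y *ᵥ (S.halfOp j x *ᵥ openMPS S.A L a a')) =
      cBA • S.halfOp i z *ᵥ (S.halfOp k y *ᵥ (S.halfOp j x *ᵥ openMPS S.A L a a')) := by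
  have e : openMPS S.A L a a' = fun s => word S.A L s a a' := rfl
  simp only [e, halfOp_mulVec, h.halfAct_halfAct_halfAct hkj hji hi]
  rfl

theorem LocalRules.nested_pairs {cAB cBA : ℂ} (h : S.LocalRules cAB cBA) {N : ℕ}
    {i₁ j₁ i₂ j₂ : Fin N} (hi : (i₂ : ℕ) + 2 ≤ i₁) (hm : (i₁ : ℕ) + 4 ≤ j₁)
    (hj : (j₁ : ℕ) + 2 ≤ j₂) :
    S.pairOp i₂ j₂ *ᵥ (S.pairOp i₁ j₁ *ᵥ mps S.A N) =
      (cAB * cBA) • S.pairOp i₁ j₁ *ᵥ (S.pairOp i₂ j₂ *ᵥ mps S.A N) := by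
  have e : mps S.A N = fun s => (word S.A N s).trace := rfl
  simp only [e, pairOp_mulVec_trace, h.pairAct_pairAct hi hm hj]
  funext s
  simp

theorem pairState_smul_right {A : P → Matrix α α ℂ} {B : P → Matrix β β ℂ} {e : P → Matrix α β ℂ}
    {f : P → Matrix β α ℂ} (r : ℂ) {N : ℕ} (k l : Fin N) :
    pairState A B e (fun p => r • f p) k l = r • pairState A B e f k l := by
  funext s
  simp [pairState]

theorem pairState_smul_left {A : P → Matrix α α ℂ} {B : P → Matrix β β ℂ} {e : P → Matrix α β ℂ}
    {f : P → Matrix β α ℂ} (r : ℂ) {N : ℕ} (k l : Fin N) :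
    pairState A B (fun p => r • e p) f k l = r • pairState A B e f k l := by
  funext s
  simp [pairState]

/-- Both pair states contain `eBA` exactly once, so `map_pair` persists with the same factors. -/
theorem IsDomainWallSystem.rescale (h : S.IsDomainWallSystem) {r : ℂ} (hr : r ≠ 0) :
    (S.rescale r).IsDomainWallSystem :=
  { h with
    eBA_ne_zero := smul_ne_zero hr h.eBA_ne_zero
    map_pair := by
      obtain ⟨R, hR⟩ := h.map_pair
      refine ⟨R, fun N k l hkl h₁ h₂ => ?_⟩
      obtain ⟨c, hc⟩ := hR N k l hkl h₁ h₂
      refine ⟨c, ?_⟩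
      simp only [DWData.rescale, pairState_smul_right, pairState_smul_left, Matrix.mulVec_smul, hc]
      exact smul_comm _ _ _ }

theorem IsCAB.rescale {cAB c r : ℂ} (h : S.IsCAB cAB) (hc : c * r = cAB) :
    (S.rescale r).IsCAB c := by
  intro i j k
  simp only [DWData.rescale, Matrix.mul_smul, Matrix.smul_mul, smul_smul, hc]
  exact h i j k

theorem IsCBA.rescale {cBA c r : ℂ} (h : S.IsCBA cBA) (hc : r * cBA = c) :
    (S.rescale r).IsCBA c := by
  intro i j k
  simp only [DWData.rescale, act_smul, Matrix.mul_smul, Matrix.smul_mul, ← hc, mul_smul]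
  exact congrArg _ (h i j k)

end DWData

end MPUDomainWall

end

theorem mainTheorem2 {P χ α β : Type*} [Fintype P] [DecidableEq P] [Fintype χ] [DecidableEq χ]
    [Fintype α] [DecidableEq α] [Fintype β] [DecidableEq β]
    (S : MPUDomainWall.DWData P χ α β) (hS : S.IsDomainWallSystem) :
    -- the anomaly index and the domain wall factors are well defined
    (∃! ω : ℂ, S.IsAnomaly ω) ∧ (∃! c : ℂ, S.IsCAB c) ∧ (∃! c : ℂ, S.IsCBA c) ∧
    (∀ ω cAB cBA : ℂ, S.IsAnomaly ω → S.IsCAB cAB → S.IsCBA cBA →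
      (ω = 1 ∨ ω = -1) ∧ cAB * cBA = ω ∧
      -- exchange of two domain walls, on top of `A` and on top of `B`
      (∀ (L : ℕ) (i j : Fin L), (j : ℕ) + 2 ≤ i → (i : ℕ) + 5 ≤ L → ∀ x y : χ,
        (∀ a a' : α,
          (S.halfOp j x).mulVec ((S.halfOp i y).mulVec (MPUDomainWall.openMPS S.A L a a')) =
          cAB • (S.halfOp i x).mulVec
            ((S.halfOp j y).mulVec (MPUDomainWall.openMPS S.A L a a'))) ∧
        (∀ b b' : β,
          (S.halfOp j x).mulVec ((S.halfOp i y).mulVec (MPUDomainWall.openMPS S.B L b b')) =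
          cBA • (S.halfOp i x).mulVec
            ((S.halfOp j y).mulVec (MPUDomainWall.openMPS S.B L b b')))) ∧
      -- double exchange of three domain walls
      (∀ (L : ℕ) (i j k : Fin L), (k : ℕ) + 2 ≤ j → (j : ℕ) + 4 ≤ i → (i : ℕ) + 6 ≤ L →
        ∀ (x y z : χ) (a a' : α),
          (S.halfOp k z).mulVec ((S.halfOp j y).mulVec
              ((S.halfOp i x).mulVec (MPUDomainWall.openMPS S.A L a a'))) =
            cAB • (S.halfOp k z).mulVec ((S.halfOp i y).mulVec
              ((S.halfOp j x).mulVec (MPUDomainWall.openMPS S.A L a a'))) ∧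
          (S.halfOp k z).mulVec ((S.halfOp j y).mulVec
              ((S.halfOp i x).mulVec (MPUDomainWall.openMPS S.A L a a'))) =
            ω • (S.halfOp i z).mulVec ((S.halfOp k y).mulVec
              ((S.halfOp j x).mulVec (MPUDomainWall.openMPS S.A L a a')))) ∧
      -- nested pairs of domain walls
      (∀ (N : ℕ) (i₁ j₁ i₂ j₂ : Fin N),
        (i₂ : ℕ) + 2 ≤ i₁ → (i₁ : ℕ) + 4 ≤ j₁ → (j₁ : ℕ) + 2 ≤ j₂ →
          (S.pairOp i₁ j₁).mulVec ((S.pairOp i₂ j₂).mulVec (MPUDomainWall.mps S.A N)) =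
            ω • (S.pairOp i₂ j₂).mulVec
              ((S.pairOp i₁ j₁).mulVec (MPUDomainWall.mps S.A N))) ∧
      -- in the anomalous case a rescaling of `e_BA` makes every exchange phase equal to `i`
      (ω = -1 → ∃ r : ℂ, r ≠ 0 ∧ ‖r‖ = ‖cAB‖ ∧
        (S.rescale r).IsDomainWallSystem ∧
        (S.rescale r).IsCAB Complex.I ∧ (S.rescale r).IsCBA Complex.I ∧
        ∀ (L : ℕ) (i j : Fin L), (j : ℕ) + 2 ≤ i → (i : ℕ) + 5 ≤ L → ∀ x y : χ,
          (∀ a a' : α,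
            ((S.rescale r).halfOp j x).mulVec
                (((S.rescale r).halfOp i y).mulVec (MPUDomainWall.openMPS S.A L a a')) =
              Complex.I • ((S.rescale r).halfOp i x).mulVec
                (((S.rescale r).halfOp j y).mulVec (MPUDomainWall.openMPS S.A L a a'))) ∧
          (∀ b b' : β,
            ((S.rescale r).halfOp j x).mulVec
                (((S.rescale r).halfOp i y).mulVec (MPUDomainWall.openMPS S.B L b b')) =
              Complex.I • ((S.rescale r).halfOp i x).mulVec
                (((S.rescale r).halfOp j y).mulVec (MPUDomainWall.openMPS S.B L b b'))))) ∧
    -- the CZX symmetry, two qubits per site, exchanging `|0…0⟩` and `|1…1⟩`, is an anomalous case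
    (∀ (N : ℕ) [NeZero N],
      MPUDomainWall.mpo MPUDomainWall.czxTensor N = MPUDomainWall.czxOperator N) ∧
    (∃ S₀ : MPUDomainWall.DWData (Fin 2 × Fin 2) (Fin 2) Unit Unit,
      S₀.IsDomainWallSystem ∧
      S₀.T = MPUDomainWall.blockTwo MPUDomainWall.czxTensor ∧
      S₀.A = MPUDomainWall.productTensor (0, 0) ∧ S₀.B = MPUDomainWall.productTensor (1, 1)) ∧
    (∀ S₀ : MPUDomainWall.DWData (Fin 2 × Fin 2) (Fin 2) α β, S₀.IsDomainWallSystem →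
      S₀.T = MPUDomainWall.blockTwo MPUDomainWall.czxTensor → S₀.IsAnomaly (-1)) := by
  obtain ⟨ω₀, hω₀, hu, hone, hmul⟩ := hS.exists_anomaly
  refine ⟨⟨ω₀, hω₀, hu⟩, hS.existsUnique_cAB_cBA.1, hS.existsUnique_cAB_cBA.2, ?_,
    MPUDomainWall.mpo_czxTensor,
    ⟨MPUDomainWall.czxSystem, MPUDomainWall.czxSystem_isDomainWallSystem, rfl, rfl, rfl⟩, ?_⟩
  · intro ω cAB cBA hω h₁ h₂
    obtain rfl := hu ω hω
    have hrules := hS.localRules h₁ h₂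
    have hc := hmul cAB cBA h₁ h₂
    refine ⟨hone, hc, fun L i j hji hi x y => ⟨hrules.exchange_A hji hi x y,
      hrules.exchange_B hji hi x y⟩, fun L i j k hkj hji hi x y z a a' => ?_,
      fun N i₁ j₁ i₂ j₂ hi hm hj => ?_, fun hω' => ?_⟩
    · have h := hrules.exchange_A (i := i) (j := j) (by omega) (by omega) y x a a'
      have h' : (S.halfOp k z).mulVec ((S.halfOp j y).mulVec
            ((S.halfOp i x).mulVec (MPUDomainWall.openMPS S.A L a a'))) =
          cAB • (S.halfOp k z).mulVec ((S.halfOp i y).mulVec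
            ((S.halfOp j x).mulVec (MPUDomainWall.openMPS S.A L a a'))) := by
        rw [h, Matrix.mulVec_smul]
      refine ⟨h', ?_⟩
      rw [h', hrules.double_exchange hkj hji hi, smul_smul, hc]
    -- The nested relation is available with the two sides interchanged, and `ω` is its own inverse.
    · rw [hrules.nested_pairs hi hm hj, hc, smul_smul, mul_self_eq_one_iff.2 hone, one_smul]
    · have hne : cAB ≠ 0 := by
        rintro rfl
        rw [zero_mul, hω'] at hc
        norm_num at hc
      -- The new factors are `cAB / r` and `r * cBA`. The first equals `i` exactly for `r = -i *
      -- cAB`, and then so does the second because `cAB * cBA = -1`.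
      have hr : -Complex.I * cAB ≠ 0 := mul_ne_zero (neg_ne_zero.2 Complex.I_ne_zero) hne
      have h₁' := h₁.rescale (c := Complex.I) (r := -Complex.I * cAB) (by
        rw [← mul_assoc, mul_neg, Complex.I_mul_I, neg_neg, one_mul])
      have h₂' := h₂.rescale (c := Complex.I) (r := -Complex.I * cAB) (by
        rw [mul_assoc, hc, hω', mul_neg, mul_one, neg_neg])
      have hrules' := (hS.rescale hr).localRules h₁' h₂'
      exact ⟨_, hr, by simp, hS.rescale hr, h₁', h₂', fun L i j hji hi x y =>
        ⟨hrules'.exchange_A hji hi x y, hrules'.exchange_B hji hi x y⟩⟩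
  · intro S₀ hS₀ hT
    have h := hS₀.fusion
    rw [hT] at h
    have h' := MPUDomainWall.czxBlock_isAnomalyIndex h
    rw [← hT] at h'
    exact h'
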